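/- Conventions. Logarithms are natural (another base multiplies all quantities below by the same positive constant). For probability mass functions (PMFs) $P,Q$ on a finite set, $D(P\|Q)=\sum_x P(x)\log\frac{P(x)}{Q(x)}$ with $0\log\frac0q=0$ and $p\log\frac p0=\infty$ for $p>0$; for $\alpha>0$, $\alpha\neq1$, $D_\alpha(P\|Q)=\frac1{\alpha-1}\log\sum_x P(x)^\alpha Q(x)^{1-\alpha}$, where for $\alpha>1$ the summand is read as $P(x)^\alpha/Q(x)^{\alpha-1}$ with $\frac00=0$ and $\frac p0=\infty$ for $p>0$; and $D_1=D$. For random variables $X,Y$ on finite sets $\mathcal X,\mathcal Y$ with joint PMF $P_{XY}$ and for $\alpha>0$, let $J_\alpha(X;Y)=\min_{Q_X,Q_Y}D_\alpha(P_{XY}\|Q_XQ_Y)$, where $Q_X$ and $Q_Y$ range over all PMFs on $\mathcal X$ and $\mathcal Y$. For a joint PMF $R_{XY}$ with marginals $R_X,R_Y$ let $I_{R_{XY}}(X;Y)=D(R_{XY}\|R_XR_Y)$, and let $I(X;Y)=I_{P_{XY}}(X;Y)$. Let $H_\beta(X)=\frac1{1-\beta}\log\sum_xP_X(x)^\beta$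 for $\beta>0$, $\beta\ne1$, $H_1(X)=\sum_xP_X(x)\log\frac1{P_X(x)}$, and $H_\infty(X)=-\log\max_xP_X(x)$. Theorem. Let $X,X_1,X_2,Y,Y_1,Y_2,Z$ be random variables on finite sets, defined on a common probability space. For all $\alpha>0$ the minimum defining $J_\alpha(X;Y)$ is attained, and: 1. $J_\alpha(X;Y)\ge0$, with equality if and only if $X$ and $Y$ are independent. 2. $J_\alpha(X;Y)=J_\alpha(Y;X)$. 3. $J_\alpha(X;Z)\le J_\alpha(X;Y)$ if $X,Y,Z$ form a Markov chain (in this order). 4. $J_\alpha(X_1,X_2;Y_1,Y_2)=J_\alpha(X_1;Y_1)+J_\alpha(X_2;Y_2)$ if the pairs $(X_1,Y_1)$ and $(X_2,Y_2)$ are independent. 5. $J_\alpha(X;Y)\le\log|\mathcal X|$ and $J_\alpha(X;Y)\le\log|\mathcal Y|$. 6. $J_1(X;Y)=I(X;Y)$. 7. $\alpha\mapsto J_\alpha(X;Y)$ is continuous and nondecreasing on $(0,\infty)$. 8. For $\alpha>0$, $\alpha\ne1$, $$J_\alpha(X;Y)=\min_{Q_X}\frac{\alpha}{\alpha-1}\log\sum_{y\in\mathcal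 Y}\Big[\sum_{x\in\mathcal X}P_{XY}(x,y)^\alpha Q_X(x)^{1-\alpha}\Big]^{1/\alpha},$$ where the minimum is over all PMFs $Q_X$ on $\mathcal X$ (with the conventions above). If moreover $\alpha\ge\frac12$, the objective is a convex function of $Q_X$, with values in $(-\infty,\infty]$. 9. For $\alpha\in(0,1)$, $J_\alpha(X;Y)=\min_{R_{XY}}\big[I_{R_{XY}}(X;Y)+\frac{\alpha}{1-\alpha}D(R_{XY}\|P_{XY})\big]$, over all joint PMFs $R_{XY}$ on $\mathcal X\times\mathcal Y$. 10. For $\alpha>1$, $J_\alpha(X;Y)=\max_{R_{XY}}\big[I_{R_{XY}}(X;Y)+\frac{\alpha}{1-\alpha}D(R_{XY}\|P_{XY})\big]$, over all joint PMFs $R_{XY}$. The expression in brackets, with values in $[-\infty,\infty)$, is concave in $R_{XY}$, and strictly concave on the set where it is finite. A joint PMF $R_{XY}$ maximizes it if and only if its value at $R_{XY}$ equals $D_\alpha(P_{XY}\|R_XR_Y)$. 11. For $\alpha\ge1$ and a fixed conditional PMF $P_{Y|X}$, $J_\alpha(X;Y)$ is concave in $P_X$. 12. $J_\alpha(X;X)=H_{\frac{\alpha}{2\alpha-1}}(X)$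 if $\alpha>\frac12$, and $J_\alpha(X;X)=\frac{\alpha}{1-\alpha}H_\infty(X)$ if $\alpha\in(0,\frac12]$. -/

import Mathlib

open MeasureTheory ProbabilityTheory

namespace RenyiDep

/-! Probability mass functions on a finite set `ι` are the elements of `stdSimplex ℝ ι`.
Logarithms are natural. -/

noncomputable section

/-- The probability mass function of a random variable `X`, that is `x ↦ P(X = x)`. -/
def pmf {Ω ι : Type*} [MeasurableSpace Ω] (μ : Measure Ω) (X : Ω → ι) : ι → ℝ :=
  fun x => μ.real (X ⁻¹' {x})

/-- The joint probability mass function of a pair of random variables. -/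
def jointPmf {Ω 𝒳 𝒴 : Type*} [MeasurableSpace Ω] (μ : Measure Ω) (X : Ω → 𝒳) (Y : Ω → 𝒴) :
    𝒳 × 𝒴 → ℝ :=
  pmf μ (fun ω => (X ω, Y ω))

/-- `X`, `Y`, `Z` form a Markov chain:
`P(x, y, z) P(y) = P(x, y) P(y, z)` for all `x`, `y`, `z`. -/
def IsMarkovChain {Ω 𝒳 𝒴 𝒵 : Type*} [MeasurableSpace Ω] (μ : Measure Ω)
    (X : Ω → 𝒳) (Y : Ω → 𝒴) (Z : Ω → 𝒵) : Prop :=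
  ∀ x y z, pmf μ (fun ω => (X ω, Y ω, Z ω)) (x, y, z) * pmf μ Y y
    = jointPmf μ X Y (x, y) * jointPmf μ Y Z (y, z)

/-- The product `(x, y) ↦ Q_X(x) Q_Y(y)`. -/
def prodPmf {𝒳 𝒴 : Type*} (QX : 𝒳 → ℝ) (QY : 𝒴 → ℝ) : 𝒳 × 𝒴 → ℝ :=
  fun p => QX p.1 * QY p.2

/-- The first marginal. -/
def margFst {𝒳 𝒴 : Type*} [Fintype 𝒴] (R : 𝒳 × 𝒴 → ℝ) : 𝒳 → ℝ :=
  fun x => ∑ y, R (x, y)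

/-- The second marginal. -/
def margSnd {𝒳 𝒴 : Type*} [Fintype 𝒳] (R : 𝒳 × 𝒴 → ℝ) : 𝒴 → ℝ :=
  fun y => ∑ x, R (x, y)

/-- Relative entropy `D(P‖Q) = ∑ P(x) log (P(x) / Q(x))`, extended-real valued.
The arithmetic of `ℝ≥0∞` and `EReal` gives `0 log (0 / q) = 0` and `p log (p / 0) = ∞`
for `p > 0`. -/
def relEntropy {ι : Type*} [Fintype ι] (P Q : ι → ℝ) : EReal :=
  ∑ x, (P x : EReal) * ENNReal.log (ENNReal.ofReal (P x) / ENNReal.ofReal (Q x))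

open Classical in
/-- Rényi divergence `D_α(P‖Q) = (α - 1)⁻¹ log ∑ P(x)^α Q(x)^(1-α)`, extended-real valued, with
`D_1 = D`. In `ℝ≥0∞` the negative powers of `0` are `∞` and `0 * ∞ = 0`, so for `α > 1` one has
`P(x)^α Q(x)^(1-α) = P(x)^α / Q(x)^(α-1)` with `0 / 0 = 0` and `p / 0 = ∞`. -/
def renyiDiv {ι : Type*} [Fintype ι] (α : ℝ) (P Q : ι → ℝ) : EReal :=
  if α = 1 then relEntropy P Q
  else (((α - 1)⁻¹ : ℝ) : EReal) *
    ENNReal.log (∑ x, ENNReal.ofReal (P x) ^ α * ENNReal.ofReal (Q x) ^ (1 - α))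

/-- `J_α` of a joint probability mass function `P`: the minimum of `D_α(P‖Q_X Q_Y)` over all
probability mass functions `Q_X` and `Q_Y`. -/
def renyiJ {𝒳 𝒴 : Type*} [Fintype 𝒳] [Fintype 𝒴] (α : ℝ) (P : 𝒳 × 𝒴 → ℝ) : EReal :=
  ⨅ QX ∈ stdSimplex ℝ 𝒳, ⨅ QY ∈ stdSimplex ℝ 𝒴, renyiDiv α P (prodPmf QX QY)

/-- `J_α(X;Y)` of two random variables. -/
def renyiJRV {Ω 𝒳 𝒴 : Type*} [MeasurableSpace Ω] [Fintype 𝒳] [Fintype 𝒴] (μ : Measure Ω)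
    (α : ℝ) (X : Ω → 𝒳) (Y : Ω → 𝒴) : EReal :=
  renyiJ α (jointPmf μ X Y)

/-- The mutual information of a joint probability mass function `R`: `D(R‖R_X R_Y)`. -/
def mutualInfo {𝒳 𝒴 : Type*} [Fintype 𝒳] [Fintype 𝒴] (R : 𝒳 × 𝒴 → ℝ) : EReal :=
  relEntropy R (prodPmf (margFst R) (margSnd R))

/-- `α / (α - 1) * log ∑ y, (∑ x, P(x,y)^α Q_X(x)^(1-α))^(1/α)`, with the same conventions
as in the Rényi divergence. -/
def reducedObjective {𝒳 𝒴 : Type*} [Fintype 𝒳] [Fintype 𝒴] (α : ℝ) (P : 𝒳 × 𝒴 → ℝ)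
    (QX : 𝒳 → ℝ) : EReal :=
  ((α / (α - 1) : ℝ) : EReal) *
    ENNReal.log (∑ y, (∑ x, ENNReal.ofReal (P (x, y)) ^ α *
      ENNReal.ofReal (QX x) ^ (1 - α)) ^ (1 / α))

/-- `I_R(X;Y) + α / (1 - α) * D(R‖P)`. -/
def dualObjective {𝒳 𝒴 : Type*} [Fintype 𝒳] [Fintype 𝒴] (α : ℝ) (P R : 𝒳 × 𝒴 → ℝ) : EReal :=
  mutualInfo R + ((α / (1 - α) : ℝ) : EReal) * relEntropy R P

open Classical in
/-- Rényi entropy of order `β` (Shannon entropy for `β = 1`). -/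
def renyiEntropy {ι : Type*} [Fintype ι] (β : ℝ) (P : ι → ℝ) : ℝ :=
  if β = 1 then ∑ x, P x * Real.log (1 / P x)
  else 1 / (1 - β) * Real.log (∑ x, P x ^ β)

/-- Rényi entropy of order `∞`: `- log max_x P(x)`. -/
def minEntropy {ι : Type*} (P : ι → ℝ) : ℝ :=
  -Real.log (⨆ x, P x)

/-- Convexity for functions with values in `(-∞, ∞]`. -/
def EConvexOn {E : Type*} [AddCommGroup E] [Module ℝ E] (s : Set E) (f : E → EReal) : Prop :=
  Convex ℝ s ∧ ∀ ⦃x⦄, x ∈ s → ∀ ⦃y⦄, y ∈ s → ∀ ⦃a b : ℝ⦄, 0 ≤ a → 0 ≤ b → a + b = 1 →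
    f (a • x + b • y) ≤ (a : EReal) * f x + (b : EReal) * f y

/-- Concavity for functions with values in `[-∞, ∞)`. -/
def EConcaveOn {E : Type*} [AddCommGroup E] [Module ℝ E] (s : Set E) (f : E → EReal) : Prop :=
  Convex ℝ s ∧ ∀ ⦃x⦄, x ∈ s → ∀ ⦃y⦄, y ∈ s → ∀ ⦃a b : ℝ⦄, 0 ≤ a → 0 ≤ b → a + b = 1 →
    (a : EReal) * f x + (b : EReal) * f y ≤ f (a • x + b • y)

/-- Strict concavity for functions with values in `[-∞, ∞)`: concavity, with strict inequality
between any two distinct points where the function is not `-∞`. -/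
def EStrictConcaveOn {E : Type*} [AddCommGroup E] [Module ℝ E] (s : Set E) (f : E → EReal) :
    Prop :=
  EConcaveOn s f ∧ ∀ ⦃x⦄, x ∈ s → f x ≠ ⊥ → ∀ ⦃y⦄, y ∈ s → f y ≠ ⊥ → x ≠ y →
    ∀ ⦃a b : ℝ⦄, 0 < a → 0 < b → a + b = 1 →
      (a : EReal) * f x + (b : EReal) * f y < f (a • x + b • y)

end

end RenyiDep

open RenyiDep

/-! For `α ≠ 1`, let `S` be the normalization of `P ^ α * Q ^ (1 - α)`. The Pythagorean identity
`D(R‖Q) + α / (1 - α) * D(R‖P) = D_α(P‖Q) + (1 - α)⁻¹ * D(R‖S)` shows that `D_α(P‖Q)` is the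
minimum (`α < 1`) or the maximum (`1 < α`) over `R` of its left-hand side. For `Q = Q_X Q_Y` the
minimum of `D(R‖Q)` over `Q_X` and `Q_Y` is `I_R(X;Y)`, attained at the marginals of `R`. This
gives the formula for `α < 1` by exchanging two minima. For `1 < α` the normalization `S` at an
optimal pair `(Q_X, Q_Y)` has marginals `Q_X` and `Q_Y`, and hence attains the maximum.

The dual objectives are monotone and continuous in `α`, and `J_α` inherits this. Sibson's identity
`D_α(P‖Q_X Q_Y) = f(Q_X) + D_α(E‖Q_Y)`, in which `E` does not depend on `Q_Y`, eliminates `Q_Y`;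
the reduced objective `f` yields the convexity, the concavity in `P_X` and the self-information.
-/

namespace RenyiDep

/-- The relative entropy as a real number. It equals `relEntropy P Q` if `P` vanishes wherever `Q`
does; otherwise it is a junk value, because `p / 0 = 0`. -/
noncomputable def relEntropyReal {ι : Type*} [Fintype ι] (P Q : ι → ℝ) : ℝ :=
  ∑ x, P x * Real.log (P x / Q x)

/-- The probability mass function proportional to a nonnegative weight. -/
noncomputable def normalized {ι : Type*} [Fintype ι] (w : ι → ℝ) : ι → ℝ :=
  fun x => w x / ∑ y, w y

/-- The weight `P ^ α * Q ^ (1 - α)`, whose total mass defines the Rényi divergence and whose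
normalization solves the variational problem for the latter. -/
noncomputable def tilt {ι : Type*} (α : ℝ) (P Q : ι → ℝ) : ι → ℝ :=
  fun x => P x ^ α * Q x ^ (1 - α)

/-- The sum inside the logarithm of the Rényi divergence, possibly infinite if `1 < α`. -/
noncomputable def renyiSum {ι : Type*} [Fintype ι] (α : ℝ) (P Q : ι → ℝ) : ENNReal :=
  ∑ x, ENNReal.ofReal (P x) ^ α * ENNReal.ofReal (Q x) ^ (1 - α)

section ExtendedReal

variable {κ : Type*} {s : Finset κ}

theorem coe_sum (s : Finset κ) (f : κ → ℝ) :
    ((∑ x ∈ s, f x : ℝ) : EReal) = ∑ x ∈ s, (f x : EReal) :=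
  map_sum (⟨⟨Real.toEReal, EReal.coe_zero⟩, EReal.coe_add⟩ : ℝ →+ EReal) f s

theorem sum_ne_bot {f : κ → EReal} (hf : ∀ x ∈ s, f x ≠ ⊥) : ∑ x ∈ s, f x ≠ ⊥ :=
  Finset.sum_induction f (· ≠ ⊥) (fun _ _ ha hb => by simp [EReal.add_eq_bot_iff, ha, hb])
    EReal.zero_ne_bot hf

theorem sum_eq_top {f : κ → EReal} (hf : ∀ x ∈ s, f x ≠ ⊥) {x : κ} (hx : x ∈ s)
    (htop : f x = ⊤) : ∑ x ∈ s, f x = ⊤ := by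
  classical
  rw [← Finset.add_sum_erase s f hx, htop]
  exact EReal.top_add_of_ne_bot (sum_ne_bot fun y hy => hf y (Finset.mem_of_mem_erase hy))

end ExtendedReal

section Simplex

variable {ι : Type*} {P Q w : ι → ℝ}

theorem pos_of_support_subset (h : P.support ⊆ Q.support) (hQ : ∀ x, 0 ≤ Q x) {x : ι}
    (hx : P x ≠ 0) : 0 < Q x :=
  (hQ x).lt_of_ne' (h hx)

variable [Fintype ι]

theorem exists_pos_of_mem_stdSimplex (hP : P ∈ stdSimplex ℝ ι) : ∃ x, 0 < P x := by
  by_contra! h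
  linarith [hP.2, Finset.sum_nonpos fun x (_ : x ∈ Finset.univ) => h x]

theorem sum_pos_of_support_subset (hP : P ∈ stdSimplex ℝ ι) (hw : ∀ x, 0 ≤ w x)
    (h : P.support ⊆ w.support) : 0 < ∑ x, w x := by
  obtain ⟨x, hx⟩ := exists_pos_of_mem_stdSimplex hP
  exact Finset.sum_pos' (fun y _ => hw y)
    ⟨x, Finset.mem_univ x, pos_of_support_subset h hw hx.ne'⟩

theorem normalized_mem_stdSimplex (hw : ∀ x, 0 ≤ w x) (hS : 0 < ∑ x, w x) :
    normalized w ∈ stdSimplex ℝ ι :=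
  ⟨fun x => div_nonneg (hw x) hS.le, by
    simp only [normalized, ← Finset.sum_div, div_self hS.ne']⟩

theorem support_normalized (hS : 0 < ∑ x, w x) : (normalized w).support = w.support := by
  ext x
  simp [normalized, hS.ne']

end Simplex

section RelEntropy

variable {ι : Type*} [Fintype ι] {P Q R w : ι → ℝ}

theorem coe_mul_log_div {p q : ℝ} (hp : 0 ≤ p) (hq : 0 ≤ q) (h : p ≠ 0 → q ≠ 0) :
    (p : EReal) * ENNReal.log (ENNReal.ofReal p / ENNReal.ofReal q)
      = ((p * Real.log (p / q) : ℝ) : EReal) := by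
  rcases hp.eq_or_lt with rfl | hp
  · simp
  · have hq : 0 < q := hq.lt_of_ne' (h hp.ne')
    rw [← ENNReal.ofReal_div_of_pos hq, ENNReal.log_ofReal_of_pos (div_pos hp hq),
      EReal.coe_mul]

theorem coe_mul_log_div_zero {p : ℝ} (hp : 0 < p) :
    (p : EReal) * ENNReal.log (ENNReal.ofReal p / ENNReal.ofReal 0) = ⊤ := by
  rw [ENNReal.ofReal_zero, ENNReal.div_zero (by simpa using hp), ENNReal.log_top,
    EReal.coe_mul_top_of_pos hp]

theorem coe_mul_log_div_ne_bot {p q : ℝ} (hp : 0 ≤ p) (hq : 0 ≤ q) :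
    (p : EReal) * ENNReal.log (ENNReal.ofReal p / ENNReal.ofReal q) ≠ ⊥ := by
  by_cases h : p ≠ 0 → q ≠ 0
  · rw [coe_mul_log_div hp hq h]
    exact EReal.coe_ne_bot _
  · push Not at h
    rw [h.2, coe_mul_log_div_zero (hp.lt_of_ne' h.1)]
    exact top_ne_bot

theorem relEntropy_eq_coe (hP : ∀ x, 0 ≤ P x) (hQ : ∀ x, 0 ≤ Q x)
    (h : P.support ⊆ Q.support) : relEntropy P Q = ((relEntropyReal P Q : ℝ) : EReal) := by
  rw [relEntropy, relEntropyReal, coe_sum]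
  exact Finset.sum_congr rfl fun x _ => coe_mul_log_div (hP x) (hQ x) (@h x)

theorem relEntropy_eq_top (hP : ∀ x, 0 ≤ P x) (hQ : ∀ x, 0 ≤ Q x)
    (h : ¬ P.support ⊆ Q.support) : relEntropy P Q = ⊤ := by
  obtain ⟨x, hPx, hQx⟩ := Set.not_subset.1 h
  refine sum_eq_top (fun y _ => coe_mul_log_div_ne_bot (hP y) (hQ y)) (Finset.mem_univ x) ?_
  rw [Function.notMem_support.1 hQx, coe_mul_log_div_zero ((hP x).lt_of_ne' hPx)]

theorem relEntropyReal_self (P : ι → ℝ) : relEntropyReal P P = 0 :=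
  Finset.sum_eq_zero fun x _ => by by_cases h : P x = 0 <;> simp [h]

theorem two_mul_sub_sqrt_le_mul_log {r p : ℝ} (hr : 0 ≤ r) (hp : 0 ≤ p) (h : r ≠ 0 → p ≠ 0) :
    2 * (r - √r * √p) ≤ r * Real.log (r / p) := by
  rcases hr.eq_or_lt with rfl | hr
  · simp
  · have hp : 0 < p := hp.lt_of_ne' (h hr.ne')
    have hlog := Real.one_sub_inv_le_log_of_pos (x := √(r / p)) (by positivity)
    rw [Real.log_sqrt (by positivity)] at hlog
    have hsqrt : r * (1 - (√(r / p))⁻¹) = r - √r * √p := by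
      rw [Real.sqrt_div hr.le, inv_div]
      field_simp
      linear_combination √p * Real.sq_sqrt hr.le
    linarith [mul_le_mul_of_nonneg_left hlog hr.le]

theorem sum_sq_sqrt_sub_sqrt_le_relEntropyReal (hR : R ∈ stdSimplex ℝ ι)
    (hP : P ∈ stdSimplex ℝ ι) (h : R.support ⊆ P.support) :
    ∑ x, (√(R x) - √(P x)) ^ 2 ≤ relEntropyReal R P := by
  calc ∑ x, (√(R x) - √(P x)) ^ 2
      = ∑ x, (2 * (R x - √(R x) * √(P x)) + (P x - R x)) :=
        Finset.sum_congr rfl fun x _ => by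
          linear_combination Real.sq_sqrt (hR.1 x) + Real.sq_sqrt (hP.1 x)
    _ = ∑ x, 2 * (R x - √(R x) * √(P x)) := by
        rw [Finset.sum_add_distrib, Finset.sum_sub_distrib, hR.2, hP.2, sub_self, add_zero]
    _ ≤ relEntropyReal R P :=
        Finset.sum_le_sum fun x _ => two_mul_sub_sqrt_le_mul_log (hR.1 x) (hP.1 x) (@h x)

theorem relEntropyReal_nonneg (hR : R ∈ stdSimplex ℝ ι) (hP : P ∈ stdSimplex ℝ ι)
    (h : R.support ⊆ P.support) : 0 ≤ relEntropyReal R P :=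
  (Finset.sum_nonneg fun _ _ => sq_nonneg _).trans
    (sum_sq_sqrt_sub_sqrt_le_relEntropyReal hR hP h)

theorem eq_of_relEntropyReal_nonpos (hR : R ∈ stdSimplex ℝ ι) (hP : P ∈ stdSimplex ℝ ι)
    (h : R.support ⊆ P.support) (h0 : relEntropyReal R P ≤ 0) : R = P := by
  have hsum : ∑ x, (√(R x) - √(P x)) ^ 2 = 0 :=
    le_antisymm ((sum_sq_sqrt_sub_sqrt_le_relEntropyReal hR hP h).trans h0)
      (Finset.sum_nonneg fun _ _ => sq_nonneg _)
  funext x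
  have hx := (Finset.sum_eq_zero_iff_of_nonneg fun _ _ => sq_nonneg _).1 hsum x
    (Finset.mem_univ x)
  exact (Real.sqrt_inj (hR.1 x) (hP.1 x)).1 (sub_eq_zero.1 (pow_eq_zero_iff two_ne_zero |>.1 hx))

theorem relEntropy_nonneg (hP : P ∈ stdSimplex ℝ ι) (hQ : Q ∈ stdSimplex ℝ ι) :
    0 ≤ relEntropy P Q := by
  by_cases h : P.support ⊆ Q.support
  · rw [relEntropy_eq_coe hP.1 hQ.1 h]
    exact_mod_cast relEntropyReal_nonneg hP hQ h
  · simp [relEntropy_eq_top hP.1 hQ.1 h]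

theorem eq_of_relEntropy_nonpos (hP : P ∈ stdSimplex ℝ ι) (hQ : Q ∈ stdSimplex ℝ ι)
    (h0 : relEntropy P Q ≤ 0) : P = Q := by
  by_cases h : P.support ⊆ Q.support
  · rw [relEntropy_eq_coe hP.1 hQ.1 h] at h0
    exact eq_of_relEntropyReal_nonpos hP hQ h (by exact_mod_cast h0)
  · simp [relEntropy_eq_top hP.1 hQ.1 h] at h0

theorem relEntropyReal_eq_normalized_sub_log (hR : R ∈ stdSimplex ℝ ι) (hw : ∀ x, 0 ≤ w x)
    (h : R.support ⊆ w.support) :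
    relEntropyReal R w = relEntropyReal R (normalized w) - Real.log (∑ x, w x) := by
  have hS := sum_pos_of_support_subset hR hw h
  have hlog : Real.log (∑ x, w x) = ∑ x, R x * Real.log (∑ x, w x) := by
    rw [← Finset.sum_mul, hR.2, one_mul]
  rw [hlog, relEntropyReal, relEntropyReal, ← Finset.sum_sub_distrib]
  refine Finset.sum_congr rfl fun x _ => ?_
  by_cases hx : R x = 0
  · simp [hx]
  · rw [normalized, ← div_mul, Real.log_mul (div_ne_zero hx (h hx)) hS.ne']
    ring

end RelEntropy

section RenyiDiv

variable {ι : Type*} {α : ℝ} {P Q R : ι → ℝ}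

theorem tilt_nonneg (hP : ∀ x, 0 ≤ P x) (hQ : ∀ x, 0 ≤ Q x) (x : ι) : 0 ≤ tilt α P Q x :=
  mul_nonneg (Real.rpow_nonneg (hP x) _) (Real.rpow_nonneg (hQ x) _)

theorem support_tilt (hα : 0 < α) (hα1 : α ≠ 1) (hP : ∀ x, 0 ≤ P x) (hQ : ∀ x, 0 ≤ Q x) :
    (tilt α P Q).support = P.support ∩ Q.support := by
  ext x
  simp [tilt, Real.rpow_eq_zero (hP x) hα.ne', Real.rpow_eq_zero (hQ x) (sub_ne_zero.2 hα1.symm)]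

theorem ofReal_tilt (hα : 0 < α) (hP : ∀ x, 0 ≤ P x) (hQ : ∀ x, 0 ≤ Q x)
    (h : α < 1 ∨ P.support ⊆ Q.support) (x : ι) :
    ENNReal.ofReal (tilt α P Q x)
      = ENNReal.ofReal (P x) ^ α * ENNReal.ofReal (Q x) ^ (1 - α) := by
  rw [tilt, ENNReal.ofReal_mul (Real.rpow_nonneg (hP x) _),
    ENNReal.ofReal_rpow_of_nonneg (hP x) hα.le]
  rcases (hQ x).eq_or_lt' with hQx | hQx
  · rcases h with hα1 | h
    · rw [ENNReal.ofReal_rpow_of_nonneg (hQ x) (by linarith)]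
    · have hPx : P x = 0 := by_contra fun hx => h hx hQx
      simp [hPx, Real.zero_rpow hα.ne']
  · rw [ENNReal.ofReal_rpow_of_pos hQx]

variable [Fintype ι]

theorem renyiSum_eq_ofReal (hα : 0 < α) (hP : ∀ x, 0 ≤ P x) (hQ : ∀ x, 0 ≤ Q x)
    (h : α < 1 ∨ P.support ⊆ Q.support) :
    renyiSum α P Q = ENNReal.ofReal (∑ x, tilt α P Q x) := by
  rw [ENNReal.ofReal_sum_of_nonneg fun x _ => tilt_nonneg hP hQ x]
  exact Finset.sum_congr rfl fun x _ => (ofReal_tilt hα hP hQ h x).symm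

theorem renyiSum_eq_top (hα : 1 < α) (hP : ∀ x, 0 ≤ P x) (h : ¬ P.support ⊆ Q.support) :
    renyiSum α P Q = ⊤ := by
  obtain ⟨x, hPx, hQx⟩ := Set.not_subset.1 h
  refine ENNReal.sum_eq_top.2 ⟨x, Finset.mem_univ x, ?_⟩
  rw [Function.notMem_support.1 hQx, ENNReal.ofReal_zero,
    ENNReal.zero_rpow_of_neg (by linarith), ENNReal.mul_top]
  simp [(hP x).lt_of_ne' hPx]

theorem sum_tilt_pos (hα : 0 < α) (hα1 : α ≠ 1) (hR : R ∈ stdSimplex ℝ ι) (hP : ∀ x, 0 ≤ P x)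
    (hQ : ∀ x, 0 ≤ Q x) (hRP : R.support ⊆ P.support) (hRQ : R.support ⊆ Q.support) :
    0 < ∑ x, tilt α P Q x :=
  sum_pos_of_support_subset hR (tilt_nonneg hP hQ)
    (support_tilt hα hα1 hP hQ ▸ Set.subset_inter hRP hRQ)

theorem support_normalized_tilt (hα : 0 < α) (hα1 : α ≠ 1) (hP : ∀ x, 0 ≤ P x)
    (hQ : ∀ x, 0 ≤ Q x) (hS : 0 < ∑ x, tilt α P Q x) :
    (normalized (tilt α P Q)).support = P.support ∩ Q.support := by
  rw [support_normalized hS, support_tilt hα hα1 hP hQ]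

theorem renyiDiv_one (P Q : ι → ℝ) : renyiDiv 1 P Q = relEntropy P Q := by
  simp [renyiDiv]

theorem renyiDiv_of_ne_one (hα1 : α ≠ 1) (P Q : ι → ℝ) :
    renyiDiv α P Q = (((α - 1)⁻¹ : ℝ) : EReal) * ENNReal.log (renyiSum α P Q) := by
  rw [renyiDiv, if_neg hα1, renyiSum]

theorem renyiDiv_eq_log_rpow (hα1 : α ≠ 1) (P Q : ι → ℝ) :
    renyiDiv α P Q = ENNReal.log (renyiSum α P Q ^ (α - 1)⁻¹) := by
  rw [renyiDiv_of_ne_one hα1, ENNReal.log_rpow]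

theorem renyiDiv_eq_coe (hα : 0 < α) (hα1 : α ≠ 1) (hP : ∀ x, 0 ≤ P x) (hQ : ∀ x, 0 ≤ Q x)
    (h : α < 1 ∨ P.support ⊆ Q.support) (hS : 0 < ∑ x, tilt α P Q x) :
    renyiDiv α P Q = (((α - 1)⁻¹ * Real.log (∑ x, tilt α P Q x) : ℝ) : EReal) := by
  rw [renyiDiv_of_ne_one hα1, renyiSum_eq_ofReal hα hP hQ h, ENNReal.log_ofReal_of_pos hS,
    EReal.coe_mul]

theorem renyiDiv_eq_top (hα : 1 < α) (hP : ∀ x, 0 ≤ P x) (h : ¬ P.support ⊆ Q.support) :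
    renyiDiv α P Q = ⊤ := by
  rw [renyiDiv_of_ne_one hα.ne', renyiSum_eq_top hα hP h, ENNReal.log_top,
    EReal.coe_mul_top_of_pos (inv_pos.2 (sub_pos.2 hα))]

theorem lt_one_or_support_subset_of_renyiDiv_ne_top (hα1 : α ≠ 1) (hP : ∀ x, 0 ≤ P x)
    (hfin : renyiDiv α P Q ≠ ⊤) : α < 1 ∨ P.support ⊆ Q.support :=
  hα1.lt_or_gt.imp_right fun hα => by_contra fun h => hfin (renyiDiv_eq_top hα hP h)

theorem sum_tilt_pos_of_renyiDiv_ne_top (hα : 0 < α) (hα1 : α ≠ 1) (hP : P ∈ stdSimplex ℝ ι)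
    (hQ : ∀ x, 0 ≤ Q x) (hfin : renyiDiv α P Q ≠ ⊤) : 0 < ∑ x, tilt α P Q x := by
  rcases lt_one_or_support_subset_of_renyiDiv_ne_top hα1 hP.1 hfin with hlt | h
  · refine (Finset.sum_nonneg fun x _ => tilt_nonneg hP.1 hQ x).lt_of_ne' fun hS => hfin ?_
    rw [renyiDiv_of_ne_one hα1, renyiSum_eq_ofReal hα hP.1 hQ (.inl hlt), hS,
      ENNReal.ofReal_zero, ENNReal.log_zero, EReal.coe_mul_bot_of_neg (inv_lt_zero.2 (by linarith))]
  · exact sum_tilt_pos hα hα1 hP hP.1 hQ subset_rfl h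

theorem relEntropyReal_tilt (hα1 : α ≠ 1) (hP : ∀ x, 0 ≤ P x) (hQ : ∀ x, 0 ≤ Q x)
    (hRP : R.support ⊆ P.support) (hRQ : R.support ⊆ Q.support) :
    relEntropyReal R (tilt α P Q)
      = (1 - α) * (relEntropyReal R Q + α / (1 - α) * relEntropyReal R P) := by
  have hne : 1 - α ≠ 0 := sub_ne_zero.2 hα1.symm
  rw [mul_add, ← mul_assoc, mul_div_cancel₀ _ hne, relEntropyReal, relEntropyReal, relEntropyReal,
    Finset.mul_sum, Finset.mul_sum, ← Finset.sum_add_distrib]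
  refine Finset.sum_congr rfl fun x _ => ?_
  by_cases hx : R x = 0
  · simp [hx]
  · have hPx := pos_of_support_subset hRP hP hx
    have hQx := pos_of_support_subset hRQ hQ hx
    rw [tilt, Real.log_div hx (by positivity), Real.log_div hx hPx.ne', Real.log_div hx hQx.ne',
      Real.log_mul (by positivity) (by positivity), Real.log_rpow hPx, Real.log_rpow hQx]
    ring

/- The Pythagorean identity behind the variational formulas: the sign of `(1 - α)⁻¹` decides whether
the Rényi divergence is a minimum or a maximum of the left-hand side. -/
theorem relEntropyReal_add_mul_relEntropyReal (hα : 0 < α) (hα1 : α ≠ 1)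
    (hR : R ∈ stdSimplex ℝ ι) (hP : ∀ x, 0 ≤ P x) (hQ : ∀ x, 0 ≤ Q x)
    (hRP : R.support ⊆ P.support) (hRQ : R.support ⊆ Q.support) :
    relEntropyReal R Q + α / (1 - α) * relEntropyReal R P
      = (α - 1)⁻¹ * Real.log (∑ x, tilt α P Q x)
        + (1 - α)⁻¹ * relEntropyReal R (normalized (tilt α P Q)) := by
  have hne : 1 - α ≠ 0 := sub_ne_zero.2 hα1.symm
  have hsplit := relEntropyReal_eq_normalized_sub_log hR (tilt_nonneg (α := α) hP hQ)
    (support_tilt hα hα1 hP hQ ▸ Set.subset_inter hRP hRQ)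
  rw [relEntropyReal_tilt hα1 hP hQ hRP hRQ] at hsplit
  have hinv : (α - 1)⁻¹ = -(1 - α)⁻¹ := by rw [← neg_sub, inv_neg]
  rw [hinv, ← mul_right_inj' hne, hsplit]
  field_simp
  ring

theorem renyiDiv_le_of_lt_one (hα : 0 < α) (hα1 : α < 1) (hR : R ∈ stdSimplex ℝ ι)
    (hP : ∀ x, 0 ≤ P x) (hQ : ∀ x, 0 ≤ Q x) (hRP : R.support ⊆ P.support)
    (hRQ : R.support ⊆ Q.support) :
    renyiDiv α P Q ≤ ((relEntropyReal R Q + α / (1 - α) * relEntropyReal R P : ℝ) : EReal) := by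
  have hS := sum_tilt_pos hα hα1.ne hR hP hQ hRP hRQ
  rw [renyiDiv_eq_coe hα hα1.ne hP hQ (.inl hα1) hS,
    relEntropyReal_add_mul_relEntropyReal hα hα1.ne hR hP hQ hRP hRQ, EReal.coe_le_coe_iff]
  refine le_add_of_nonneg_right (mul_nonneg (inv_nonneg.2 (by linarith)) ?_)
  refine relEntropyReal_nonneg hR (normalized_mem_stdSimplex (tilt_nonneg hP hQ) hS) ?_
  exact support_normalized_tilt hα hα1.ne hP hQ hS ▸ Set.subset_inter hRP hRQ

theorem le_renyiDiv_of_one_lt (hα : 1 < α) (hR : R ∈ stdSimplex ℝ ι) (hP : ∀ x, 0 ≤ P x)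
    (hQ : ∀ x, 0 ≤ Q x) (hRP : R.support ⊆ P.support) :
    ((relEntropyReal R Q + α / (1 - α) * relEntropyReal R P : ℝ) : EReal) ≤ renyiDiv α P Q := by
  by_cases h : P.support ⊆ Q.support
  · have hα0 : 0 < α := one_pos.trans hα
    have hRQ := hRP.trans h
    have hS := sum_tilt_pos hα0 hα.ne' hR hP hQ hRP hRQ
    rw [renyiDiv_eq_coe hα0 hα.ne' hP hQ (.inr h) hS,
      relEntropyReal_add_mul_relEntropyReal hα0 hα.ne' hR hP hQ hRP hRQ, EReal.coe_le_coe_iff]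
    refine add_le_of_nonpos_right (mul_nonpos_of_nonpos_of_nonneg (inv_nonpos.2 (by linarith)) ?_)
    refine relEntropyReal_nonneg hR (normalized_mem_stdSimplex (tilt_nonneg hP hQ) hS) ?_
    exact support_normalized_tilt hα0 hα.ne' hP hQ hS ▸ Set.subset_inter hRP hRQ
  · simp [renyiDiv_eq_top hα hP h]

theorem renyiDiv_eq_normalized_tilt (hα : 0 < α) (hα1 : α ≠ 1) (hP : P ∈ stdSimplex ℝ ι)
    (hQ : ∀ x, 0 ≤ Q x) (hfin : renyiDiv α P Q ≠ ⊤) :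
    renyiDiv α P Q = ((relEntropyReal (normalized (tilt α P Q)) Q
      + α / (1 - α) * relEntropyReal (normalized (tilt α P Q)) P : ℝ) : EReal) := by
  have hS := sum_tilt_pos_of_renyiDiv_ne_top hα hα1 hP hQ hfin
  have hsupp := support_normalized_tilt hα hα1 hP.1 hQ hS
  rw [renyiDiv_eq_coe hα hα1 hP.1 hQ
      (lt_one_or_support_subset_of_renyiDiv_ne_top hα1 hP.1 hfin) hS,
    relEntropyReal_add_mul_relEntropyReal hα hα1
      (normalized_mem_stdSimplex (tilt_nonneg hP.1 hQ) hS) hP.1 hQ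
      (hsupp ▸ Set.inter_subset_left) (hsupp ▸ Set.inter_subset_right),
    relEntropyReal_self, mul_zero, add_zero]

theorem relEntropy_le_renyiDiv (hα : 1 ≤ α) (hP : P ∈ stdSimplex ℝ ι) (hQ : ∀ x, 0 ≤ Q x) :
    relEntropy P Q ≤ renyiDiv α P Q := by
  rcases hα.eq_or_lt with rfl | hα
  · rw [renyiDiv_one]
  by_cases h : P.support ⊆ Q.support
  · rw [relEntropy_eq_coe hP.1 hQ h]
    simpa [relEntropyReal_self] using le_renyiDiv_of_one_lt hα hP hP.1 hQ subset_rfl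
  · simp [renyiDiv_eq_top hα hP.1 h]

theorem renyiDiv_nonneg_and_eq_of_lt_one (hα : 0 < α) (hα1 : α < 1) (hP : P ∈ stdSimplex ℝ ι)
    (hQ : Q ∈ stdSimplex ℝ ι) : 0 ≤ renyiDiv α P Q ∧ (renyiDiv α P Q = 0 → P = Q) := by
  by_cases hfin : renyiDiv α P Q = ⊤
  · simp [hfin]
  have hS := sum_tilt_pos_of_renyiDiv_ne_top hα hα1.ne hP hQ.1 hfin
  have hsupp := support_normalized_tilt hα hα1.ne hP.1 hQ.1 hS
  have hT := normalized_mem_stdSimplex (tilt_nonneg hP.1 hQ.1) hS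
  have hTP := hsupp.trans_subset Set.inter_subset_left
  have hTQ := hsupp.trans_subset Set.inter_subset_right
  rw [renyiDiv_eq_normalized_tilt hα hα1.ne hP hQ.1 hfin]
  set T := normalized (tilt α P Q)
  have hTP0 := relEntropyReal_nonneg hT hP hTP
  have hTQ0 := relEntropyReal_nonneg hT hQ hTQ
  have hc : 0 < α / (1 - α) := div_pos hα (sub_pos.2 hα1)
  refine ⟨by exact_mod_cast add_nonneg hTQ0 (mul_nonneg hc.le hTP0), fun h0 => ?_⟩
  obtain ⟨hTQ1, hTP1⟩ := (add_eq_zero_iff_of_nonneg hTQ0 (mul_nonneg hc.le hTP0)).1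
    (by exact_mod_cast h0)
  rw [← eq_of_relEntropyReal_nonpos hT hQ hTQ hTQ1.le]
  exact (eq_of_relEntropyReal_nonpos hT hP hTP
    ((mul_eq_zero.1 hTP1).resolve_left hc.ne').le).symm

theorem renyiDiv_nonneg (hα : 0 < α) (hP : P ∈ stdSimplex ℝ ι) (hQ : Q ∈ stdSimplex ℝ ι) :
    0 ≤ renyiDiv α P Q := by
  rcases lt_or_ge α 1 with hα1 | hα1
  · exact (renyiDiv_nonneg_and_eq_of_lt_one hα hα1 hP hQ).1
  · exact (relEntropy_nonneg hP hQ).trans (relEntropy_le_renyiDiv hα1 hP hQ.1)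

theorem eq_of_renyiDiv_eq_zero (hα : 0 < α) (hP : P ∈ stdSimplex ℝ ι) (hQ : Q ∈ stdSimplex ℝ ι)
    (h0 : renyiDiv α P Q = 0) : P = Q := by
  rcases lt_or_ge α 1 with hα1 | hα1
  · exact (renyiDiv_nonneg_and_eq_of_lt_one hα hα1 hP hQ).2 h0
  · exact eq_of_relEntropy_nonpos hP hQ ((relEntropy_le_renyiDiv hα1 hP hQ.1).trans_eq h0)

theorem renyiDiv_self (hα : 0 < α) (hP : P ∈ stdSimplex ℝ ι) : renyiDiv α P P = 0 := by
  rcases eq_or_ne α 1 with rfl | hα1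
  · rw [renyiDiv_one, relEntropy_eq_coe hP.1 hP.1 subset_rfl, relEntropyReal_self, EReal.coe_zero]
  · have hsum : ∑ x, tilt α P P x = 1 := by
      rw [← hP.2]
      refine Finset.sum_congr rfl fun x _ => ?_
      rcases (hP.1 x).eq_or_lt' with hx | hx
      · simp [tilt, hx, Real.zero_rpow hα.ne']
      · rw [tilt, ← Real.rpow_add hx, add_sub_cancel, Real.rpow_one]
    rw [renyiDiv_eq_coe hα hα1 hP.1 hP.1 (.inr subset_rfl) (hsum ▸ one_pos), hsum]
    simp

theorem continuous_renyiDiv_right (hα : 0 < α) (hα1 : α ≠ 1) (P : ι → ℝ) :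
    Continuous fun Q : ι → ℝ => renyiDiv α P Q := by
  have hsum : Continuous fun Q : ι → ℝ => renyiSum α P Q :=
    continuous_finsetSum _ fun x _ => (ENNReal.continuous_const_mul
      (ENNReal.rpow_ne_top_of_nonneg hα.le ENNReal.ofReal_ne_top)).comp
        (ENNReal.continuous_rpow_const.comp (ENNReal.continuous_ofReal.comp (continuous_apply x)))
  simp only [renyiDiv_eq_log_rpow hα1]
  exact ENNReal.continuous_log.comp (ENNReal.continuous_rpow_const.comp hsum)

end RenyiDiv

/-- The mutual information as a real number. -/
noncomputable def mutualInfoReal {𝒳 𝒴 : Type*} [Fintype 𝒳] [Fintype 𝒴] (R : 𝒳 × 𝒴 → ℝ) : ℝ :=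
  relEntropyReal R (prodPmf (margFst R) (margSnd R))

section Marginals

variable {𝒳 𝒴 : Type*} {R : 𝒳 × 𝒴 → ℝ} {Q : 𝒳 → ℝ} {T : 𝒴 → ℝ}

theorem prodPmf_comp_swap (Q : 𝒳 → ℝ) (T : 𝒴 → ℝ) : prodPmf Q T ∘ Prod.swap = prodPmf T Q :=
  funext fun _ => mul_comm _ _

theorem prodPmf_nonneg (hQ : ∀ x, 0 ≤ Q x) (hT : ∀ y, 0 ≤ T y) (p : 𝒳 × 𝒴) :
    0 ≤ prodPmf Q T p :=
  mul_nonneg (hQ _) (hT _)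

theorem margFst_ne_zero [Fintype 𝒴] (hR : ∀ p, 0 ≤ R p) {p : 𝒳 × 𝒴} (hp : R p ≠ 0) :
    margFst R p.1 ≠ 0 :=
  fun h => hp ((Finset.sum_eq_zero_iff_of_nonneg fun _ _ => hR _).1 h p.2 (Finset.mem_univ _))

theorem margSnd_ne_zero [Fintype 𝒳] (hR : ∀ p, 0 ≤ R p) {p : 𝒳 × 𝒴} (hp : R p ≠ 0) :
    margSnd R p.2 ≠ 0 :=
  fun h => hp ((Finset.sum_eq_zero_iff_of_nonneg fun _ _ => hR _).1 h p.1 (Finset.mem_univ _))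

theorem support_margFst_subset [Fintype 𝒴] (h : R.support ⊆ (prodPmf Q T).support) :
    (margFst R).support ⊆ Q.support := fun x hx => by
  obtain ⟨y, -, hy⟩ := Finset.exists_ne_zero_of_sum_ne_zero hx
  exact left_ne_zero_of_mul (h hy)

theorem support_margSnd_subset [Fintype 𝒳] (h : R.support ⊆ (prodPmf Q T).support) :
    (margSnd R).support ⊆ T.support := fun y hy => by
  obtain ⟨x, -, hx⟩ := Finset.exists_ne_zero_of_sum_ne_zero hy
  exact right_ne_zero_of_mul (h hx)

theorem margFst_prodPmf [Fintype 𝒴] (Q : 𝒳 → ℝ) (hT : T ∈ stdSimplex ℝ 𝒴) :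
    margFst (prodPmf Q T) = Q :=
  funext fun x => by simp only [margFst, prodPmf, ← Finset.mul_sum, hT.2, mul_one]

theorem margSnd_prodPmf [Fintype 𝒳] (hQ : Q ∈ stdSimplex ℝ 𝒳) (T : 𝒴 → ℝ) :
    margSnd (prodPmf Q T) = T :=
  funext fun y => by simp only [margSnd, prodPmf, ← Finset.sum_mul, hQ.2, one_mul]

variable [Fintype 𝒳] [Fintype 𝒴]

theorem support_subset_support_prodPmf_marg (hR : ∀ p, 0 ≤ R p) :
    R.support ⊆ (prodPmf (margFst R) (margSnd R)).support :=
  fun _ hp => mul_ne_zero (margFst_ne_zero hR hp) (margSnd_ne_zero hR hp)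

theorem sum_mul_comp_fst (R : 𝒳 × 𝒴 → ℝ) (g : 𝒳 → ℝ) :
    ∑ p, R p * g p.1 = ∑ x, margFst R x * g x := by
  simp only [Fintype.sum_prod_type, margFst, Finset.sum_mul]

theorem sum_mul_comp_snd (R : 𝒳 × 𝒴 → ℝ) (g : 𝒴 → ℝ) :
    ∑ p, R p * g p.2 = ∑ y, margSnd R y * g y := by
  simp only [Fintype.sum_prod_type_right, margSnd, Finset.sum_mul]

theorem margFst_mem_stdSimplex (hR : R ∈ stdSimplex ℝ (𝒳 × 𝒴)) :
    margFst R ∈ stdSimplex ℝ 𝒳 :=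
  ⟨fun _ => Finset.sum_nonneg fun _ _ => hR.1 _, (Fintype.sum_prod_type R).symm.trans hR.2⟩

theorem margSnd_mem_stdSimplex (hR : R ∈ stdSimplex ℝ (𝒳 × 𝒴)) :
    margSnd R ∈ stdSimplex ℝ 𝒴 :=
  ⟨fun _ => Finset.sum_nonneg fun _ _ => hR.1 _, (Fintype.sum_prod_type_right R).symm.trans hR.2⟩

theorem prodPmf_mem_stdSimplex (hQ : Q ∈ stdSimplex ℝ 𝒳) (hT : T ∈ stdSimplex ℝ 𝒴) :
    prodPmf Q T ∈ stdSimplex ℝ (𝒳 × 𝒴) :=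
  ⟨prodPmf_nonneg hQ.1 hT.1, by
    simp only [prodPmf, Fintype.sum_prod_type, ← Finset.mul_sum, hQ.2, hT.2, mul_one]⟩

theorem prodPmf_marg_mem_stdSimplex (hR : R ∈ stdSimplex ℝ (𝒳 × 𝒴)) :
    prodPmf (margFst R) (margSnd R) ∈ stdSimplex ℝ (𝒳 × 𝒴) :=
  prodPmf_mem_stdSimplex (margFst_mem_stdSimplex hR) (margSnd_mem_stdSimplex hR)

theorem comp_swap_mem_stdSimplex (hR : R ∈ stdSimplex ℝ (𝒳 × 𝒴)) :
    R ∘ Prod.swap ∈ stdSimplex ℝ (𝒴 × 𝒳) :=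
  ⟨fun _ => hR.1 _, ((Equiv.prodComm 𝒴 𝒳).sum_comp R).trans hR.2⟩

end Marginals

section MutualInfo

variable {𝒳 𝒴 : Type*} [Fintype 𝒳] [Fintype 𝒴] {R : 𝒳 × 𝒴 → ℝ} {Q : 𝒳 → ℝ} {T : 𝒴 → ℝ}

theorem mutualInfo_eq_coe (hR : R ∈ stdSimplex ℝ (𝒳 × 𝒴)) :
    mutualInfo R = ((mutualInfoReal R : ℝ) : EReal) :=
  relEntropy_eq_coe hR.1 (prodPmf_marg_mem_stdSimplex hR).1
    (support_subset_support_prodPmf_marg hR.1)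

theorem mutualInfoReal_nonneg (hR : R ∈ stdSimplex ℝ (𝒳 × 𝒴)) : 0 ≤ mutualInfoReal R :=
  relEntropyReal_nonneg hR (prodPmf_marg_mem_stdSimplex hR)
    (support_subset_support_prodPmf_marg hR.1)

theorem relEntropyReal_prodPmf (hR : ∀ p, 0 ≤ R p) (h : R.support ⊆ (prodPmf Q T).support) :
    relEntropyReal R (prodPmf Q T)
      = mutualInfoReal R + relEntropyReal (margFst R) Q + relEntropyReal (margSnd R) T := by
  simp only [mutualInfoReal, relEntropyReal]
  rw [← sum_mul_comp_fst R fun x => Real.log (margFst R x / Q x),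
    ← sum_mul_comp_snd R fun y => Real.log (margSnd R y / T y),
    ← Finset.sum_add_distrib, ← Finset.sum_add_distrib]
  refine Finset.sum_congr rfl fun p _ => ?_
  by_cases hp : R p = 0
  · simp [hp]
  · have hQ : Q p.1 ≠ 0 := left_ne_zero_of_mul (h hp)
    have hT : T p.2 ≠ 0 := right_ne_zero_of_mul (h hp)
    have hX := margFst_ne_zero hR hp
    have hY := margSnd_ne_zero hR hp
    rw [prodPmf, prodPmf, Real.log_div hp (mul_ne_zero hQ hT), Real.log_div hp (mul_ne_zero hX hY),
      Real.log_div hX hQ, Real.log_div hY hT, Real.log_mul hQ hT, Real.log_mul hX hY]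
    ring

theorem mutualInfoReal_le_relEntropyReal_prodPmf (hR : R ∈ stdSimplex ℝ (𝒳 × 𝒴))
    (hQ : Q ∈ stdSimplex ℝ 𝒳) (hT : T ∈ stdSimplex ℝ 𝒴)
    (h : R.support ⊆ (prodPmf Q T).support) :
    mutualInfoReal R ≤ relEntropyReal R (prodPmf Q T) := by
  rw [relEntropyReal_prodPmf hR.1 h, add_assoc]
  exact le_add_of_nonneg_right (add_nonneg
    (relEntropyReal_nonneg (margFst_mem_stdSimplex hR) hQ (support_margFst_subset h))
    (relEntropyReal_nonneg (margSnd_mem_stdSimplex hR) hT (support_margSnd_subset h)))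

theorem mutualInfoReal_eq_sum_negMulLog (hR : ∀ p, 0 ≤ R p) :
    mutualInfoReal R = ∑ x, Real.negMulLog (margFst R x) + ∑ y, Real.negMulLog (margSnd R y)
      - ∑ p, Real.negMulLog (R p) := by
  simp only [mutualInfoReal, relEntropyReal, Real.negMulLog, neg_mul, Finset.sum_neg_distrib]
  rw [← sum_mul_comp_fst R fun x => Real.log (margFst R x),
    ← sum_mul_comp_snd R fun y => Real.log (margSnd R y), sub_neg_eq_add, add_comm,
    ← sub_eq_add_neg, add_sub_assoc', ← sub_eq_add_neg, ← Finset.sum_sub_distrib,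
    ← Finset.sum_sub_distrib]
  refine Finset.sum_congr rfl fun p _ => ?_
  by_cases hp : R p = 0
  · simp [hp]
  · have hX := margFst_ne_zero hR hp
    have hY := margSnd_ne_zero hR hp
    rw [prodPmf, Real.log_div hp (mul_ne_zero hX hY), Real.log_mul hX hY]
    ring

theorem const_inv_card_mem_stdSimplex [Nonempty 𝒳] :
    (fun _ : 𝒳 => (Fintype.card 𝒳 : ℝ)⁻¹) ∈ stdSimplex ℝ 𝒳 :=
  ⟨fun _ => by positivity, by simp⟩

theorem mutualInfoReal_le_log_card (hR : R ∈ stdSimplex ℝ (𝒳 × 𝒴)) :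
    mutualInfoReal R ≤ Real.log (Fintype.card 𝒳) := by
  have : Nonempty 𝒳 := ⟨(exists_pos_of_mem_stdSimplex hR).choose.1⟩
  have hcard : (0 : ℝ) < Fintype.card 𝒳 := by exact_mod_cast Fintype.card_pos
  have hterm (p : 𝒳 × 𝒴) : R p * Real.log (R p / ((Fintype.card 𝒳 : ℝ)⁻¹ * margSnd R p.2))
      ≤ R p * Real.log (Fintype.card 𝒳) := by
    rcases (hR.1 p).eq_or_lt' with hp | hp
    · simp [hp]
    have hle : R p ≤ margSnd R p.2 :=
      Finset.single_le_sum (f := fun x => R (x, p.2)) (fun x _ => hR.1 _) (Finset.mem_univ p.1)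
    have hm : 0 < margSnd R p.2 := hp.trans_le hle
    refine mul_le_mul_of_nonneg_left (Real.log_le_log (by positivity) ?_) hp.le
    rwa [div_le_iff₀ (by positivity), mul_inv_cancel_left₀ hcard.ne']
  calc mutualInfoReal R
      ≤ relEntropyReal R (prodPmf (fun _ => (Fintype.card 𝒳 : ℝ)⁻¹) (margSnd R)) :=
        mutualInfoReal_le_relEntropyReal_prodPmf hR const_inv_card_mem_stdSimplex
          (margSnd_mem_stdSimplex hR)
          fun p hp => mul_ne_zero (inv_ne_zero hcard.ne') (margSnd_ne_zero hR.1 hp)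
    _ ≤ ∑ p, R p * Real.log (Fintype.card 𝒳) := Finset.sum_le_sum fun p _ => hterm p
    _ = Real.log (Fintype.card 𝒳) := by rw [← Finset.sum_mul, hR.2, one_mul]

end MutualInfo

section RenyiJ

theorem renyiDiv_comp_equiv {ι κ : Type*} [Fintype ι] [Fintype κ] (e : κ ≃ ι) (α : ℝ)
    (P Q : ι → ℝ) : renyiDiv α (P ∘ e) (Q ∘ e) = renyiDiv α P Q := by
  have hrel : relEntropy (P ∘ e) (Q ∘ e) = relEntropy P Q := e.sum_comp fun x =>
    (P x : EReal) * ENNReal.log (ENNReal.ofReal (P x) / ENNReal.ofReal (Q x))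
  have hsum : renyiSum α (P ∘ e) (Q ∘ e) = renyiSum α P Q := e.sum_comp fun x =>
    ENNReal.ofReal (P x) ^ α * ENNReal.ofReal (Q x) ^ (1 - α)
  rcases eq_or_ne α 1 with rfl | hα1
  · rw [renyiDiv_one, renyiDiv_one, hrel]
  · rw [renyiDiv_of_ne_one hα1, renyiDiv_of_ne_one hα1, hsum]

variable {𝒳 𝒴 : Type*} [Fintype 𝒳] [Fintype 𝒴] {α : ℝ} {P : 𝒳 × 𝒴 → ℝ} {Q : 𝒳 → ℝ} {T : 𝒴 → ℝ}

theorem renyiDiv_comp_swap (α : ℝ) (P : 𝒳 × 𝒴 → ℝ) (Q : 𝒳 → ℝ) (T : 𝒴 → ℝ) :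
    renyiDiv α (P ∘ Prod.swap) (prodPmf T Q) = renyiDiv α P (prodPmf Q T) := by
  rw [← prodPmf_comp_swap]
  exact renyiDiv_comp_equiv (Equiv.prodComm 𝒴 𝒳) α P _

theorem renyiJ_le (hQ : Q ∈ stdSimplex ℝ 𝒳) (hT : T ∈ stdSimplex ℝ 𝒴) :
    renyiJ α P ≤ renyiDiv α P (prodPmf Q T) :=
  (iInf₂_le Q hQ).trans (iInf₂_le T hT)

theorem le_renyiJ {c : EReal}
    (h : ∀ Q ∈ stdSimplex ℝ 𝒳, ∀ T ∈ stdSimplex ℝ 𝒴, c ≤ renyiDiv α P (prodPmf Q T)) :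
    c ≤ renyiJ α P :=
  le_iInf₂ fun Q hQ => le_iInf₂ fun T hT => h Q hQ T hT

theorem renyiJ_comp_swap (α : ℝ) (P : 𝒳 × 𝒴 → ℝ) : renyiJ α (P ∘ Prod.swap) = renyiJ α P := by
  refine le_antisymm (le_renyiJ fun Q hQ T hT => ?_) (le_renyiJ fun T hT Q hQ => ?_)
  · exact renyiDiv_comp_swap α P Q T ▸ renyiJ_le hT hQ
  · exact renyiDiv_comp_swap α P Q T ▸ renyiJ_le hQ hT

theorem renyiJ_one (hP : P ∈ stdSimplex ℝ (𝒳 × 𝒴)) : renyiJ 1 P = mutualInfo P := by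
  refine le_antisymm ?_ (le_renyiJ fun Q hQ T hT => ?_)
  · rw [mutualInfo, ← renyiDiv_one]
    exact renyiJ_le (margFst_mem_stdSimplex hP) (margSnd_mem_stdSimplex hP)
  · rw [renyiDiv_one, mutualInfo_eq_coe hP]
    by_cases h : P.support ⊆ (prodPmf Q T).support
    · rw [relEntropy_eq_coe hP.1 (prodPmf_nonneg hQ.1 hT.1) h]
      exact_mod_cast mutualInfoReal_le_relEntropyReal_prodPmf hP hQ hT h
    · simp [relEntropy_eq_top hP.1 (prodPmf_nonneg hQ.1 hT.1) h]

theorem exists_renyiJ_eq (hα : 0 < α) (hP : P ∈ stdSimplex ℝ (𝒳 × 𝒴)) :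
    ∃ Q ∈ stdSimplex ℝ 𝒳, ∃ T ∈ stdSimplex ℝ 𝒴, renyiJ α P = renyiDiv α P (prodPmf Q T) := by
  rcases eq_or_ne α 1 with rfl | hα1
  · exact ⟨_, margFst_mem_stdSimplex hP, _, margSnd_mem_stdSimplex hP, by
      rw [renyiJ_one hP, renyiDiv_one, mutualInfo]⟩
  · have hcont : Continuous fun q : (𝒳 → ℝ) × (𝒴 → ℝ) => renyiDiv α P (prodPmf q.1 q.2) :=
      (continuous_renyiDiv_right hα hα1 P).comp (by unfold prodPmf; fun_prop)
    obtain ⟨q, hq, hmin⟩ := ((isCompact_stdSimplex ℝ 𝒳).prod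
      (isCompact_stdSimplex ℝ 𝒴)).exists_isMinOn
        ⟨(margFst P, margSnd P), margFst_mem_stdSimplex hP, margSnd_mem_stdSimplex hP⟩
        hcont.continuousOn
    exact ⟨q.1, hq.1, q.2, hq.2, le_antisymm (renyiJ_le hq.1 hq.2)
      (le_renyiJ fun Q hQ T hT => isMinOn_iff.1 hmin (Q, T) ⟨hQ, hT⟩)⟩

theorem renyiJ_nonneg (hα : 0 < α) (hP : P ∈ stdSimplex ℝ (𝒳 × 𝒴)) : 0 ≤ renyiJ α P :=
  le_renyiJ fun _ hQ _ hT => renyiDiv_nonneg hα hP (prodPmf_mem_stdSimplex hQ hT)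

theorem renyiJ_ne_bot (hα : 0 < α) (hP : P ∈ stdSimplex ℝ (𝒳 × 𝒴)) : renyiJ α P ≠ ⊥ :=
  ne_bot_of_le_ne_bot EReal.zero_ne_bot (renyiJ_nonneg hα hP)

theorem renyiJ_ne_top (hα : 0 < α) (hP : P ∈ stdSimplex ℝ (𝒳 × 𝒴)) : renyiJ α P ≠ ⊤ := by
  rcases eq_or_ne α 1 with rfl | hα1
  · rw [renyiJ_one hP, mutualInfo_eq_coe hP]
    exact EReal.coe_ne_top _
  · have hM := (prodPmf_marg_mem_stdSimplex hP).1
    have hsupp := support_subset_support_prodPmf_marg hP.1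
    refine ne_top_of_le_ne_top ?_
      (renyiJ_le (margFst_mem_stdSimplex hP) (margSnd_mem_stdSimplex hP))
    rw [renyiDiv_eq_coe hα hα1 hP.1 hM (.inr hsupp)
      (sum_tilt_pos hα hα1 hP hP.1 hM subset_rfl hsupp)]
    exact EReal.coe_ne_top _

theorem coe_toReal_renyiJ (hα : 0 < α) (hP : P ∈ stdSimplex ℝ (𝒳 × 𝒴)) :
    (((renyiJ α P).toReal : ℝ) : EReal) = renyiJ α P :=
  EReal.coe_toReal (renyiJ_ne_top hα hP) (renyiJ_ne_bot hα hP)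

theorem renyiJ_eq_zero_iff (hα : 0 < α) (hP : P ∈ stdSimplex ℝ (𝒳 × 𝒴)) :
    renyiJ α P = 0 ↔ P = prodPmf (margFst P) (margSnd P) := by
  refine ⟨fun h => ?_, fun h => le_antisymm ?_ (renyiJ_nonneg hα hP)⟩
  · obtain ⟨Q, hQ, T, hT, hmin⟩ := exists_renyiJ_eq hα hP
    obtain rfl := eq_of_renyiDiv_eq_zero hα hP (prodPmf_mem_stdSimplex hQ hT) (hmin ▸ h)
    rw [margFst_prodPmf Q hT, margSnd_prodPmf hQ T]
  · have hle := renyiJ_le (α := α) (P := P) (margFst_mem_stdSimplex hP) (margSnd_mem_stdSimplex hP)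
    rwa [← h, renyiDiv_self hα hP] at hle

end RenyiJ

/-- The objective `I_R(X;Y) + α / (1 - α) * D(R‖P)` of the variational formulas as a real number. It
equals `dualObjective α P R` if `R` vanishes wherever `P` does. -/
noncomputable def dualObjectiveReal {𝒳 𝒴 : Type*} [Fintype 𝒳] [Fintype 𝒴] (α : ℝ)
    (P R : 𝒳 × 𝒴 → ℝ) : ℝ :=
  mutualInfoReal R + α / (1 - α) * relEntropyReal R P

/-- The normalization of `A ^ (1 / α)`, which minimizes
`T ↦ (α - 1)⁻¹ * log ∑ y, A y * T y ^ (1 - α)`. -/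
noncomputable def escort {ι : Type*} [Fintype ι] (α : ℝ) (A : ι → ENNReal) : ι → ℝ :=
  fun x => (A x ^ (1 / α) / ∑ y, A y ^ (1 / α)).toReal

/-- The sum over the first coordinate in the reduced objective. -/
noncomputable def innerSum {𝒳 𝒴 : Type*} [Fintype 𝒳] (α : ℝ) (P : 𝒳 × 𝒴 → ℝ) (Q : 𝒳 → ℝ) :
    𝒴 → ENNReal :=
  fun y => ∑ x, ENNReal.ofReal (P (x, y)) ^ α * ENNReal.ofReal (Q x) ^ (1 - α)

section Dual

variable {𝒳 𝒴 : Type*} [Fintype 𝒳] [Fintype 𝒴] {α : ℝ} {P R : 𝒳 × 𝒴 → ℝ}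

theorem dualObjective_eq_coe (hP : ∀ p, 0 ≤ P p) (hR : R ∈ stdSimplex ℝ (𝒳 × 𝒴))
    (h : R.support ⊆ P.support) : dualObjective α P R = (dualObjectiveReal α P R : EReal) := by
  rw [dualObjective, mutualInfo_eq_coe hR, relEntropy_eq_coe hR.1 hP h]
  norm_cast

theorem dualObjective_eq_top (hα : 0 < α) (hα1 : α < 1) (hP : ∀ p, 0 ≤ P p)
    (hR : R ∈ stdSimplex ℝ (𝒳 × 𝒴)) (h : ¬ R.support ⊆ P.support) : dualObjective α P R = ⊤ := by
  rw [dualObjective, mutualInfo_eq_coe hR, relEntropy_eq_top hR.1 hP h,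
    EReal.coe_mul_top_of_pos (div_pos hα (by linarith)), EReal.coe_add_top]

theorem dualObjective_eq_bot (hα : 1 < α) (hP : ∀ p, 0 ≤ P p)
    (hR : R ∈ stdSimplex ℝ (𝒳 × 𝒴)) (h : ¬ R.support ⊆ P.support) : dualObjective α P R = ⊥ := by
  rw [dualObjective, mutualInfo_eq_coe hR, relEntropy_eq_top hR.1 hP h,
    EReal.coe_mul_top_of_neg (div_neg_of_pos_of_neg (by linarith) (by linarith)), EReal.add_bot]

theorem renyiJ_le_dualObjectiveReal (hα : 0 < α) (hα1 : α < 1) (hP : ∀ p, 0 ≤ P p)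
    (hR : R ∈ stdSimplex ℝ (𝒳 × 𝒴)) (h : R.support ⊆ P.support) :
    renyiJ α P ≤ (dualObjectiveReal α P R : EReal) :=
  (renyiJ_le (margFst_mem_stdSimplex hR) (margSnd_mem_stdSimplex hR)).trans
    (renyiDiv_le_of_lt_one hα hα1 hR hP (prodPmf_marg_mem_stdSimplex hR).1 h
      (support_subset_support_prodPmf_marg hR.1))

theorem dualObjectiveReal_le_renyiJ (hα : 1 < α) (hP : ∀ p, 0 ≤ P p)
    (hR : R ∈ stdSimplex ℝ (𝒳 × 𝒴)) (h : R.support ⊆ P.support) :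
    (dualObjectiveReal α P R : EReal) ≤ renyiJ α P := by
  refine le_renyiJ fun Q hQ T hT => ?_
  have hM := prodPmf_nonneg hQ.1 hT.1
  by_cases hPM : P.support ⊆ (prodPmf Q T).support
  · refine le_trans ?_ (le_renyiDiv_of_one_lt hα hR hP hM h)
    rw [EReal.coe_le_coe_iff, dualObjectiveReal]
    gcongr
    exact mutualInfoReal_le_relEntropyReal_prodPmf hR hQ hT (h.trans hPM)
  · simp [renyiDiv_eq_top hα hP hPM]

theorem exists_renyiJ_eq_of_lt_one (hα : 0 < α) (hα1 : α < 1) (hP : P ∈ stdSimplex ℝ (𝒳 × 𝒴)) :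
    ∃ R ∈ stdSimplex ℝ (𝒳 × 𝒴), R.support ⊆ P.support ∧
      renyiJ α P = (dualObjectiveReal α P R : EReal) := by
  obtain ⟨Q, hQ, T, hT, hmin⟩ := exists_renyiJ_eq hα hP
  have hM := prodPmf_nonneg hQ.1 hT.1
  have hfin := hmin ▸ renyiJ_ne_top hα hP
  have hS := sum_tilt_pos_of_renyiDiv_ne_top hα hα1.ne hP hM hfin
  have hR := normalized_mem_stdSimplex (tilt_nonneg (α := α) hP.1 hM) hS
  have hsupp := support_normalized_tilt hα hα1.ne hP.1 hM hS
  have hRP := hsupp.trans_subset Set.inter_subset_left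
  refine ⟨_, hR, hRP, le_antisymm (renyiJ_le_dualObjectiveReal hα hα1 hP.1 hR hRP) ?_⟩
  rw [hmin, renyiDiv_eq_normalized_tilt hα hα1.ne hP hM hfin, EReal.coe_le_coe_iff,
    dualObjectiveReal]
  gcongr
  exact mutualInfoReal_le_relEntropyReal_prodPmf hR hQ hT
    (hsupp.trans_subset Set.inter_subset_right)

theorem isLeast_dualObjective (hα : 0 < α) (hα1 : α < 1) (hP : P ∈ stdSimplex ℝ (𝒳 × 𝒴)) :
    IsLeast (dualObjective α P '' stdSimplex ℝ (𝒳 × 𝒴)) (renyiJ α P) := by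
  constructor
  · obtain ⟨R, hR, h, hmin⟩ := exists_renyiJ_eq_of_lt_one hα hα1 hP
    exact ⟨R, hR, by rw [hmin, dualObjective_eq_coe hP.1 hR h]⟩
  · rintro _ ⟨R, hR, rfl⟩
    by_cases h : R.support ⊆ P.support
    · rw [dualObjective_eq_coe hP.1 hR h]
      exact renyiJ_le_dualObjectiveReal hα hα1 hP.1 hR h
    · simp [dualObjective_eq_top hα hα1 hP.1 hR h]

theorem dualObjective_le_renyiJ (hα : 1 < α) (hP : ∀ p, 0 ≤ P p)
    (hR : R ∈ stdSimplex ℝ (𝒳 × 𝒴)) : dualObjective α P R ≤ renyiJ α P := by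
  by_cases h : R.support ⊆ P.support
  · rw [dualObjective_eq_coe hP hR h]
    exact dualObjectiveReal_le_renyiJ hα hP hR h
  · simp [dualObjective_eq_bot hα hP hR h]

end Dual

section Escort

variable {ι : Type*} [Fintype ι] {α : ℝ} {A : ι → ENNReal}

theorem escort_mem_stdSimplex (h0 : ∑ y, A y ^ (1 / α) ≠ 0) (htop : ∑ y, A y ^ (1 / α) ≠ ⊤) :
    escort α A ∈ stdSimplex ℝ ι := by
  refine ⟨fun x => ENNReal.toReal_nonneg, ?_⟩
  simp only [escort]
  rw [← ENNReal.toReal_sum fun x _ =>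
    ENNReal.div_ne_top (ENNReal.sum_ne_top.1 htop x (Finset.mem_univ x)) h0]
  simp only [div_eq_mul_inv]
  rw [← Finset.sum_mul, ENNReal.mul_inv_cancel (by simpa using h0) (by simpa using htop),
    ENNReal.toReal_one]

theorem eq_mul_ofReal_escort_rpow (hα : 0 < α) (h0 : ∑ y, A y ^ (1 / α) ≠ 0)
    (htop : ∑ y, A y ^ (1 / α) ≠ ⊤) (x : ι) :
    A x = (∑ y, A y ^ (1 / α)) ^ α * ENNReal.ofReal (escort α A x) ^ α := by
  rw [escort, ENNReal.ofReal_toReal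
      (ENNReal.div_ne_top (ENNReal.sum_ne_top.1 htop x (Finset.mem_univ x)) h0),
    ← ENNReal.mul_rpow_of_nonneg _ _ hα.le, ENNReal.mul_div_cancel h0 htop, ← ENNReal.rpow_mul,
    one_div, inv_mul_cancel₀ hα.ne', ENNReal.rpow_one]

theorem sum_mul_rpow_eq_rpow_mul_renyiSum_escort (hα : 0 < α) (h0 : ∑ y, A y ^ (1 / α) ≠ 0)
    (htop : ∑ y, A y ^ (1 / α) ≠ ⊤) (T : ι → ℝ) :
    ∑ y, A y * ENNReal.ofReal (T y) ^ (1 - α)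
      = (∑ y, A y ^ (1 / α)) ^ α * renyiSum α (escort α A) T := by
  rw [renyiSum, Finset.mul_sum]
  refine Finset.sum_congr rfl fun y _ => ?_
  conv_lhs => rw [eq_mul_ofReal_escort_rpow hα h0 htop y]
  rw [mul_assoc]

theorem log_sum_mul_rpow_eq_add_renyiDiv_escort (hα : 0 < α) (hα1 : α ≠ 1)
    (h0 : ∑ y, A y ^ (1 / α) ≠ 0) (htop : ∑ y, A y ^ (1 / α) ≠ ⊤) (T : ι → ℝ) :
    ENNReal.log ((∑ y, A y * ENNReal.ofReal (T y) ^ (1 - α)) ^ (α - 1)⁻¹)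
      = ENNReal.log (((∑ y, A y ^ (1 / α)) ^ α) ^ (α - 1)⁻¹) + renyiDiv α (escort α A) T := by
  rw [renyiDiv_eq_log_rpow hα1, sum_mul_rpow_eq_rpow_mul_renyiSum_escort hα h0 htop,
    ← ENNReal.log_mul_add, ENNReal.mul_rpow_eq_ite, if_neg]
  simp only [(ENNReal.rpow_pos (pos_of_ne_zero h0) htop).ne',
    ENNReal.rpow_ne_top_of_nonneg hα.le htop, false_and, or_self, not_false_eq_true]

theorem sum_mul_rpow_eq_rpow_of_eq_zero_or_eq_top (hα : 0 < α)
    (h : ∑ y, A y ^ (1 / α) = 0 ∨ 1 < α ∧ ∑ y, A y ^ (1 / α) = ⊤) (T : ι → ℝ) :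
    ∑ y, A y * ENNReal.ofReal (T y) ^ (1 - α) = (∑ y, A y ^ (1 / α)) ^ α := by
  rcases h with h0 | ⟨hα1, htop⟩
  · rw [h0, ENNReal.zero_rpow_of_pos hα]
    refine Finset.sum_eq_zero fun y hy => ?_
    rw [(ENNReal.rpow_eq_zero_iff_of_pos (by positivity)).1 (Finset.sum_eq_zero_iff.1 h0 y hy),
      zero_mul]
  · rw [htop, ENNReal.top_rpow_of_pos hα]
    obtain ⟨y, hy, hAy⟩ := ENNReal.sum_eq_top.1 htop
    refine ENNReal.sum_eq_top.2 ⟨y, hy, ?_⟩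
    rw [(ENNReal.rpow_eq_top_iff_of_pos (by positivity)).1 hAy, ENNReal.top_mul]
    simp [ENNReal.rpow_eq_zero_iff, hα1.le]

end Escort

section Sibson

variable {𝒳 𝒴 : Type*} [Fintype 𝒳] {α : ℝ} {P : 𝒳 × 𝒴 → ℝ} {Q : 𝒳 → ℝ} {T : 𝒴 → ℝ}

theorem ofReal_mul_rpow {a b : ℝ} (ha : 0 ≤ a) (r : ℝ) :
    ENNReal.ofReal (a * b) ^ r = ENNReal.ofReal a ^ r * ENNReal.ofReal b ^ r := by
  rw [ENNReal.ofReal_mul ha,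
    ENNReal.mul_rpow_of_ne_top ENNReal.ofReal_ne_top ENNReal.ofReal_ne_top]

theorem innerSum_ne_top (hα : 0 < α) (hα1 : α < 1) (P : 𝒳 × 𝒴 → ℝ) (Q : 𝒳 → ℝ) (y : 𝒴) :
    innerSum α P Q y ≠ ⊤ :=
  ENNReal.sum_ne_top.2 fun _ _ => ENNReal.mul_ne_top
    (ENNReal.rpow_ne_top_of_nonneg hα.le ENNReal.ofReal_ne_top)
    (ENNReal.rpow_ne_top_of_nonneg (sub_nonneg.2 hα1.le) ENNReal.ofReal_ne_top)

theorem ofReal_margSnd_tilt_prodPmf (hα : 0 < α) (hP : ∀ p, 0 ≤ P p) (hQ : ∀ x, 0 ≤ Q x)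
    (hT : ∀ y, 0 ≤ T y) (h : α < 1 ∨ P.support ⊆ (prodPmf Q T).support) (y : 𝒴) :
    ENNReal.ofReal (margSnd (tilt α P (prodPmf Q T)) y)
      = innerSum α P Q y * ENNReal.ofReal (T y) ^ (1 - α) := by
  have hM := prodPmf_nonneg hQ hT
  rw [margSnd, ENNReal.ofReal_sum_of_nonneg fun x _ => tilt_nonneg hP hM _, innerSum,
    Finset.sum_mul]
  refine Finset.sum_congr rfl fun x _ => ?_
  rw [ofReal_tilt hα hP hM h, prodPmf, ofReal_mul_rpow (hQ x), mul_assoc]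

variable [Fintype 𝒴]

theorem renyiSum_prodPmf (α : ℝ) (P : 𝒳 × 𝒴 → ℝ) (hQ : ∀ x, 0 ≤ Q x) (T : 𝒴 → ℝ) :
    renyiSum α P (prodPmf Q T) = ∑ y, innerSum α P Q y * ENNReal.ofReal (T y) ^ (1 - α) := by
  simp only [renyiSum, prodPmf, innerSum, Fintype.sum_prod_type_right, Finset.sum_mul, mul_assoc,
    ofReal_mul_rpow (hQ _)]

theorem reducedObjective_eq_log_rpow (α : ℝ) (P : 𝒳 × 𝒴 → ℝ) (Q : 𝒳 → ℝ) :
    reducedObjective α P Q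
      = ENNReal.log (((∑ y, innerSum α P Q y ^ (1 / α)) ^ α) ^ (α - 1)⁻¹) := by
  rw [← ENNReal.rpow_mul, ← div_eq_mul_inv, ENNReal.log_rpow]
  rfl

theorem sum_innerSum_rpow_ne_zero_and_ne_top (hα : 0 < α) (hα1 : α ≠ 1)
    (hbot : reducedObjective α P Q ≠ ⊥) (htop : reducedObjective α P Q ≠ ⊤) :
    ∑ y, innerSum α P Q y ^ (1 / α) ≠ 0 ∧ ∑ y, innerSum α P Q y ^ (1 / α) ≠ ⊤ := by
  rw [reducedObjective_eq_log_rpow, Ne, ENNReal.log_eq_bot_iff] at hbot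
  rw [reducedObjective_eq_log_rpow, Ne, ENNReal.log_eq_top_iff] at htop
  generalize ∑ y, innerSum α P Q y ^ (1 / α) = S at *
  constructor <;> rintro rfl <;> rcases hα1.lt_or_gt with hlt | hgt <;>
    simp_all [ENNReal.zero_rpow_of_pos, ENNReal.top_rpow_of_pos]

-- Sibson's identity.
theorem renyiDiv_prodPmf_eq_reducedObjective_add (hα : 0 < α) (hα1 : α ≠ 1) (hQ : ∀ x, 0 ≤ Q x)
    (h0 : ∑ y, innerSum α P Q y ^ (1 / α) ≠ 0) (htop : ∑ y, innerSum α P Q y ^ (1 / α) ≠ ⊤)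
    (T : 𝒴 → ℝ) :
    renyiDiv α P (prodPmf Q T)
      = reducedObjective α P Q + renyiDiv α (escort α (innerSum α P Q)) T := by
  rw [renyiDiv_eq_log_rpow hα1, renyiSum_prodPmf α P hQ, reducedObjective_eq_log_rpow,
    log_sum_mul_rpow_eq_add_renyiDiv_escort hα hα1 h0 htop]

theorem isLeast_reducedObjective (hα : 0 < α) (hα1 : α ≠ 1) (hP : P ∈ stdSimplex ℝ (𝒳 × 𝒴))
    (hQ : ∀ x, 0 ≤ Q x) :
    IsLeast ((fun T => renyiDiv α P (prodPmf Q T)) '' stdSimplex ℝ 𝒴)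
      (reducedObjective α P Q) := by
  by_cases h : ∑ y, innerSum α P Q y ^ (1 / α) = 0
      ∨ 1 < α ∧ ∑ y, innerSum α P Q y ^ (1 / α) = ⊤
  · have hconst (T : 𝒴 → ℝ) : renyiDiv α P (prodPmf Q T) = reducedObjective α P Q := by
      rw [renyiDiv_eq_log_rpow hα1, renyiSum_prodPmf α P hQ,
        sum_mul_rpow_eq_rpow_of_eq_zero_or_eq_top hα h, reducedObjective_eq_log_rpow]
    refine ⟨⟨_, margSnd_mem_stdSimplex hP, hconst _⟩, ?_⟩
    rintro _ ⟨T, -, rfl⟩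
    exact (hconst T).ge
  · obtain ⟨h0, htop⟩ := not_or.1 h
    replace htop : ∑ y, innerSum α P Q y ^ (1 / α) ≠ ⊤ := by
      refine hα1.lt_or_gt.elim (fun hlt => ENNReal.sum_ne_top.2 fun y _ => ?_)
        fun hgt => not_and.1 htop hgt
      exact ENNReal.rpow_ne_top_of_nonneg (by positivity) (innerSum_ne_top hα hlt P Q y)
    have hE := escort_mem_stdSimplex h0 htop
    have hsibson := renyiDiv_prodPmf_eq_reducedObjective_add hα hα1 hQ h0 htop
    refine ⟨⟨_, hE, by simp only [hsibson, renyiDiv_self hα hE, add_zero]⟩, ?_⟩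
    rintro _ ⟨T, hT, rfl⟩
    simp only [hsibson]
    exact le_add_of_nonneg_right (renyiDiv_nonneg hα hE hT)

theorem isLeast_renyiJ_reducedObjective (hα : 0 < α) (hα1 : α ≠ 1)
    (hP : P ∈ stdSimplex ℝ (𝒳 × 𝒴)) :
    IsLeast (reducedObjective α P '' stdSimplex ℝ 𝒳) (renyiJ α P) := by
  have hle : ∀ Q ∈ stdSimplex ℝ 𝒳, renyiJ α P ≤ reducedObjective α P Q := fun Q hQ => by
    obtain ⟨T, hT, hmin⟩ := (isLeast_reducedObjective hα hα1 hP hQ.1).1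
    exact hmin ▸ renyiJ_le hQ hT
  refine ⟨?_, by rintro _ ⟨Q, hQ, rfl⟩; exact hle Q hQ⟩
  obtain ⟨Q, hQ, T, hT, hmin⟩ := exists_renyiJ_eq hα hP
  refine ⟨Q, hQ, le_antisymm ?_ (hle Q hQ)⟩
  exact hmin ▸ (isLeast_reducedObjective hα hα1 hP hQ.1).2 ⟨T, hT, rfl⟩

end Sibson

section FixedPoint

variable {𝒳 𝒴 : Type*} [Fintype 𝒳] [Fintype 𝒴] {α : ℝ} {P : 𝒳 × 𝒴 → ℝ} {Q : 𝒳 → ℝ} {T : 𝒴 → ℝ}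

theorem margFst_normalized (w : 𝒳 × 𝒴 → ℝ) : margFst (normalized w) = normalized (margFst w) := by
  funext x
  simp only [margFst, normalized, ← Finset.sum_div, Fintype.sum_prod_type]

theorem margSnd_normalized (w : 𝒳 × 𝒴 → ℝ) : margSnd (normalized w) = normalized (margSnd w) := by
  funext y
  simp only [margSnd, normalized, ← Finset.sum_div, Fintype.sum_prod_type_right]

theorem normalized_eq_of_eq_mul {ι : Type*} [Fintype ι] {v w : ι → ℝ} {c : ℝ} (hc : c ≠ 0)
    (hv : v ∈ stdSimplex ℝ ι) (hw : ∀ x, w x = c * v x) : normalized w = v := by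
  funext x
  simp only [normalized, hw, ← Finset.mul_sum, hv.2, mul_one, mul_div_cancel_left₀ _ hc]

theorem escort_eq_of_renyiJ_eq (hα : 0 < α) (hα1 : α ≠ 1) (hP : P ∈ stdSimplex ℝ (𝒳 × 𝒴))
    (hQ : Q ∈ stdSimplex ℝ 𝒳) (hT : T ∈ stdSimplex ℝ 𝒴)
    (hmin : renyiJ α P = renyiDiv α P (prodPmf Q T)) :
    ∑ y, innerSum α P Q y ^ (1 / α) ≠ 0 ∧ ∑ y, innerSum α P Q y ^ (1 / α) ≠ ⊤ ∧
      escort α (innerSum α P Q) = T := by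
  have hred : reducedObjective α P Q = renyiJ α P :=
    le_antisymm (hmin ▸ (isLeast_reducedObjective hα hα1 hP hQ.1).2 ⟨T, hT, rfl⟩)
      ((isLeast_renyiJ_reducedObjective hα hα1 hP).2 ⟨Q, hQ, rfl⟩)
  obtain ⟨h0, htop⟩ := sum_innerSum_rpow_ne_zero_and_ne_top hα hα1
    (hred ▸ renyiJ_ne_bot hα hP) (hred ▸ renyiJ_ne_top hα hP)
  refine ⟨h0, htop, eq_of_renyiDiv_eq_zero hα (escort_mem_stdSimplex h0 htop) hT ?_⟩
  have hsibson := renyiDiv_prodPmf_eq_reducedObjective_add hα hα1 hQ.1 h0 htop T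
  rw [hred, ← hmin, ← coe_toReal_renyiJ hα hP] at hsibson
  have hcancel := congrArg (· - (((renyiJ α P).toReal : ℝ) : EReal)) hsibson
  simpa [EReal.sub_self, add_comm, EReal.add_sub_cancel_right] using hcancel.symm

theorem margSnd_normalized_tilt (hα : 0 < α) (hα1 : α ≠ 1) (hP : P ∈ stdSimplex ℝ (𝒳 × 𝒴))
    (hQ : Q ∈ stdSimplex ℝ 𝒳) (hT : T ∈ stdSimplex ℝ 𝒴)
    (hmin : renyiJ α P = renyiDiv α P (prodPmf Q T)) :
    margSnd (normalized (tilt α P (prodPmf Q T))) = T := by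
  obtain ⟨h0, htop, hE⟩ := escort_eq_of_renyiJ_eq hα hα1 hP hQ hT hmin
  have hsupp := lt_one_or_support_subset_of_renyiDiv_ne_top hα1 hP.1 (hmin ▸ renyiJ_ne_top hα hP)
  have hpow (y : 𝒴) : ENNReal.ofReal (T y) ^ α * ENNReal.ofReal (T y) ^ (1 - α)
      = ENNReal.ofReal (T y) := by
    rcases (hT.1 y).eq_or_lt' with hy | hy
    · simp [hy, hα]
    · rw [← ENNReal.rpow_add _ _ (by simpa using hy) ENNReal.ofReal_ne_top, add_sub_cancel,
        ENNReal.rpow_one]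
  have hmarg (y : 𝒴) : ENNReal.ofReal (margSnd (tilt α P (prodPmf Q T)) y)
      = (∑ y, innerSum α P Q y ^ (1 / α)) ^ α * ENNReal.ofReal (T y) := by
    rw [ofReal_margSnd_tilt_prodPmf hα hP.1 hQ.1 hT.1 hsupp,
      eq_mul_ofReal_escort_rpow hα h0 htop y, hE, mul_assoc, hpow]
  rw [margSnd_normalized]
  refine normalized_eq_of_eq_mul
    (c := ((∑ y, innerSum α P Q y ^ (1 / α)) ^ α).toReal) ?_ hT fun y => ?_
  · exact ENNReal.toReal_ne_zero.2 ⟨(ENNReal.rpow_pos (pos_of_ne_zero h0) htop).ne',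
      ENNReal.rpow_ne_top_of_nonneg hα.le htop⟩
  · rw [← ENNReal.toReal_ofReal (hT.1 y), ← ENNReal.toReal_mul, ← hmarg, ENNReal.toReal_ofReal]
    exact Finset.sum_nonneg fun x _ => tilt_nonneg hP.1 (prodPmf_nonneg hQ.1 hT.1) _

theorem margFst_normalized_tilt (hα : 0 < α) (hα1 : α ≠ 1) (hP : P ∈ stdSimplex ℝ (𝒳 × 𝒴))
    (hQ : Q ∈ stdSimplex ℝ 𝒳) (hT : T ∈ stdSimplex ℝ 𝒴)
    (hmin : renyiJ α P = renyiDiv α P (prodPmf Q T)) :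
    margFst (normalized (tilt α P (prodPmf Q T))) = Q := by
  rw [← renyiJ_comp_swap, ← renyiDiv_comp_swap] at hmin
  have hswap := margSnd_normalized_tilt hα hα1 (comp_swap_mem_stdSimplex hP) hT hQ hmin
  rw [← prodPmf_comp_swap Q T, margSnd_normalized] at hswap
  rw [margFst_normalized]
  exact hswap

theorem exists_renyiJ_eq_of_one_lt (hα : 1 < α) (hP : P ∈ stdSimplex ℝ (𝒳 × 𝒴)) :
    ∃ R ∈ stdSimplex ℝ (𝒳 × 𝒴), R.support ⊆ P.support ∧
      renyiJ α P = (dualObjectiveReal α P R : EReal) ∧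
      renyiJ α P = renyiDiv α P (prodPmf (margFst R) (margSnd R)) := by
  have hα0 : 0 < α := one_pos.trans hα
  obtain ⟨Q, hQ, T, hT, hmin⟩ := exists_renyiJ_eq hα0 hP
  have hM := prodPmf_nonneg hQ.1 hT.1
  have hfin := hmin ▸ renyiJ_ne_top hα0 hP
  have hS := sum_tilt_pos_of_renyiDiv_ne_top hα0 hα.ne' hP hM hfin
  have hX := margFst_normalized_tilt hα0 hα.ne' hP hQ hT hmin
  have hY := margSnd_normalized_tilt hα0 hα.ne' hP hQ hT hmin
  refine ⟨_, normalized_mem_stdSimplex (tilt_nonneg hP.1 hM) hS,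
    (support_normalized_tilt hα0 hα.ne' hP.1 hM hS).trans_subset Set.inter_subset_left, ?_, ?_⟩
  · rw [hmin, renyiDiv_eq_normalized_tilt hα0 hα.ne' hP hM hfin, dualObjectiveReal,
      mutualInfoReal, hX, hY]
  · rw [hX, hY, hmin]

theorem isGreatest_dualObjective (hα : 1 < α) (hP : P ∈ stdSimplex ℝ (𝒳 × 𝒴)) :
    IsGreatest (dualObjective α P '' stdSimplex ℝ (𝒳 × 𝒴)) (renyiJ α P) := by
  constructor
  · obtain ⟨R, hR, h, hmax, -⟩ := exists_renyiJ_eq_of_one_lt hα hP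
    exact ⟨R, hR, by rw [hmax, dualObjective_eq_coe hP.1 hR h]⟩
  · rintro _ ⟨R, hR, rfl⟩
    exact dualObjective_le_renyiJ hα hP.1 hR

end FixedPoint

section StrictConcavity

theorem eStrictConcaveOn_of_eq_coe {E : Type*} [AddCommGroup E] [Module ℝ E] {s t : Set E}
    {f : E → EReal} {g : E → ℝ} (hs : Convex ℝ s) (hg : StrictConcaveOn ℝ (s ∩ t) g)
    (hcoe : ∀ x ∈ s, x ∈ t → f x = g x) (hbot : ∀ x ∈ s, x ∉ t → f x = ⊥) :
    EStrictConcaveOn s f := by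
  have mem_of_ne_bot {x : E} (hx : x ∈ s) (h : f x ≠ ⊥) : x ∈ t := not_not.1 fun ht =>
    h (hbot x hx ht)
  refine ⟨⟨hs, fun x hx y hy a b ha hb hab => ?_⟩,
    fun x hx hfx y hy hfy hxy a b ha hb hab => ?_⟩
  · rcases ha.eq_or_lt with rfl | ha
    · obtain rfl : b = 1 := by simpa using hab
      simp
    rcases hb.eq_or_lt with rfl | hb
    · obtain rfl : a = 1 := by simpa using hab
      simp
    by_cases hfx : f x = ⊥
    · simp [hfx, EReal.coe_mul_bot_of_pos ha]
    by_cases hfy : f y = ⊥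
    · simp [hfy, EReal.coe_mul_bot_of_pos hb]
    have hxt := mem_of_ne_bot hx hfx
    have hyt := mem_of_ne_bot hy hfy
    have hmem := hg.1 ⟨hx, hxt⟩ ⟨hy, hyt⟩ ha.le hb.le hab
    rw [hcoe x hx hxt, hcoe y hy hyt, hcoe _ hmem.1 hmem.2]
    exact_mod_cast hg.concaveOn.2 ⟨hx, hxt⟩ ⟨hy, hyt⟩ ha.le hb.le hab
  · have hxt := mem_of_ne_bot hx hfx
    have hyt := mem_of_ne_bot hy hfy
    have hmem := hg.1 ⟨hx, hxt⟩ ⟨hy, hyt⟩ ha.le hb.le hab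
    rw [hcoe x hx hxt, hcoe y hy hyt, hcoe _ hmem.1 hmem.2]
    exact_mod_cast hg.2 ⟨hx, hxt⟩ ⟨hy, hyt⟩ hxy ha hb hab

theorem strictConcaveOn_const_mul {E : Type*} [AddCommGroup E] [Module ℝ E] {s : Set E}
    {f : E → ℝ} {c : ℝ} (hc : 0 < c) (hf : StrictConcaveOn ℝ s f) :
    StrictConcaveOn ℝ s fun x => c * f x := by
  refine ⟨hf.1, fun x hx y hy hxy a b ha hb hab => ?_⟩
  have hlt := mul_lt_mul_of_pos_left (hf.2 hx hy hxy ha hb hab) hc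
  simp only [smul_eq_mul] at hlt ⊢
  linear_combination hlt

theorem strictConcaveOn_sum_negMulLog (ι : Type*) [Fintype ι] :
    StrictConcaveOn ℝ (Set.Ici (0 : ι → ℝ)) fun w => ∑ x, Real.negMulLog (w x) := by
  refine ⟨convex_Ici 0, fun v hv w hw hvw a b ha hb hab => ?_⟩
  obtain ⟨x, hx⟩ := Function.ne_iff.1 hvw
  simp only [Finset.smul_sum, ← Finset.sum_add_distrib]
  exact Finset.sum_lt_sum
    (fun y _ => Real.concaveOn_negMulLog.2 (hv y) (hw y) ha.le hb.le hab)
    ⟨x, Finset.mem_univ x, Real.strictConcaveOn_negMulLog.2 (hv x) (hw x) hx ha hb hab⟩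

theorem isLinearMap_margFst {𝒳 𝒴 : Type*} [Fintype 𝒴] :
    IsLinearMap ℝ (margFst : (𝒳 × 𝒴 → ℝ) → 𝒳 → ℝ) where
  map_add R S := by ext x; simp [margFst, Finset.sum_add_distrib]
  map_smul c R := by ext x; simp [margFst, Finset.mul_sum]

theorem isLinearMap_margSnd {𝒳 𝒴 : Type*} [Fintype 𝒳] :
    IsLinearMap ℝ (margSnd : (𝒳 × 𝒴 → ℝ) → 𝒴 → ℝ) where
  map_add R S := by ext y; simp [margSnd, Finset.sum_add_distrib]
  map_smul c R := by ext y; simp [margSnd, Finset.mul_sum]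

variable {𝒳 𝒴 : Type*} [Fintype 𝒳] [Fintype 𝒴] {α : ℝ} {P R : 𝒳 × 𝒴 → ℝ}

theorem relEntropyReal_eq_neg_sum_negMulLog_sub {ι : Type*} [Fintype ι] {P R : ι → ℝ}
    (h : R.support ⊆ P.support) :
    relEntropyReal R P = -∑ x, Real.negMulLog (R x) - ∑ x, R x * Real.log (P x) := by
  rw [relEntropyReal, ← Finset.sum_neg_distrib, ← Finset.sum_sub_distrib]
  refine Finset.sum_congr rfl fun x _ => ?_
  by_cases hx : R x = 0
  · simp [hx]
  · rw [Real.log_div hx (h hx), Real.negMulLog]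
    ring

theorem dualObjectiveReal_eq_sum_negMulLog (hα1 : α ≠ 1) (hR : ∀ p, 0 ≤ R p)
    (h : R.support ⊆ P.support) :
    dualObjectiveReal α P R
      = (α - 1)⁻¹ * ∑ p, Real.negMulLog (R p) + ∑ x, Real.negMulLog (margFst R x)
        + ∑ y, Real.negMulLog (margSnd R y) + α / (α - 1) * ∑ p, R p * Real.log (P p) := by
  have h₁ : α - 1 ≠ 0 := sub_ne_zero.2 hα1
  have h₂ : 1 - α ≠ 0 := sub_ne_zero.2 hα1.symm
  rw [dualObjectiveReal, mutualInfoReal_eq_sum_negMulLog hR,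
    relEntropyReal_eq_neg_sum_negMulLog_sub h]
  generalize ∑ p, Real.negMulLog (R p) = H
  field_simp
  ring

theorem strictConcaveOn_dualObjectiveReal (hα : 1 < α) (P : 𝒳 × 𝒴 → ℝ) :
    StrictConcaveOn ℝ (stdSimplex ℝ (𝒳 × 𝒴) ∩ {R | R.support ⊆ P.support})
      (dualObjectiveReal α P) := by
  have hconv : Convex ℝ {R : 𝒳 × 𝒴 → ℝ | R.support ⊆ P.support} :=
    fun R hR S hS a b _ _ _ => (Function.support_add _ _).trans (Set.union_subset
      ((Function.support_const_smul_subset a R).trans hR)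
      ((Function.support_const_smul_subset b S).trans hS))
  have hjoint := strictConcaveOn_const_mul (inv_pos.2 (sub_pos.2 hα))
    (strictConcaveOn_sum_negMulLog (𝒳 × 𝒴))
  have hfst := (strictConcaveOn_sum_negMulLog 𝒳).concaveOn.comp_linearMap
    (isLinearMap_margFst (𝒴 := 𝒴)).mk'
  have hsnd := (strictConcaveOn_sum_negMulLog 𝒴).concaveOn.comp_linearMap
    (isLinearMap_margSnd (𝒳 := 𝒳)).mk'
  have hs := (convex_stdSimplex ℝ (𝒳 × 𝒴)).inter hconv
  refine ((((hjoint.subset ?_ hs).add_concaveOn (hfst.subset ?_ hs)).add_concaveOn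
    (hsnd.subset ?_ hs)).add_concaveOn (((α / (α - 1)) •
      Fintype.linearCombination ℝ fun p => Real.log (P p)).concaveOn hs)).congr fun R hR => ?_
  · exact fun R hR => hR.1.1
  · exact fun R hR x => Finset.sum_nonneg fun y _ => hR.1.1 _
  · exact fun R hR y => Finset.sum_nonneg fun x _ => hR.1.1 _
  · rw [dualObjectiveReal_eq_sum_negMulLog hα.ne' hR.1.1 hR.2]
    rfl

theorem eStrictConcaveOn_dualObjective (hα : 1 < α) (hP : ∀ p, 0 ≤ P p) :
    EStrictConcaveOn (stdSimplex ℝ (𝒳 × 𝒴)) (dualObjective α P) :=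
  eStrictConcaveOn_of_eq_coe (convex_stdSimplex ℝ _) (strictConcaveOn_dualObjectiveReal hα P)
    (fun _ hR h => dualObjective_eq_coe hP hR h) fun _ hR h => dualObjective_eq_bot hα hP hR h

theorem isMaxOn_dualObjective_iff (hα : 1 < α) (hP : P ∈ stdSimplex ℝ (𝒳 × 𝒴))
    (hR : R ∈ stdSimplex ℝ (𝒳 × 𝒴)) :
    IsMaxOn (dualObjective α P) (stdSimplex ℝ (𝒳 × 𝒴)) R ↔
      dualObjective α P R = renyiDiv α P (prodPmf (margFst R) (margSnd R)) := by
  have hα0 : 0 < α := one_pos.trans hα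
  constructor
  · intro hmax
    obtain ⟨S, hS, hSP, hSmax, hSdiv⟩ := exists_renyiJ_eq_of_one_lt hα hP
    have hRmax : dualObjective α P R = renyiJ α P :=
      le_antisymm (dualObjective_le_renyiJ hα hP.1 hR)
        (hSmax.trans (dualObjective_eq_coe hP.1 hS hSP).symm ▸ hmax hS)
    have hRP : R.support ⊆ P.support := not_not.1 fun h =>
      renyiJ_ne_bot hα0 hP (hRmax ▸ dualObjective_eq_bot hα hP.1 hR h)
    have hmaximal {U : 𝒳 × 𝒴 → ℝ} (hU : renyiJ α P = (dualObjectiveReal α P U : EReal)) :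
        IsMaxOn (dualObjectiveReal α P) (stdSimplex ℝ (𝒳 × 𝒴) ∩ {R | R.support ⊆ P.support}) U :=
      fun V hV => EReal.coe_le_coe_iff.1 (hU ▸ dualObjectiveReal_le_renyiJ hα hP.1 hV.1 hV.2)
    obtain rfl : R = S := (strictConcaveOn_dualObjectiveReal hα P).eq_of_isMaxOn
      (hmaximal (hRmax.symm.trans (dualObjective_eq_coe hP.1 hR hRP))) (hmaximal hSmax)
      ⟨hR, hRP⟩ ⟨hS, hSP⟩
    rw [hRmax, hSdiv]
  · refine fun h => isMaxOn_iff.2 fun S hS => ?_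
    rw [h]
    exact (dualObjective_le_renyiJ hα hP.1 hS).trans
      (renyiJ_le (margFst_mem_stdSimplex hR) (margSnd_mem_stdSimplex hR))

end StrictConcavity

section Order

open Filter Topology

variable {𝒳 𝒴 : Type*} [Fintype 𝒳] [Fintype 𝒴] {α β : ℝ} {P : 𝒳 × 𝒴 → ℝ}

theorem dualObjectiveReal_self (α : ℝ) (P : 𝒳 × 𝒴 → ℝ) :
    dualObjectiveReal α P P = mutualInfoReal P := by
  rw [dualObjectiveReal, relEntropyReal_self, mul_zero, add_zero]

theorem renyiJ_le_mutualInfoReal (hα : 0 < α) (hα1 : α ≤ 1) (hP : P ∈ stdSimplex ℝ (𝒳 × 𝒴)) :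
    renyiJ α P ≤ (mutualInfoReal P : EReal) := by
  rcases hα1.eq_or_lt with rfl | hlt
  · rw [renyiJ_one hP, mutualInfo_eq_coe hP]
  · exact dualObjectiveReal_self α P ▸
      renyiJ_le_dualObjectiveReal hα hlt hP.1 hP subset_rfl

theorem mutualInfoReal_le_renyiJ (hα : 1 ≤ α) (hP : P ∈ stdSimplex ℝ (𝒳 × 𝒴)) :
    (mutualInfoReal P : EReal) ≤ renyiJ α P := by
  rcases hα.eq_or_lt with rfl | hlt
  · rw [renyiJ_one hP, mutualInfo_eq_coe hP]
  · exact dualObjectiveReal_self α P ▸ dualObjectiveReal_le_renyiJ hlt hP.1 hP subset_rfl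

theorem renyiJ_le_log_card (hα : 0 < α) (hP : P ∈ stdSimplex ℝ (𝒳 × 𝒴)) :
    renyiJ α P ≤ (Real.log (Fintype.card 𝒳) : EReal) := by
  rcases le_or_gt α 1 with hα1 | hα1
  · exact (renyiJ_le_mutualInfoReal hα hα1 hP).trans
      (EReal.coe_le_coe_iff.2 (mutualInfoReal_le_log_card hP))
  · obtain ⟨R, hR, hRP, hmax, -⟩ := exists_renyiJ_eq_of_one_lt hα1 hP
    have hcoef : α / (1 - α) * relEntropyReal R P ≤ 0 :=
      mul_nonpos_of_nonpos_of_nonneg (div_nonpos_of_nonneg_of_nonpos hα.le (by linarith))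
        (relEntropyReal_nonneg hR hP hRP)
    rw [hmax, EReal.coe_le_coe_iff, dualObjectiveReal]
    linarith [mutualInfoReal_le_log_card hR]

theorem renyiJ_le_log_card_right (hα : 0 < α) (hP : P ∈ stdSimplex ℝ (𝒳 × 𝒴)) :
    renyiJ α P ≤ (Real.log (Fintype.card 𝒴) : EReal) :=
  renyiJ_comp_swap α P ▸ renyiJ_le_log_card hα (comp_swap_mem_stdSimplex hP)

theorem div_one_sub_le_div_one_sub (h : α ≤ β) (hside : 0 < (1 - α) * (1 - β)) :
    α / (1 - α) ≤ β / (1 - β) := by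
  have hα : 1 - α ≠ 0 := left_ne_zero_of_mul hside.ne'
  have hβ : 1 - β ≠ 0 := right_ne_zero_of_mul hside.ne'
  rw [← sub_nonneg, show β / (1 - β) - α / (1 - α) = (β - α) / ((1 - α) * (1 - β)) by
    field_simp; ring]
  exact div_nonneg (sub_nonneg.2 h) hside.le

theorem monotoneOn_renyiJ (hP : P ∈ stdSimplex ℝ (𝒳 × 𝒴)) :
    MonotoneOn (fun α : ℝ => renyiJ α P) (Set.Ioi 0) := by
  intro α (hα : 0 < α) β (hβ : 0 < β) hαβ
  rcases lt_or_ge β 1 with hβ1 | hβ1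
  · obtain ⟨R, hR, hRP, hmin⟩ := exists_renyiJ_eq_of_lt_one hβ hβ1 hP
    have hα1 := hαβ.trans_lt hβ1
    refine (renyiJ_le_dualObjectiveReal hα hα1 hP.1 hR hRP).trans ?_
    dsimp only
    rw [hmin, EReal.coe_le_coe_iff, dualObjectiveReal, dualObjectiveReal]
    gcongr _ + ?_ * _
    · exact relEntropyReal_nonneg hR hP hRP
    · exact div_one_sub_le_div_one_sub hαβ (mul_pos (by linarith) (by linarith))
  rcases le_or_gt α 1 with hα1 | hα1
  · exact (renyiJ_le_mutualInfoReal hα hα1 hP).trans (mutualInfoReal_le_renyiJ hβ1 hP)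
  · obtain ⟨R, hR, hRP, hmax, -⟩ := exists_renyiJ_eq_of_one_lt hα1 hP
    refine le_trans ?_ (dualObjectiveReal_le_renyiJ (hα1.trans_le hαβ) hP.1 hR hRP)
    dsimp only
    rw [hmax, EReal.coe_le_coe_iff, dualObjectiveReal, dualObjectiveReal]
    gcongr _ + ?_ * _
    · exact relEntropyReal_nonneg hR hP hRP
    · exact div_one_sub_le_div_one_sub hαβ (mul_pos_of_neg_of_neg (by linarith) (by linarith))

theorem toReal_renyiJ_le (hα : 0 < α) (hP : P ∈ stdSimplex ℝ (𝒳 × 𝒴)) {c : ℝ}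
    (h : renyiJ α P ≤ (c : EReal)) : (renyiJ α P).toReal ≤ c := by
  rwa [← coe_toReal_renyiJ hα hP, EReal.coe_le_coe_iff] at h

theorem le_toReal_renyiJ (hα : 0 < α) (hP : P ∈ stdSimplex ℝ (𝒳 × 𝒴)) {c : ℝ}
    (h : (c : EReal) ≤ renyiJ α P) : c ≤ (renyiJ α P).toReal := by
  rwa [← coe_toReal_renyiJ hα hP, EReal.coe_le_coe_iff] at h

theorem exists_toReal_renyiJ_eq (hα : 0 < α) (hα1 : α ≠ 1) (hP : P ∈ stdSimplex ℝ (𝒳 × 𝒴)) :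
    ∃ R ∈ stdSimplex ℝ (𝒳 × 𝒴), R.support ⊆ P.support ∧
      (renyiJ α P).toReal = dualObjectiveReal α P R ∧
      relEntropyReal R P ≤ Real.log (Fintype.card 𝒳) * (|1 - α| / α) ∧
      |(renyiJ α P).toReal - mutualInfoReal P| ≤ |mutualInfoReal R - mutualInfoReal P| := by
  rcases hα1.lt_or_gt with hlt | hgt
  · obtain ⟨R, hR, hRP, hmin⟩ := exists_renyiJ_eq_of_lt_one hα hlt hP
    have hJ : (renyiJ α P).toReal = dualObjectiveReal α P R := by rw [hmin, EReal.toReal_coe]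
    have hJcard := toReal_renyiJ_le hα hP (renyiJ_le_log_card hα hP)
    have hJP := toReal_renyiJ_le hα hP (renyiJ_le_mutualInfoReal hα hlt.le hP)
    have hc : 0 < α / (1 - α) := div_pos hα (by linarith)
    have hcD := mul_nonneg hc.le (relEntropyReal_nonneg hR hP hRP)
    rw [dualObjectiveReal] at hJ
    refine ⟨R, hR, hRP, hJ, ?_, ?_⟩
    · rw [abs_of_pos (by linarith), ← inv_div α, ← div_eq_mul_inv, le_div_iff₀ hc]
      linarith [mutualInfoReal_nonneg hR]
    · rw [abs_of_nonpos (by linarith), abs_of_nonpos (by linarith)]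
      linarith
  · obtain ⟨R, hR, hRP, hmax, -⟩ := exists_renyiJ_eq_of_one_lt hgt hP
    have hJ : (renyiJ α P).toReal = dualObjectiveReal α P R := by rw [hmax, EReal.toReal_coe]
    have hJ0 := le_toReal_renyiJ hα hP (renyiJ_nonneg hα hP)
    have hJP := le_toReal_renyiJ hα hP (mutualInfoReal_le_renyiJ hgt.le hP)
    have hc : 0 < α / (α - 1) := div_pos hα (by linarith)
    have hcD := mul_nonneg hc.le (relEntropyReal_nonneg hR hP hRP)
    have hneg : α / (1 - α) = -(α / (α - 1)) := by rw [← div_neg, neg_sub]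
    refine ⟨R, hR, hRP, hJ, ?_, ?_⟩ <;> rw [dualObjectiveReal, hneg] at hJ
    · rw [abs_of_neg (by linarith), neg_sub, ← inv_div α, ← div_eq_mul_inv, le_div_iff₀ hc]
      linarith [mutualInfoReal_le_log_card hR]
    · rw [abs_of_nonneg (by linarith), abs_of_nonneg (by linarith)]
      linarith

theorem abs_toReal_renyiJ_sub_le (hα : 0 < α) (hβ : 0 < β) (hside : 0 < (1 - α) * (1 - β))
    (hP : P ∈ stdSimplex ℝ (𝒳 × 𝒴)) :
    |(renyiJ β P).toReal - (renyiJ α P).toReal|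
      ≤ |β / (1 - β) - α / (1 - α)|
        * (Real.log (Fintype.card 𝒳) * max (|1 - α| / α) (|1 - β| / β)) := by
  have hα1 : α ≠ 1 := (sub_ne_zero.1 (left_ne_zero_of_mul hside.ne')).symm
  have hβ1 : β ≠ 1 := (sub_ne_zero.1 (right_ne_zero_of_mul hside.ne')).symm
  have hlog : 0 ≤ Real.log (Fintype.card 𝒳) :=
    (mutualInfoReal_nonneg hP).trans (mutualInfoReal_le_log_card hP)
  obtain ⟨R, hR, hRP, hJα, hDα, -⟩ := exists_toReal_renyiJ_eq hα hα1 hP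
  obtain ⟨S, hS, hSP, hJβ, hDβ, -⟩ := exists_toReal_renyiJ_eq hβ hβ1 hP
  have hbound {D : ℝ} (h0 : 0 ≤ D)
      (h : D ≤ Real.log (Fintype.card 𝒳) * max (|1 - α| / α) (|1 - β| / β)) :=
    abs_le.1 ((abs_mul _ D).trans_le (mul_le_mul_of_nonneg_left ((abs_of_nonneg h0).trans_le h)
      (abs_nonneg (β / (1 - β) - α / (1 - α)))))
  have hboundα := hbound (relEntropyReal_nonneg hR hP hRP)
    (hDα.trans (mul_le_mul_of_nonneg_left (le_max_left _ _) hlog))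
  have hboundβ := hbound (relEntropyReal_nonneg hS hP hSP)
    (hDβ.trans (mul_le_mul_of_nonneg_left (le_max_right _ _) hlog))
  rw [dualObjectiveReal] at hJα hJβ
  rcases hα1.lt_or_gt with hlt | hgt
  · have hβlt : β < 1 := sub_pos.1 (pos_of_mul_pos_right hside (sub_pos.2 hlt).le)
    have hβR := toReal_renyiJ_le hβ hP (renyiJ_le_dualObjectiveReal hβ hβlt hP.1 hR hRP)
    have hαS := toReal_renyiJ_le hα hP (renyiJ_le_dualObjectiveReal hα hlt hP.1 hS hSP)
    rw [dualObjectiveReal] at hβR hαS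
    exact abs_le.2 ⟨by linarith, by linarith⟩
  · have hβgt : 1 < β := sub_neg.1 (neg_of_mul_pos_right hside (sub_neg.2 hgt).le)
    have hβR := le_toReal_renyiJ hβ hP (dualObjectiveReal_le_renyiJ hβgt hP.1 hR hRP)
    have hαS := le_toReal_renyiJ hα hP (dualObjectiveReal_le_renyiJ hgt hP.1 hS hSP)
    rw [dualObjectiveReal] at hβR hαS
    exact abs_le.2 ⟨by linarith, by linarith⟩

theorem tendsto_of_relEntropyReal_tendsto_zero {ι κ : Type*} [Fintype ι] {l : Filter κ}
    {R : κ → ι → ℝ} {P : ι → ℝ} (hP : P ∈ stdSimplex ℝ ι)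
    (hR : ∀ᶠ k in l, R k ∈ stdSimplex ℝ ι ∧ (R k).support ⊆ P.support)
    (h : Tendsto (fun k => relEntropyReal (R k) P) l (𝓝 0)) : Tendsto R l (𝓝 P) := by
  refine tendsto_pi_nhds.2 fun x => ?_
  have hsq : Tendsto (fun k => (√(R k x) - √(P x)) ^ 2) l (𝓝 0) := by
    refine squeeze_zero' (Eventually.of_forall fun _ => sq_nonneg _) ?_ h
    filter_upwards [hR] with k hk
    exact (Finset.single_le_sum (f := fun x => (√(R k x) - √(P x)) ^ 2)
      (fun y _ => sq_nonneg _) (Finset.mem_univ x)).trans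
        (sum_sq_sqrt_sub_sqrt_le_relEntropyReal hk.1 hP hk.2)
  have habs : Tendsto (fun k => |√(R k x) - √(P x)|) l (𝓝 0) := by
    simpa only [Function.comp_def, Real.sqrt_sq_eq_abs, Real.sqrt_zero]
      using (Real.continuous_sqrt.tendsto 0).comp hsq
  have hsqrt : Tendsto (fun k => √(R k x)) l (𝓝 (√(P x))) :=
    tendsto_sub_nhds_zero_iff.1 ((tendsto_zero_iff_abs_tendsto_zero _).2 habs)
  have hlim := hsqrt.pow 2
  rw [Real.sq_sqrt (hP.1 x)] at hlim
  refine hlim.congr' ?_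
  filter_upwards [hR] with k hk using Real.sq_sqrt (hk.1.1 x)

theorem continuousOn_mutualInfoReal :
    ContinuousOn (mutualInfoReal : (𝒳 × 𝒴 → ℝ) → ℝ) (stdSimplex ℝ (𝒳 × 𝒴)) := by
  have hcont : Continuous fun R : 𝒳 × 𝒴 → ℝ => ∑ x, Real.negMulLog (margFst R x)
      + ∑ y, Real.negMulLog (margSnd R y) - ∑ p, Real.negMulLog (R p) := by
    have := Real.continuous_negMulLog
    unfold margFst margSnd
    fun_prop
  exact hcont.continuousOn.congr fun R hR => mutualInfoReal_eq_sum_negMulLog hR.1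

theorem continuousAt_toReal_renyiJ_of_ne_one (hα : 0 < α) (hα1 : α ≠ 1)
    (hP : P ∈ stdSimplex ℝ (𝒳 × 𝒴)) :
    ContinuousAt (fun α : ℝ => (renyiJ α P).toReal) α := by
  have h1 : 1 - α ≠ 0 := sub_ne_zero.2 hα1.symm
  have hbound : ContinuousAt (fun β : ℝ => |β / (1 - β) - α / (1 - α)|
      * (Real.log (Fintype.card 𝒳) * max (|1 - α| / α) (|1 - β| / β))) α := by
    fun_prop (disch := first | assumption | exact hα.ne')
  rw [ContinuousAt, sub_self, abs_zero, zero_mul] at hbound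
  rw [ContinuousAt, tendsto_iff_norm_sub_tendsto_zero]
  refine squeeze_zero' (Eventually.of_forall fun _ => norm_nonneg _) ?_ hbound
  have hside : ∀ᶠ β in 𝓝 α, 0 < (1 - α) * (1 - β) :=
    (continuous_const.mul (continuous_const.sub continuous_id)).continuousAt.eventually_const_lt
      (mul_self_pos.2 h1)
  filter_upwards [hside, lt_mem_nhds hα] with β hβ hβ0
  exact abs_toReal_renyiJ_sub_le hα hβ0 hβ hP

theorem continuousAt_toReal_renyiJ_one (hP : P ∈ stdSimplex ℝ (𝒳 × 𝒴)) :
    ContinuousAt (fun α : ℝ => (renyiJ α P).toReal) 1 := by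
  choose! R hR using fun (α : ℝ) (hα : 0 < α ∧ α ≠ 1) =>
    exists_toReal_renyiJ_eq hα.1 hα.2 hP
  have hmem : ∀ᶠ α : ℝ in 𝓝[≠] 1, 0 < α ∧ α ≠ 1 :=
    (eventually_nhdsWithin_of_eventually_nhds (lt_mem_nhds one_pos)).and self_mem_nhdsWithin
  have hbound : ContinuousAt (fun α : ℝ => Real.log (Fintype.card 𝒳) * (|1 - α| / α)) 1 := by
    fun_prop (disch := norm_num)
  rw [ContinuousAt, sub_self, abs_zero, zero_div, mul_zero] at hbound
  have hRP : Tendsto R (𝓝[≠] 1) (𝓝 P) := by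
    refine tendsto_of_relEntropyReal_tendsto_zero hP
      (hmem.mono fun α hα => ⟨(hR α hα).1, (hR α hα).2.1⟩)
      (squeeze_zero' ?_ ?_ (hbound.mono_left nhdsWithin_le_nhds))
    · exact hmem.mono fun α hα => relEntropyReal_nonneg (hR α hα).1 hP (hR α hα).2.1
    · exact hmem.mono fun α hα => (hR α hα).2.2.2.1
  have hI : Tendsto (fun α => mutualInfoReal (R α)) (𝓝[≠] 1) (𝓝 (mutualInfoReal P)) :=
    (continuousOn_mutualInfoReal P hP).tendsto.comp
      (tendsto_nhdsWithin_iff.2 ⟨hRP, hmem.mono fun α hα => (hR α hα).1⟩)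
  rw [continuousAt_iff_punctured_nhds, renyiJ_one hP, mutualInfo_eq_coe hP, EReal.toReal_coe,
    tendsto_iff_norm_sub_tendsto_zero]
  exact squeeze_zero' (Eventually.of_forall fun _ => norm_nonneg _)
    (hmem.mono fun α hα => (hR α hα).2.2.2.2) (tendsto_iff_norm_sub_tendsto_zero.1 hI)

theorem continuousOn_renyiJ (hP : P ∈ stdSimplex ℝ (𝒳 × 𝒴)) :
    ContinuousOn (fun α : ℝ => renyiJ α P) (Set.Ioi 0) := by
  have hreal : ContinuousOn (fun α : ℝ => (renyiJ α P).toReal) (Set.Ioi 0) := fun α hα => by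
    rcases eq_or_ne α 1 with rfl | hα1
    · exact (continuousAt_toReal_renyiJ_one hP).continuousWithinAt
    · exact (continuousAt_toReal_renyiJ_of_ne_one hα hα1 hP).continuousWithinAt
  exact (continuous_coe_real_ereal.comp_continuousOn hreal).congr
    fun _ hα => (coe_toReal_renyiJ hα hP).symm

end Order

section DataProcessing

variable {ι κ : Type*} [Fintype ι]

theorem sum_rpow_mul_rpow_le_rpow_mul_rpow {a b : ℝ} (ha : 0 < a) (hb : 0 < b) (hab : a + b = 1)
    (u v : ι → ENNReal) :
    ∑ i, u i ^ a * v i ^ b ≤ (∑ i, u i) ^ a * (∑ i, v i) ^ b := by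
  have hconj : (1 / a).HolderConjugate (1 / b) :=
    Real.holderConjugate_iff.2 ⟨(one_lt_div ha).2 (by linarith), by simpa using hab⟩
  simpa [← ENNReal.rpow_mul, mul_inv_cancel₀ ha.ne', mul_inv_cancel₀ hb.ne']
    using ENNReal.inner_le_Lp_mul_Lq Finset.univ (fun i => u i ^ a) (fun i => v i ^ b) hconj

theorem rpow_mul_rpow_one_sub_rpow_inv {α : ℝ} (hα : 1 < α) {p q : ENNReal} (hq : q ≠ ⊤)
    (h : q = 0 → p = 0) : (p ^ α * q ^ (1 - α)) ^ α⁻¹ * q ^ (1 - α⁻¹) = p := by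
  have hα0 : 0 < α := one_pos.trans hα
  by_cases hq0 : q = 0
  · simp [h hq0, hα0]
  · rw [ENNReal.mul_rpow_of_nonneg _ _ (inv_nonneg.2 hα0.le), ← ENNReal.rpow_mul,
      ← ENNReal.rpow_mul, mul_assoc, ← ENNReal.rpow_add _ _ hq0 hq, sub_mul,
      mul_inv_cancel₀ hα0.ne']
    simp

-- Hölder's inequality for the factors `p ^ α * q ^ (1 - α)` and `q` of exponents `1 / α` and
-- `1 - 1 / α`.
theorem rpow_mul_rpow_le_sum_rpow_mul_rpow {α : ℝ} (hα : 1 < α) (p : ι → ENNReal)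
    {q : ι → ENNReal} (hq : ∀ i, q i ≠ ⊤) :
    (∑ i, p i) ^ α * (∑ i, q i) ^ (1 - α) ≤ ∑ i, p i ^ α * q i ^ (1 - α) := by
  have hα0 : 0 < α := one_pos.trans hα
  by_cases htop : ∑ i, p i ^ α * q i ^ (1 - α) = ⊤
  · exact htop ▸ le_top
  have hzero : ∀ i, q i = 0 → p i = 0 := fun i hi => by
    have := ENNReal.sum_ne_top.1 htop i (Finset.mem_univ i)
    contrapose! this
    rw [hi, ENNReal.zero_rpow_of_neg (by linarith), ENNReal.mul_top]
    simp [ENNReal.rpow_eq_zero_iff, hα0.not_gt, this]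
  by_cases hq0 : ∑ i, q i = 0
  · have hp0 : ∀ i, p i = 0 := fun i => hzero i (Finset.sum_eq_zero_iff.1 hq0 i (Finset.mem_univ i))
    simp [hp0, hα0]
  have hholder := ENNReal.rpow_le_rpow (sum_rpow_mul_rpow_le_rpow_mul_rpow (inv_pos.2 hα0)
    (sub_pos.2 (inv_lt_one_of_one_lt₀ hα)) (add_sub_cancel _ _)
    (fun i => p i ^ α * q i ^ (1 - α)) q) hα0.le
  simp only [rpow_mul_rpow_one_sub_rpow_inv hα (hq _) (hzero _)] at hholder
  rw [ENNReal.mul_rpow_of_nonneg _ _ hα0.le, ← ENNReal.rpow_mul, ← ENNReal.rpow_mul,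
    inv_mul_cancel₀ hα0.ne', sub_mul, inv_mul_cancel₀ hα0.ne', one_mul, ENNReal.rpow_one]
    at hholder
  calc (∑ i, p i) ^ α * (∑ i, q i) ^ (1 - α)
      ≤ (∑ i, p i ^ α * q i ^ (1 - α)) * (∑ i, q i) ^ (α - 1) * (∑ i, q i) ^ (1 - α) := by
        gcongr
    _ = ∑ i, p i ^ α * q i ^ (1 - α) := by
        rw [mul_assoc, ← ENNReal.rpow_add _ _ hq0 (ENNReal.sum_ne_top.2 fun i _ => hq i)]
        simp

theorem rpow_le_rpow_iff_of_neg {r : ℝ} (hr : r < 0) {a b : ENNReal} :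
    a ^ r ≤ b ^ r ↔ b ≤ a := by
  rw [← neg_neg r, ENNReal.rpow_neg a, ENNReal.rpow_neg b, ENNReal.inv_le_inv,
    ENNReal.rpow_le_rpow_iff (neg_pos.2 hr)]

theorem renyiDiv_le_renyiDiv_iff_of_lt_one [Fintype κ] {α : ℝ} (hα1 : α < 1) {P Q : ι → ℝ}
    {P' Q' : κ → ℝ} :
    renyiDiv α P Q ≤ renyiDiv α P' Q' ↔ renyiSum α P' Q' ≤ renyiSum α P Q := by
  rw [renyiDiv_eq_log_rpow hα1.ne, renyiDiv_eq_log_rpow hα1.ne, ENNReal.log_le_log_iff,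
    rpow_le_rpow_iff_of_neg (inv_lt_zero.2 (sub_neg.2 hα1))]

theorem renyiDiv_le_renyiDiv_iff_of_one_lt [Fintype κ] {α : ℝ} (hα1 : 1 < α) {P Q : ι → ℝ}
    {P' Q' : κ → ℝ} :
    renyiDiv α P Q ≤ renyiDiv α P' Q' ↔ renyiSum α P Q ≤ renyiSum α P' Q' := by
  rw [renyiDiv_eq_log_rpow hα1.ne', renyiDiv_eq_log_rpow hα1.ne', ENNReal.log_le_log_iff,
    ENNReal.rpow_le_rpow_iff (inv_pos.2 (sub_pos.2 hα1))]

theorem ofReal_mul_rpow_mul_ofReal_mul_rpow {α a b c : ℝ} (hα : 0 < α) (ha : 0 ≤ a) (hb : 0 ≤ b)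
    (hc : 0 ≤ c) :
    ENNReal.ofReal (a * c) ^ α * ENNReal.ofReal (b * c) ^ (1 - α)
      = ENNReal.ofReal a ^ α * ENNReal.ofReal b ^ (1 - α) * ENNReal.ofReal c := by
  rw [ofReal_mul_rpow ha, ofReal_mul_rpow hb]
  rcases hc.eq_or_lt with rfl | hc
  · simp [hα]
  · rw [mul_mul_mul_comm, ← ENNReal.rpow_add _ _ (by simpa using hc) ENNReal.ofReal_ne_top]
    simp

variable [Fintype κ] {α : ℝ} {P Q : ι → ℝ} {K : ι → κ → ℝ}

theorem sum_mul_kernel_mem_stdSimplex (hP : P ∈ stdSimplex ℝ ι) (hK : ∀ i, K i ∈ stdSimplex ℝ κ) :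
    (fun k => ∑ i, P i * K i k) ∈ stdSimplex ℝ κ :=
  ⟨fun k => Finset.sum_nonneg fun i _ => mul_nonneg (hP.1 i) ((hK i).1 k), by
    rw [Finset.sum_comm]
    simp only [← Finset.mul_sum, (hK _).2, mul_one, hP.2]⟩

theorem sum_sum_kernel_eq_renyiSum (hα : 0 < α) (hP : ∀ i, 0 ≤ P i) (hQ : ∀ i, 0 ≤ Q i)
    (hK : ∀ i, K i ∈ stdSimplex ℝ κ) :
    ∑ k, ∑ i, ENNReal.ofReal (P i * K i k) ^ α * ENNReal.ofReal (Q i * K i k) ^ (1 - α)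
      = renyiSum α P Q := by
  rw [Finset.sum_comm, renyiSum]
  refine Finset.sum_congr rfl fun i _ => ?_
  simp only [ofReal_mul_rpow_mul_ofReal_mul_rpow hα (hP i) (hQ i) ((hK i).1 _)]
  rw [← Finset.mul_sum, ← ENNReal.ofReal_sum_of_nonneg fun k _ => (hK i).1 k, (hK i).2,
    ENNReal.ofReal_one, mul_one]

-- Hölder's inequality for each output letter `k`, in the direction given by the sign of `1 - α`.
theorem renyiDiv_kernel_le (hα : 0 < α) (hα1 : α ≠ 1) (hP : ∀ i, 0 ≤ P i) (hQ : ∀ i, 0 ≤ Q i)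
    (hK : ∀ i, K i ∈ stdSimplex ℝ κ) :
    renyiDiv α (fun k => ∑ i, P i * K i k) (fun k => ∑ i, Q i * K i k) ≤ renyiDiv α P Q := by
  have hsum : ∀ {P : ι → ℝ}, (∀ i, 0 ≤ P i) → ∀ k, ENNReal.ofReal (∑ i, P i * K i k)
      = ∑ i, ENNReal.ofReal (P i * K i k) := fun hP k =>
    ENNReal.ofReal_sum_of_nonneg fun i _ => mul_nonneg (hP i) ((hK i).1 k)
  rcases lt_or_gt_of_ne hα1 with h | h
  · rw [renyiDiv_le_renyiDiv_iff_of_lt_one h, ← sum_sum_kernel_eq_renyiSum hα hP hQ hK]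
    refine Finset.sum_le_sum fun k _ => ?_
    rw [hsum hP, hsum hQ]
    exact sum_rpow_mul_rpow_le_rpow_mul_rpow hα (sub_pos.2 h) (add_sub_cancel _ _) _ _
  · rw [renyiDiv_le_renyiDiv_iff_of_one_lt h, ← sum_sum_kernel_eq_renyiSum hα hP hQ hK]
    refine Finset.sum_le_sum fun k _ => ?_
    rw [hsum hP, hsum hQ]
    exact rpow_mul_rpow_le_sum_rpow_mul_rpow h _ fun i => ENNReal.ofReal_ne_top

end DataProcessing

section DataProcessingRenyiJ

open Filter Topology

open Classical in
/-- The kernel from `𝒳 × 𝒴` to `𝒳 × 𝒵` that keeps the first coordinate and applies the kernel `V` to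
the second one. -/
noncomputable def sndKernel {𝒳 𝒴 𝒵 : Type*} (V : 𝒴 → 𝒵 → ℝ) (p : 𝒳 × 𝒴) (r : 𝒳 × 𝒵) : ℝ :=
  if p.1 = r.1 then V p.2 r.2 else 0

theorem sndKernel_mem_stdSimplex {𝒳 𝒴 𝒵 : Type*} [Fintype 𝒳] [Fintype 𝒵] {V : 𝒴 → 𝒵 → ℝ}
    (hV : ∀ y, V y ∈ stdSimplex ℝ 𝒵) (p : 𝒳 × 𝒴) : sndKernel V p ∈ stdSimplex ℝ (𝒳 × 𝒵) := by
  classical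
  refine ⟨fun r => ?_, ?_⟩
  · unfold sndKernel
    split_ifs
    exacts [(hV _).1 _, le_rfl]
  · simp [sndKernel, Fintype.sum_prod_type_right, (hV _).2]

variable {𝒳 𝒴 𝒵 : Type*} [Fintype 𝒳] [Fintype 𝒴] {α : ℝ} {P : 𝒳 × 𝒴 → ℝ}

theorem sum_mul_sndKernel (R : 𝒳 × 𝒴 → ℝ) (V : 𝒴 → 𝒵 → ℝ) (r : 𝒳 × 𝒵) :
    ∑ p, R p * sndKernel V p r = ∑ y, R (r.1, y) * V y r.2 := by
  classical
  simp [sndKernel, Fintype.sum_prod_type_right]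

theorem tendsto_renyiJ_one (hP : P ∈ stdSimplex ℝ (𝒳 × 𝒴)) :
    Tendsto (fun α : ℝ => renyiJ α P) (𝓝[>] 1) (𝓝 (renyiJ 1 P)) :=
  ((continuousOn_renyiJ hP).continuousAt (Ioi_mem_nhds one_pos)).tendsto.mono_left
    nhdsWithin_le_nhds

variable [Fintype 𝒵] {V : 𝒴 → 𝒵 → ℝ}

theorem sum_mul_kernel_snd_mem_stdSimplex (hP : P ∈ stdSimplex ℝ (𝒳 × 𝒴))
    (hV : ∀ y, V y ∈ stdSimplex ℝ 𝒵) :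
    (fun p : 𝒳 × 𝒵 => ∑ y, P (p.1, y) * V y p.2) ∈ stdSimplex ℝ (𝒳 × 𝒵) := by
  simp only [← sum_mul_sndKernel]
  exact sum_mul_kernel_mem_stdSimplex hP (sndKernel_mem_stdSimplex hV)

theorem renyiJ_kernel_le_of_ne_one (hα : 0 < α) (hα1 : α ≠ 1) (hP : P ∈ stdSimplex ℝ (𝒳 × 𝒴))
    (hV : ∀ y, V y ∈ stdSimplex ℝ 𝒵) :
    renyiJ α (fun p : 𝒳 × 𝒵 => ∑ y, P (p.1, y) * V y p.2) ≤ renyiJ α P := by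
  obtain ⟨Q, hQ, T, hT, hJ⟩ := exists_renyiJ_eq hα hP
  have hdiv := renyiDiv_kernel_le hα hα1 hP.1 (prodPmf_mem_stdSimplex hQ hT).1
    (sndKernel_mem_stdSimplex hV)
  have hprod : (fun r : 𝒳 × 𝒵 => ∑ y, prodPmf Q T (r.1, y) * V y r.2)
      = prodPmf Q fun z => ∑ y, T y * V y z := by
    funext r
    simp only [prodPmf, Finset.mul_sum, mul_assoc]
  simp only [sum_mul_sndKernel, hprod] at hdiv
  exact hJ ▸ (renyiJ_le hQ (sum_mul_kernel_mem_stdSimplex hT hV)).trans hdiv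

theorem renyiJ_kernel_le (hα : 0 < α) (hP : P ∈ stdSimplex ℝ (𝒳 × 𝒴))
    (hV : ∀ y, V y ∈ stdSimplex ℝ 𝒵) :
    renyiJ α (fun p : 𝒳 × 𝒵 => ∑ y, P (p.1, y) * V y p.2) ≤ renyiJ α P := by
  rcases eq_or_ne α 1 with rfl | hα1
  · refine le_of_tendsto_of_tendsto
      (tendsto_renyiJ_one (sum_mul_kernel_snd_mem_stdSimplex hP hV)) (tendsto_renyiJ_one hP) ?_
    filter_upwards [self_mem_nhdsWithin] with β hβ
    exact renyiJ_kernel_le_of_ne_one (one_pos.trans hβ) (ne_of_gt hβ) hP hV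
  · exact renyiJ_kernel_le_of_ne_one hα hα1 hP hV

end DataProcessingRenyiJ

/-- The joint probability mass function of `((X₁, X₂), (Y₁, Y₂))` when `(X₁, Y₁)` and `(X₂, Y₂)` are
independent with joint probability mass functions `P₁` and `P₂`. -/
def prodJoint {𝒳₁ 𝒳₂ 𝒴₁ 𝒴₂ : Type*} (P₁ : 𝒳₁ × 𝒴₁ → ℝ) (P₂ : 𝒳₂ × 𝒴₂ → ℝ) :
    (𝒳₁ × 𝒳₂) × (𝒴₁ × 𝒴₂) → ℝ :=
  fun p => P₁ (p.1.1, p.2.1) * P₂ (p.1.2, p.2.2)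

section Additivity

theorem exists_stdSimplex_eq_margFst_mul {ι κ : Type*} [Fintype κ] [Nonempty κ] {Q : ι × κ → ℝ}
    (hQ : ∀ p, 0 ≤ Q p) : ∃ q : ι → κ → ℝ, (∀ i, q i ∈ stdSimplex ℝ κ) ∧
      Q = fun p => margFst Q p.1 * q p.1 p.2 := by
  have hfiber : ∀ i, ∃ q ∈ stdSimplex ℝ κ, ∀ k, Q (i, k) = margFst Q i * q k := by
    intro i
    rcases (Finset.sum_nonneg fun k _ => hQ (i, k)).eq_or_lt with h | h
    · refine ⟨_, const_inv_card_mem_stdSimplex, fun k => ?_⟩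
      rw [margFst, ← h, zero_mul]
      by_contra hk
      exact margFst_ne_zero hQ hk h.symm
    · exact ⟨_, normalized_mem_stdSimplex (fun k => hQ (i, k)) h,
        fun k => (mul_div_cancel₀ _ h.ne').symm⟩
  choose q hq hQq using hfiber
  exact ⟨q, hq, funext fun p => hQq p.1 p.2⟩

theorem renyiDiv_add_renyiDiv {ι κ : Type*} [Fintype ι] [Fintype κ] {α : ℝ} (hα1 : α ≠ 1)
    (P Q : ι → ℝ) {P' Q' : κ → ℝ} (hbot : renyiDiv α P' Q' ≠ ⊥) (htop : renyiDiv α P' Q' ≠ ⊤) :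
    renyiDiv α P Q + renyiDiv α P' Q'
      = ENNReal.log ((renyiSum α P Q * renyiSum α P' Q') ^ (α - 1)⁻¹) := by
  simp only [renyiDiv_eq_log_rpow hα1] at hbot htop ⊢
  generalize renyiSum α P' Q' = S at hbot htop ⊢
  rw [ENNReal.mul_rpow_eq_ite, if_neg, ENNReal.log_mul_add]
  rintro ⟨⟨-, rfl⟩ | ⟨-, rfl⟩, hneg⟩
  · exact hbot (by rw [ENNReal.top_rpow_of_neg hneg, ENNReal.log_zero])
  · exact htop (by rw [ENNReal.zero_rpow_of_neg hneg, ENNReal.log_top])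

variable {𝒳₁ 𝒳₂ 𝒴₁ 𝒴₂ : Type*} [Fintype 𝒳₁] [Fintype 𝒳₂] [Fintype 𝒴₁] [Fintype 𝒴₂] {α : ℝ}
  {P₁ : 𝒳₁ × 𝒴₁ → ℝ} {P₂ : 𝒳₂ × 𝒴₂ → ℝ}

theorem sum_prodProdProdComm {M : Type*} [AddCommMonoid M]
    (F : (𝒳₁ × 𝒳₂) × (𝒴₁ × 𝒴₂) → M) :
    ∑ p, F p = ∑ p₁ : 𝒳₁ × 𝒴₁, ∑ p₂ : 𝒳₂ × 𝒴₂, F ((p₁.1, p₂.1), (p₁.2, p₂.2)) := by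
  rw [← Fintype.sum_prod_type']
  exact ((Equiv.prodProdProdComm 𝒳₁ 𝒴₁ 𝒳₂ 𝒴₂).sum_comp F).symm

theorem prodJoint_mem_stdSimplex (h₁ : P₁ ∈ stdSimplex ℝ (𝒳₁ × 𝒴₁))
    (h₂ : P₂ ∈ stdSimplex ℝ (𝒳₂ × 𝒴₂)) :
    prodJoint P₁ P₂ ∈ stdSimplex ℝ ((𝒳₁ × 𝒳₂) × (𝒴₁ × 𝒴₂)) :=
  ⟨fun p => mul_nonneg (h₁.1 _) (h₂.1 _), by
    simp only [sum_prodProdProdComm, prodJoint, ← Finset.mul_sum, h₁.2, h₂.2, mul_one]⟩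

theorem renyiSum_prodJoint (α : ℝ) (h₁ : ∀ p, 0 ≤ P₁ p) (P₂ : 𝒳₂ × 𝒴₂ → ℝ) {Q : 𝒳₁ → ℝ}
    (hQ : ∀ x, 0 ≤ Q x) (q : 𝒳₁ → 𝒳₂ → ℝ) {T : 𝒴₁ → ℝ} (hT : ∀ y, 0 ≤ T y)
    (t : 𝒴₁ → 𝒴₂ → ℝ) :
    renyiSum α (prodJoint P₁ P₂) (prodPmf (fun x => Q x.1 * q x.1 x.2) fun y => T y.1 * t y.1 y.2)
      = ∑ p, ENNReal.ofReal (P₁ p) ^ α * ENNReal.ofReal (prodPmf Q T p) ^ (1 - α)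
        * renyiSum α P₂ (prodPmf (q p.1) (t p.2)) := by
  rw [renyiSum, sum_prodProdProdComm]
  refine Finset.sum_congr rfl fun p₁ _ => ?_
  rw [renyiSum, Finset.mul_sum]
  refine Finset.sum_congr rfl fun p₂ _ => ?_
  simp only [prodJoint, prodPmf]
  rw [mul_mul_mul_comm (Q p₁.1), ofReal_mul_rpow (h₁ _),
    ofReal_mul_rpow (mul_nonneg (hQ _) (hT _)), mul_mul_mul_comm]

theorem renyiDiv_prodJoint (hα1 : α ≠ 1) (h₁ : ∀ p, 0 ≤ P₁ p) {Q₁ : 𝒳₁ → ℝ} {Q₂ : 𝒳₂ → ℝ}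
    (hQ₁ : ∀ x, 0 ≤ Q₁ x) {T₁ : 𝒴₁ → ℝ} {T₂ : 𝒴₂ → ℝ} (hT₁ : ∀ y, 0 ≤ T₁ y)
    (hbot : renyiDiv α P₂ (prodPmf Q₂ T₂) ≠ ⊥) (htop : renyiDiv α P₂ (prodPmf Q₂ T₂) ≠ ⊤) :
    renyiDiv α (prodJoint P₁ P₂) (prodPmf (prodPmf Q₁ Q₂) (prodPmf T₁ T₂))
      = renyiDiv α P₁ (prodPmf Q₁ T₁) + renyiDiv α P₂ (prodPmf Q₂ T₂) := by
  rw [renyiDiv_add_renyiDiv hα1 _ _ hbot htop, renyiDiv_eq_log_rpow hα1, renyiSum, renyiSum,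
    Finset.sum_mul]
  exact congrArg (fun S => ENNReal.log (S ^ (α - 1)⁻¹))
    (renyiSum_prodJoint α h₁ P₂ hQ₁ (fun _ => Q₂) hT₁ fun _ => T₂)

theorem renyiJ_prodJoint_le (hα : 0 < α) (hα1 : α ≠ 1) (h₁ : P₁ ∈ stdSimplex ℝ (𝒳₁ × 𝒴₁))
    (h₂ : P₂ ∈ stdSimplex ℝ (𝒳₂ × 𝒴₂)) :
    renyiJ α (prodJoint P₁ P₂) ≤ renyiJ α P₁ + renyiJ α P₂ := by
  obtain ⟨Q₁, hQ₁, T₁, hT₁, hJ₁⟩ := exists_renyiJ_eq hα h₁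
  obtain ⟨Q₂, hQ₂, T₂, hT₂, hJ₂⟩ := exists_renyiJ_eq hα h₂
  rw [hJ₁, hJ₂, ← renyiDiv_prodJoint hα1 h₁.1 hQ₁.1 hT₁.1 (hJ₂ ▸ renyiJ_ne_bot hα h₂)
    (hJ₂ ▸ renyiJ_ne_top hα h₂)]
  exact renyiJ_le (prodPmf_mem_stdSimplex hQ₁ hQ₂) (prodPmf_mem_stdSimplex hT₁ hT₂)

-- Conditionally on the first components, `Q` and `T` are candidates for `renyiJ α P₂`.
theorem renyiJ_add_renyiJ_le_renyiDiv_prodJoint (hα : 0 < α) (hα1 : α ≠ 1)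
    (h₁ : P₁ ∈ stdSimplex ℝ (𝒳₁ × 𝒴₁)) (h₂ : P₂ ∈ stdSimplex ℝ (𝒳₂ × 𝒴₂)) {Q : 𝒳₁ × 𝒳₂ → ℝ}
    (hQ : Q ∈ stdSimplex ℝ (𝒳₁ × 𝒳₂)) {T : 𝒴₁ × 𝒴₂ → ℝ} (hT : T ∈ stdSimplex ℝ (𝒴₁ × 𝒴₂)) :
    renyiJ α P₁ + renyiJ α P₂ ≤ renyiDiv α (prodJoint P₁ P₂) (prodPmf Q T) := by
  obtain ⟨⟨x, y⟩, -⟩ := exists_pos_of_mem_stdSimplex h₂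
  have : Nonempty 𝒳₂ := ⟨x⟩
  have : Nonempty 𝒴₂ := ⟨y⟩
  obtain ⟨q, hq, hQq⟩ := exists_stdSimplex_eq_margFst_mul hQ.1
  obtain ⟨t, ht, hTt⟩ := exists_stdSimplex_eq_margFst_mul hT.1
  have hQ₁ := margFst_mem_stdSimplex hQ
  have hT₁ := margFst_mem_stdSimplex hT
  obtain ⟨Q₂, -, T₂, -, hJ₂⟩ := exists_renyiJ_eq hα h₂
  have hmin : ∀ x y, renyiDiv α P₂ (prodPmf Q₂ T₂) ≤ renyiDiv α P₂ (prodPmf (q x) (t y)) :=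
    fun x y => hJ₂ ▸ renyiJ_le (hq x) (ht y)
  have hsum := renyiSum_prodJoint α h₁.1 P₂ hQ₁.1 q hT₁.1 t
  rw [← hQq, ← hTt] at hsum
  refine (add_le_add_left (renyiJ_le hQ₁ hT₁) _).trans ?_
  rw [hJ₂, renyiDiv_add_renyiDiv hα1 _ _ (hJ₂ ▸ renyiJ_ne_bot hα h₂) (hJ₂ ▸ renyiJ_ne_top hα h₂),
    renyiDiv_eq_log_rpow hα1, ENNReal.log_le_log_iff, hsum, renyiSum, Finset.sum_mul]
  rcases lt_or_gt_of_ne hα1 with h | h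
  · rw [rpow_le_rpow_iff_of_neg (inv_lt_zero.2 (sub_neg.2 h))]
    gcongr with p
    exact (renyiDiv_le_renyiDiv_iff_of_lt_one h).1 (hmin _ _)
  · rw [ENNReal.rpow_le_rpow_iff (inv_pos.2 (sub_pos.2 h))]
    gcongr with p
    exact (renyiDiv_le_renyiDiv_iff_of_one_lt h).1 (hmin _ _)

theorem renyiJ_prodJoint_of_ne_one (hα : 0 < α) (hα1 : α ≠ 1)
    (h₁ : P₁ ∈ stdSimplex ℝ (𝒳₁ × 𝒴₁)) (h₂ : P₂ ∈ stdSimplex ℝ (𝒳₂ × 𝒴₂)) :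
    renyiJ α (prodJoint P₁ P₂) = renyiJ α P₁ + renyiJ α P₂ :=
  (renyiJ_prodJoint_le hα hα1 h₁ h₂).antisymm <| le_renyiJ fun _ hQ _ hT =>
    renyiJ_add_renyiJ_le_renyiDiv_prodJoint hα hα1 h₁ h₂ hQ hT

open Filter Topology in
theorem renyiJ_prodJoint (hα : 0 < α) (h₁ : P₁ ∈ stdSimplex ℝ (𝒳₁ × 𝒴₁))
    (h₂ : P₂ ∈ stdSimplex ℝ (𝒳₂ × 𝒴₂)) :
    renyiJ α (prodJoint P₁ P₂) = renyiJ α P₁ + renyiJ α P₂ := by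
  rcases eq_or_ne α 1 with rfl | hα1
  · have hadd : Tendsto (fun β => renyiJ β P₁ + renyiJ β P₂) (𝓝[>] 1)
        (𝓝 (renyiJ 1 P₁ + renyiJ 1 P₂)) :=
      (EReal.continuousAt_add (.inl (renyiJ_ne_top hα h₁))
        (.inl (renyiJ_ne_bot hα h₁))).tendsto.comp ((tendsto_renyiJ_one h₁).prodMk_nhds
          (tendsto_renyiJ_one h₂))
    refine tendsto_nhds_unique (tendsto_renyiJ_one (prodJoint_mem_stdSimplex h₁ h₂))
      (hadd.congr' ?_)
    filter_upwards [self_mem_nhdsWithin] with β hβ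
    exact (renyiJ_prodJoint_of_ne_one (one_pos.trans hβ) (ne_of_gt hβ) h₁ h₂).symm
  · exact renyiJ_prodJoint_of_ne_one hα hα1 h₁ h₂

end Additivity

section Convexity

variable {a b r : ℝ}

theorem ofReal_rpow_mul_ofReal_rpow_le (ha : 0 ≤ a) (hb : 0 ≤ b) (hab : a + b = 1) {x y : ℝ}
    (hx : 0 ≤ x) (hy : 0 ≤ y) :
    ENNReal.ofReal x ^ a * ENNReal.ofReal y ^ b ≤ ENNReal.ofReal (a * x + b * y) := by
  rw [ENNReal.ofReal_rpow_of_nonneg hx ha, ENNReal.ofReal_rpow_of_nonneg hy hb,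
    ← ENNReal.ofReal_mul (Real.rpow_nonneg hx a)]
  exact ENNReal.ofReal_le_ofReal (Real.geom_mean_le_arith_mean2_weighted ha hb hx hy hab)

theorem ofReal_add_rpow_le_of_neg (ha : 0 ≤ a) (hb : 0 ≤ b) (hab : a + b = 1) (hr : r < 0)
    {x y : ℝ} (hx : 0 ≤ x) (hy : 0 ≤ y) :
    ENNReal.ofReal (a * x + b * y) ^ r
      ≤ (ENNReal.ofReal x ^ r) ^ a * (ENNReal.ofReal y ^ r) ^ b := by
  refine ((rpow_le_rpow_iff_of_neg hr).2
    (ofReal_rpow_mul_ofReal_rpow_le ha hb hab hx hy)).trans_eq ?_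
  rw [ENNReal.mul_rpow_of_ne_top (ENNReal.rpow_ne_top_of_nonneg ha ENNReal.ofReal_ne_top)
    (ENNReal.rpow_ne_top_of_nonneg hb ENNReal.ofReal_ne_top)]
  simp only [← ENNReal.rpow_mul, mul_comm]

theorem mul_sqrt_add_mul_sqrt_le (ha : 0 ≤ a) (hb : 0 ≤ b) {x₁ y₁ x₂ y₂ : ℝ} (hx₁ : 0 ≤ x₁)
    (hy₁ : 0 ≤ y₁) (hx₂ : 0 ≤ x₂) (hy₂ : 0 ≤ y₂) :
    a * √(x₁ * y₁) + b * √(x₂ * y₂) ≤ √((a * x₁ + b * x₂) * (a * y₁ + b * y₂)) := by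
  refine Real.le_sqrt_of_sq_le ?_
  rw [Real.sqrt_mul hx₁, Real.sqrt_mul hx₂]
  calc (a * (√x₁ * √y₁) + b * (√x₂ * √y₂)) ^ 2
      ≤ (a * (√x₁ * √y₁) + b * (√x₂ * √y₂)) ^ 2 + a * b * (√x₁ * √y₂ - √x₂ * √y₁) ^ 2 :=
        le_add_of_nonneg_right (mul_nonneg (mul_nonneg ha hb) (sq_nonneg _))
    _ = (a * √x₁ ^ 2 + b * √x₂ ^ 2) * (a * √y₁ ^ 2 + b * √y₂ ^ 2) := by ring
    _ = (a * x₁ + b * x₂) * (a * y₁ + b * y₂) := by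
        simp only [Real.sq_sqrt, hx₁, hx₂, hy₁, hy₂]

theorem rpow_mul_concave (ha : 0 ≤ a) (hb : 0 ≤ b) (hab : a + b = 1) (hr : 0 ≤ r)
    (hr2 : r ≤ 1 / 2) {x₁ y₁ x₂ y₂ : ℝ} (hx₁ : 0 ≤ x₁) (hy₁ : 0 ≤ y₁) (hx₂ : 0 ≤ x₂)
    (hy₂ : 0 ≤ y₂) :
    a * (x₁ * y₁) ^ r + b * (x₂ * y₂) ^ r ≤ ((a * x₁ + b * x₂) * (a * y₁ + b * y₂)) ^ r := by
  have hsqrt : ∀ {z : ℝ}, 0 ≤ z → z ^ r = √z ^ (2 * r) := fun hz => by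
    rw [Real.sqrt_eq_rpow, ← Real.rpow_mul hz, one_div, inv_mul_cancel_left₀ two_ne_zero]
  rw [hsqrt (mul_nonneg hx₁ hy₁), hsqrt (mul_nonneg hx₂ hy₂), hsqrt (by positivity)]
  calc a * √(x₁ * y₁) ^ (2 * r) + b * √(x₂ * y₂) ^ (2 * r)
      ≤ (a * √(x₁ * y₁) + b * √(x₂ * y₂)) ^ (2 * r) :=
        (Real.concaveOn_rpow (by linarith) (by linarith)).2 (Real.sqrt_nonneg _)
          (Real.sqrt_nonneg _) ha hb hab
    _ ≤ _ := Real.rpow_le_rpow (by positivity)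
        (mul_sqrt_add_mul_sqrt_le ha hb hx₁ hy₁ hx₂ hy₂) (by linarith)

variable {𝒳 𝒴 : Type*} {α : ℝ} {P : 𝒳 × 𝒴 → ℝ} {Q₁ Q₂ : 𝒳 → ℝ} {T₁ T₂ : 𝒴 → ℝ}

theorem prodPmf_add_nonneg (ha : 0 ≤ a) (hb : 0 ≤ b) (hQ₁ : ∀ x, 0 ≤ Q₁ x) (hQ₂ : ∀ x, 0 ≤ Q₂ x)
    (hT₁ : ∀ y, 0 ≤ T₁ y) (hT₂ : ∀ y, 0 ≤ T₂ y) (p : 𝒳 × 𝒴) :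
    0 ≤ prodPmf (a • Q₁ + b • Q₂) (a • T₁ + b • T₂) p :=
  prodPmf_nonneg (fun x => add_nonneg (mul_nonneg ha (hQ₁ x)) (mul_nonneg hb (hQ₂ x)))
    (fun y => add_nonneg (mul_nonneg ha (hT₁ y)) (mul_nonneg hb (hT₂ y))) p

variable [Fintype 𝒳] [Fintype 𝒴]

theorem renyiSum_prodPmf_add_le (hα : 1 < α) (P : 𝒳 × 𝒴 → ℝ) (hQ₁ : ∀ x, 0 ≤ Q₁ x)
    (hQ₂ : ∀ x, 0 ≤ Q₂ x) (hT₁ : ∀ y, 0 ≤ T₁ y) (hT₂ : ∀ y, 0 ≤ T₂ y) (ha : 0 < a) (hb : 0 < b)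
    (hab : a + b = 1) :
    renyiSum α P (prodPmf (a • Q₁ + b • Q₂) (a • T₁ + b • T₂))
      ≤ renyiSum α P (prodPmf Q₁ T₁) ^ a * renyiSum α P (prodPmf Q₂ T₂) ^ b := by
  refine le_trans (Finset.sum_le_sum fun p _ => ?_)
    (sum_rpow_mul_rpow_le_rpow_mul_rpow ha hb hab _ _)
  have hr : 1 - α < 0 := sub_neg.2 hα
  simp only [prodPmf, Pi.add_apply, Pi.smul_apply, smul_eq_mul]
  rw [ofReal_mul_rpow (add_nonneg (mul_nonneg ha.le (hQ₁ _)) (mul_nonneg hb.le (hQ₂ _))),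
    ofReal_mul_rpow (hQ₁ _), ofReal_mul_rpow (hQ₂ _)]
  simp only [ENNReal.mul_rpow_of_nonneg _ _ ha.le, ENNReal.mul_rpow_of_nonneg _ _ hb.le]
  set w := ENNReal.ofReal (P p) ^ α
  have hw : w ^ a * w ^ b = w := by
    rw [← ENNReal.rpow_add_of_nonneg _ _ ha.le hb.le, hab, ENNReal.rpow_one]
  calc _ ≤ w * _ := mul_le_mul_right (mul_le_mul'
        (ofReal_add_rpow_le_of_neg ha.le hb.le hab hr (hQ₁ p.1) (hQ₂ p.1))
        (ofReal_add_rpow_le_of_neg ha.le hb.le hab hr (hT₁ p.2) (hT₂ p.2))) w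
    _ = _ := by
        conv_lhs => rw [← hw]
        ring

theorem le_renyiSum_prodPmf_add (hα : 1 / 2 ≤ α) (hα1 : α < 1) (hP : ∀ p, 0 ≤ P p)
    (hQ₁ : ∀ x, 0 ≤ Q₁ x) (hQ₂ : ∀ x, 0 ≤ Q₂ x) (hT₁ : ∀ y, 0 ≤ T₁ y) (hT₂ : ∀ y, 0 ≤ T₂ y)
    (ha : 0 ≤ a) (hb : 0 ≤ b) (hab : a + b = 1) :
    renyiSum α P (prodPmf Q₁ T₁) ^ a * renyiSum α P (prodPmf Q₂ T₂) ^ b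
      ≤ renyiSum α P (prodPmf (a • Q₁ + b • Q₂) (a • T₁ + b • T₂)) := by
  have hα0 : 0 < α := by linarith
  rw [renyiSum_eq_ofReal hα0 hP (prodPmf_nonneg hQ₁ hT₁) (.inl hα1),
    renyiSum_eq_ofReal hα0 hP (prodPmf_nonneg hQ₂ hT₂) (.inl hα1),
    renyiSum_eq_ofReal hα0 hP (prodPmf_add_nonneg ha hb hQ₁ hQ₂ hT₁ hT₂) (.inl hα1)]
  refine (ofReal_rpow_mul_ofReal_rpow_le ha hb hab
    (Finset.sum_nonneg fun p _ => tilt_nonneg hP (prodPmf_nonneg hQ₁ hT₁) p)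
    (Finset.sum_nonneg fun p _ => tilt_nonneg hP (prodPmf_nonneg hQ₂ hT₂) p)).trans ?_
  rw [Finset.mul_sum, Finset.mul_sum, ← Finset.sum_add_distrib]
  refine ENNReal.ofReal_le_ofReal (Finset.sum_le_sum fun p _ => ?_)
  have hconc := mul_le_mul_of_nonneg_left (rpow_mul_concave ha hb hab (r := 1 - α) (by linarith)
    (by linarith) (hQ₁ p.1) (hT₁ p.2) (hQ₂ p.1) (hT₂ p.2)) (Real.rpow_nonneg (hP p) α)
  simp only [tilt, prodPmf, Pi.add_apply, Pi.smul_apply, smul_eq_mul]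
  linarith

theorem coe_mul_renyiDiv_add_coe_mul_renyiDiv {ι κ : Type*} [Fintype ι] [Fintype κ] (hα1 : α ≠ 1)
    (a b : ℝ) (P Q : ι → ℝ) (P' Q' : κ → ℝ) :
    (a : EReal) * renyiDiv α P Q + (b : EReal) * renyiDiv α P' Q'
      = ENNReal.log ((renyiSum α P Q ^ a) ^ (α - 1)⁻¹ * (renyiSum α P' Q' ^ b) ^ (α - 1)⁻¹) := by
  rw [renyiDiv_eq_log_rpow hα1, renyiDiv_eq_log_rpow hα1, ← ENNReal.log_rpow, ← ENNReal.log_rpow,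
    ← ENNReal.log_mul_add]
  simp only [← ENNReal.rpow_mul, mul_comm]

theorem renyiDiv_prodPmf_add_le (hα : 1 / 2 ≤ α) (hα1 : α ≠ 1) (hP : ∀ p, 0 ≤ P p)
    (hQ₁ : ∀ x, 0 ≤ Q₁ x) (hQ₂ : ∀ x, 0 ≤ Q₂ x) (hT₁ : ∀ y, 0 ≤ T₁ y) (hT₂ : ∀ y, 0 ≤ T₂ y)
    (ha : 0 < a) (hb : 0 < b) (hab : a + b = 1) :
    renyiDiv α P (prodPmf (a • Q₁ + b • Q₂) (a • T₁ + b • T₂))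
      ≤ (a : EReal) * renyiDiv α P (prodPmf Q₁ T₁)
        + (b : EReal) * renyiDiv α P (prodPmf Q₂ T₂) := by
  have hα0 : 0 < α := by linarith
  rw [coe_mul_renyiDiv_add_coe_mul_renyiDiv hα1, renyiDiv_eq_log_rpow hα1, ENNReal.log_le_log_iff]
  rcases lt_or_gt_of_ne hα1 with h | h
  · have hfin : ∀ {Q : 𝒳 → ℝ} {T : 𝒴 → ℝ} {c : ℝ}, (∀ x, 0 ≤ Q x) → (∀ y, 0 ≤ T y) → 0 ≤ c →
        renyiSum α P (prodPmf Q T) ^ c ≠ ⊤ := fun hQ hT hc => by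
      rw [renyiSum_eq_ofReal hα0 hP (prodPmf_nonneg hQ hT) (.inl h)]
      exact ENNReal.rpow_ne_top_of_nonneg hc ENNReal.ofReal_ne_top
    rw [← ENNReal.mul_rpow_of_ne_top (hfin hQ₁ hT₁ ha.le) (hfin hQ₂ hT₂ hb.le),
      rpow_le_rpow_iff_of_neg (inv_lt_zero.2 (sub_neg.2 h))]
    exact le_renyiSum_prodPmf_add hα h hP hQ₁ hQ₂ hT₁ hT₂ ha.le hb.le hab
  · have hr : 0 < (α - 1)⁻¹ := inv_pos.2 (sub_pos.2 h)
    rw [← ENNReal.mul_rpow_of_nonneg _ _ hr.le, ENNReal.rpow_le_rpow_iff hr]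
    exact renyiSum_prodPmf_add_le h P hQ₁ hQ₂ hT₁ hT₂ ha hb hab

-- A partial minimum of a jointly convex function is convex.
theorem eConvexOn_reducedObjective (hα : 1 / 2 ≤ α) (hα1 : α ≠ 1)
    (hP : P ∈ stdSimplex ℝ (𝒳 × 𝒴)) : EConvexOn (stdSimplex ℝ 𝒳) (reducedObjective α P) := by
  have hα0 : 0 < α := by linarith
  refine ⟨convex_stdSimplex ℝ _, fun Q₁ hQ₁ Q₂ hQ₂ a b ha hb hab => ?_⟩
  rcases ha.eq_or_lt with rfl | ha'
  · simp [show b = 1 by linarith]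
  rcases hb.eq_or_lt with rfl | hb'
  · simp [show a = 1 by linarith]
  obtain ⟨T₁, hT₁, h₁⟩ := (isLeast_reducedObjective hα0 hα1 hP hQ₁.1).1
  obtain ⟨T₂, hT₂, h₂⟩ := (isLeast_reducedObjective hα0 hα1 hP hQ₂.1).1
  have hQ := convex_stdSimplex ℝ 𝒳 hQ₁ hQ₂ ha hb hab
  have hT := convex_stdSimplex ℝ 𝒴 hT₁ hT₂ ha hb hab
  rw [← h₁, ← h₂]
  exact ((isLeast_reducedObjective hα0 hα1 hP hQ.1).2 ⟨_, hT, rfl⟩).trans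
    (renyiDiv_prodPmf_add_le hα hα1 hP.1 hQ₁.1 hQ₂.1 hT₁.1 hT₂.1 ha' hb' hab)

end Convexity

section Channel

theorem rpow_mul_rpow_le_ofReal_mul_add_ofReal_mul {a b : ℝ} (ha : 0 < a) (hb : 0 < b)
    (hab : a + b = 1) (u v : ENNReal) :
    u ^ a * v ^ b ≤ ENNReal.ofReal a * u + ENNReal.ofReal b * v := by
  refine (ENNReal.young_inequality _ _ (Real.holderConjugate_one_div ha hb hab)).trans_eq ?_
  rw [← ENNReal.rpow_mul, ← ENNReal.rpow_mul, mul_one_div_cancel ha.ne', mul_one_div_cancel hb.ne',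
    ENNReal.rpow_one, ENNReal.rpow_one, one_div, one_div, ENNReal.ofReal_inv_of_pos ha,
    ENNReal.ofReal_inv_of_pos hb, div_eq_mul_inv, div_eq_mul_inv, inv_inv, inv_inv, mul_comm u,
    mul_comm v]

variable {𝒳 𝒴 : Type*} {α : ℝ} {W : 𝒳 → 𝒴 → ℝ} {Q Q₁ Q₂ : 𝒳 → ℝ}

/-- The joint probability mass function of the input and the output of a channel `W` whose input
has distribution `Q`. -/
def channelJoint (W : 𝒳 → 𝒴 → ℝ) (Q : 𝒳 → ℝ) : 𝒳 × 𝒴 → ℝ :=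
  fun p => Q p.1 * W p.1 p.2

theorem channelJoint_mem_stdSimplex [Fintype 𝒳] [Fintype 𝒴] (hW : ∀ x, W x ∈ stdSimplex ℝ 𝒴)
    (hQ : Q ∈ stdSimplex ℝ 𝒳) : channelJoint W Q ∈ stdSimplex ℝ (𝒳 × 𝒴) :=
  ⟨fun p => mul_nonneg (hQ.1 _) ((hW _).1 _), by
    simp only [channelJoint, Fintype.sum_prod_type, ← Finset.mul_sum, (hW _).2, mul_one, hQ.2]⟩

theorem innerSum_channelJoint_swap_rpow [Fintype 𝒴] (hα : 0 < α) (W : 𝒳 → 𝒴 → ℝ)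
    (hQ : ∀ x, 0 ≤ Q x) (T : 𝒴 → ℝ) (x : 𝒳) :
    innerSum α (channelJoint W Q ∘ Prod.swap) T x ^ (1 / α)
      = ENNReal.ofReal (Q x) * renyiSum α (W x) T ^ (1 / α) := by
  simp only [innerSum, renyiSum, channelJoint, Function.comp, Prod.swap, ofReal_mul_rpow (hQ x),
    mul_assoc]
  rw [← Finset.mul_sum, ENNReal.mul_rpow_of_nonneg _ _ (by positivity), ← ENNReal.rpow_mul,
    mul_one_div_cancel hα.ne', ENNReal.rpow_one]

variable [Fintype 𝒳] [Fintype 𝒴]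

theorem sum_innerSum_channelJoint_swap_add (hα : 0 < α) (hQ₁ : ∀ x, 0 ≤ Q₁ x)
    (hQ₂ : ∀ x, 0 ≤ Q₂ x) {a b : ℝ} (ha : 0 ≤ a) (hb : 0 ≤ b) (T : 𝒴 → ℝ) :
    ∑ x, innerSum α (channelJoint W (a • Q₁ + b • Q₂) ∘ Prod.swap) T x ^ (1 / α)
      = ENNReal.ofReal a * ∑ x, innerSum α (channelJoint W Q₁ ∘ Prod.swap) T x ^ (1 / α)
        + ENNReal.ofReal b * ∑ x, innerSum α (channelJoint W Q₂ ∘ Prod.swap) T x ^ (1 / α) := by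
  have hQ (x : 𝒳) : 0 ≤ (a • Q₁ + b • Q₂) x :=
    add_nonneg (mul_nonneg ha (hQ₁ x)) (mul_nonneg hb (hQ₂ x))
  simp only [innerSum_channelJoint_swap_rpow hα W hQ, innerSum_channelJoint_swap_rpow hα W hQ₁,
    innerSum_channelJoint_swap_rpow hα W hQ₂, Finset.mul_sum, ← Finset.sum_add_distrib,
    Pi.add_apply, Pi.smul_apply, smul_eq_mul, ENNReal.ofReal_add (mul_nonneg ha (hQ₁ _))
    (mul_nonneg hb (hQ₂ _)), ENNReal.ofReal_mul ha, ENNReal.ofReal_mul hb, add_mul, mul_assoc]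

theorem coe_mul_reducedObjective_channelJoint_swap_add_le (hα : 1 < α) (hQ₁ : ∀ x, 0 ≤ Q₁ x)
    (hQ₂ : ∀ x, 0 ≤ Q₂ x) {a b : ℝ} (ha : 0 < a) (hb : 0 < b) (hab : a + b = 1) (T : 𝒴 → ℝ) :
    (a : EReal) * reducedObjective α (channelJoint W Q₁ ∘ Prod.swap) T
        + (b : EReal) * reducedObjective α (channelJoint W Q₂ ∘ Prod.swap) T
      ≤ reducedObjective α (channelJoint W (a • Q₁ + b • Q₂) ∘ Prod.swap) T := by
  have hα0 : 0 < α := one_pos.trans hα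
  have hr : 0 < α * (α - 1)⁻¹ := mul_pos hα0 (inv_pos.2 (sub_pos.2 hα))
  simp only [reducedObjective_eq_log_rpow, ← ENNReal.rpow_mul]
  rw [← ENNReal.log_rpow, ← ENNReal.log_rpow, ← ENNReal.log_mul_add, ENNReal.log_le_log_iff,
    sum_innerSum_channelJoint_swap_add hα0 hQ₁ hQ₂ ha.le hb.le]
  simp only [← ENNReal.rpow_mul, mul_comm _ a, mul_comm _ b]
  rw [ENNReal.rpow_mul _ a, ENNReal.rpow_mul _ b, ← ENNReal.mul_rpow_of_nonneg _ _ hr.le]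
  exact ENNReal.rpow_le_rpow (rpow_mul_rpow_le_ofReal_mul_add_ofReal_mul ha hb hab _ _)
    hr.le

-- For fixed `T` the reduced objective is concave in the input distribution, and an infimum of
-- concave functions is concave.
theorem coe_mul_renyiJ_channelJoint_add_le_of_one_lt (hα : 1 < α)
    (hW : ∀ x, W x ∈ stdSimplex ℝ 𝒴) (hQ₁ : Q₁ ∈ stdSimplex ℝ 𝒳) (hQ₂ : Q₂ ∈ stdSimplex ℝ 𝒳)
    {a b : ℝ} (ha : 0 < a) (hb : 0 < b) (hab : a + b = 1) :
    (a : EReal) * renyiJ α (channelJoint W Q₁) + (b : EReal) * renyiJ α (channelJoint W Q₂)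
      ≤ renyiJ α (channelJoint W (a • Q₁ + b • Q₂)) := by
  have hleast {Q : 𝒳 → ℝ} (hQ : Q ∈ stdSimplex ℝ 𝒳) :=
    isLeast_renyiJ_reducedObjective (one_pos.trans hα) hα.ne'
      (comp_swap_mem_stdSimplex (channelJoint_mem_stdSimplex hW hQ))
  simp only [renyiJ_comp_swap] at hleast
  obtain ⟨T, hT, hmin⟩ := (hleast (convex_stdSimplex ℝ 𝒳 hQ₁ hQ₂ ha.le hb.le hab)).1
  rw [← hmin]
  exact (add_le_add
    (mul_le_mul_of_nonneg_left ((hleast hQ₁).2 ⟨T, hT, rfl⟩) (EReal.coe_nonneg.2 ha.le))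
    (mul_le_mul_of_nonneg_left ((hleast hQ₂).2 ⟨T, hT, rfl⟩) (EReal.coe_nonneg.2 hb.le))).trans
    (coe_mul_reducedObjective_channelJoint_swap_add_le hα hQ₁.1 hQ₂.1 ha hb hab T)

open Filter Topology in
theorem tendsto_coe_mul_renyiJ_add_one {P₁ P₂ : 𝒳 × 𝒴 → ℝ} (h₁ : P₁ ∈ stdSimplex ℝ (𝒳 × 𝒴))
    (h₂ : P₂ ∈ stdSimplex ℝ (𝒳 × 𝒴)) (a b : ℝ) :
    Tendsto (fun α : ℝ => (a : EReal) * renyiJ α P₁ + (b : EReal) * renyiJ α P₂) (𝓝[>] 1)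
      (𝓝 ((a : EReal) * renyiJ 1 P₁ + (b : EReal) * renyiJ 1 P₂)) := by
  have hmul {P : 𝒳 × 𝒴 → ℝ} (hP : P ∈ stdSimplex ℝ (𝒳 × 𝒴)) (c : ℝ) :=
    EReal.Tendsto.const_mul (tendsto_renyiJ_one hP) (.inl (EReal.coe_ne_bot c))
      (.inl (EReal.coe_ne_top c))
  have hfin : (a : EReal) * renyiJ 1 P₁ = ((a * (renyiJ 1 P₁).toReal : ℝ) : EReal) := by
    rw [EReal.coe_mul, coe_toReal_renyiJ one_pos h₁]
  exact (EReal.continuousAt_add (.inl (hfin ▸ EReal.coe_ne_top _))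
    (.inl (hfin ▸ EReal.coe_ne_bot _))).tendsto.comp ((hmul h₁ a).prodMk_nhds (hmul h₂ b))

theorem eConcaveOn_renyiJ_channelJoint (hα : 1 ≤ α) (hW : ∀ x, W x ∈ stdSimplex ℝ 𝒴) :
    EConcaveOn (stdSimplex ℝ 𝒳) fun Q => renyiJ α (channelJoint W Q) := by
  refine ⟨convex_stdSimplex ℝ _, fun Q₁ hQ₁ Q₂ hQ₂ a b ha hb hab => ?_⟩
  rcases ha.eq_or_lt with rfl | ha'
  · simp [show b = 1 by linarith]
  rcases hb.eq_or_lt with rfl | hb'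
  · simp [show a = 1 by linarith]
  rcases hα.eq_or_lt with rfl | hα1
  · refine le_of_tendsto_of_tendsto
      (tendsto_coe_mul_renyiJ_add_one (channelJoint_mem_stdSimplex hW hQ₁)
        (channelJoint_mem_stdSimplex hW hQ₂) a b)
      (tendsto_renyiJ_one (channelJoint_mem_stdSimplex hW
        (convex_stdSimplex ℝ 𝒳 hQ₁ hQ₂ ha hb hab))) ?_
    filter_upwards [self_mem_nhdsWithin] with β hβ
    exact coe_mul_renyiJ_channelJoint_add_le_of_one_lt hβ hW hQ₁ hQ₂ ha' hb' hab
  · exact coe_mul_renyiJ_channelJoint_add_le_of_one_lt hα1 hW hQ₁ hQ₂ ha' hb' hab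

end Channel

section Diagonal

variable {𝒳 : Type*} {α : ℝ} {P : 𝒳 → ℝ}

open Classical in
/-- The joint probability mass function of the pair `(X, X)` when `X` has distribution `P`. -/
noncomputable def diagJoint (P : 𝒳 → ℝ) : 𝒳 × 𝒳 → ℝ :=
  fun q => if q.1 = q.2 then P q.1 else 0

theorem coe_mul_minEntropy {x₀ : 𝒳} (hx₀ : 0 < P x₀) (hmax : ∀ x, P x ≤ P x₀) (α : ℝ) :
    ((α / (1 - α) * minEntropy P : ℝ) : EReal)
      = ENNReal.log (ENNReal.ofReal (P x₀) ^ (α / (α - 1))) := by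
  have : Nonempty 𝒳 := ⟨x₀⟩
  have hsup : ⨆ x, P x = P x₀ :=
    (ciSup_le hmax).antisymm (le_ciSup ⟨P x₀, Set.forall_mem_range.2 hmax⟩ x₀)
  rw [ENNReal.log_rpow, ENNReal.log_ofReal_of_pos hx₀, ← EReal.coe_mul, minEntropy, hsup,
    ← neg_sub α 1, div_neg, neg_mul_neg]

variable [Fintype 𝒳]

theorem margFst_diagJoint (P : 𝒳 → ℝ) : margFst (diagJoint P) = P := by
  classical
  funext x
  simp [margFst, diagJoint]

theorem margSnd_diagJoint (P : 𝒳 → ℝ) : margSnd (diagJoint P) = P := by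
  classical
  funext x
  simp [margSnd, diagJoint]

theorem diagJoint_mem_stdSimplex (hP : P ∈ stdSimplex ℝ 𝒳) :
    diagJoint P ∈ stdSimplex ℝ (𝒳 × 𝒳) := by
  classical
  refine ⟨fun q => ite_nonneg (hP.1 _) le_rfl, ?_⟩
  rw [Fintype.sum_prod_type]
  exact (Finset.sum_congr rfl fun x _ => congrFun (margFst_diagJoint P) x).trans hP.2

theorem mutualInfoReal_diagJoint (P : 𝒳 → ℝ) :
    mutualInfoReal (diagJoint P) = renyiEntropy 1 P := by
  rw [renyiEntropy, if_pos rfl, mutualInfoReal, relEntropyReal, Fintype.sum_prod_type]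
  refine Finset.sum_congr rfl fun x _ => ?_
  rw [Finset.sum_eq_single x (fun y _ hy => by simp [diagJoint, hy.symm]) (by simp)]
  simp only [prodPmf, margFst_diagJoint, margSnd_diagJoint, diagJoint, if_true]
  by_cases h : P x = 0
  · simp [h]
  · rw [← div_div, div_self h]

theorem innerSum_diagJoint (hα : 0 < α) (P Q : 𝒳 → ℝ) (y : 𝒳) :
    innerSum α (diagJoint P) Q y = ENNReal.ofReal (P y) ^ α * ENNReal.ofReal (Q y) ^ (1 - α) := by
  rw [innerSum, Finset.sum_eq_single y (fun x _ hx => by simp [diagJoint, hx, hα]) (by simp)]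
  simp only [diagJoint, if_true]

theorem reducedObjective_diagJoint (hα : 0 < α) (P Q : 𝒳 → ℝ) :
    reducedObjective α (diagJoint P) Q
      = ENNReal.log ((∑ x, ENNReal.ofReal (P x) * ENNReal.ofReal (Q x) ^ ((1 - α) / α))
          ^ (α / (α - 1))) := by
  rw [reducedObjective_eq_log_rpow, ← ENNReal.rpow_mul, ← div_eq_mul_inv]
  congr 3 with y
  rw [innerSum_diagJoint hα, ENNReal.mul_rpow_of_nonneg _ _ (by positivity), ← ENNReal.rpow_mul,
    ← ENNReal.rpow_mul, mul_one_div_cancel hα.ne', ENNReal.rpow_one, mul_one_div]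

theorem sum_rpow_pos (hP : P ∈ stdSimplex ℝ 𝒳) (r : ℝ) : 0 < ∑ x, P x ^ r :=
  let ⟨x₀, hx₀⟩ := exists_pos_of_mem_stdSimplex hP
  Finset.sum_pos' (fun x _ => Real.rpow_nonneg (hP.1 x) r)
    ⟨x₀, Finset.mem_univ x₀, Real.rpow_pos_of_pos hx₀ r⟩

theorem sum_ofReal_rpow (hP : ∀ x, 0 ≤ P x) {r : ℝ} (hr : 0 ≤ r) :
    ∑ x, ENNReal.ofReal (P x) ^ r = ENNReal.ofReal (∑ x, P x ^ r) := by
  rw [ENNReal.ofReal_sum_of_nonneg fun x _ => Real.rpow_nonneg (hP x) r]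
  exact Finset.sum_congr rfl fun x _ => ENNReal.ofReal_rpow_of_nonneg (hP x) hr

theorem coe_renyiEntropy_one_div {β : ℝ} (hβ : 0 < β) (hβ1 : β ≠ 1) (hP : P ∈ stdSimplex ℝ 𝒳) :
    (renyiEntropy (1 / β) P : EReal)
      = ENNReal.log (((∑ x, ENNReal.ofReal (P x) ^ (1 / β)) ^ β) ^ (β - 1)⁻¹) := by
  rw [sum_ofReal_rpow hP.1 (by positivity), ← ENNReal.rpow_mul, ENNReal.log_rpow,
    ENNReal.log_ofReal_of_pos (sum_rpow_pos hP _), ← EReal.coe_mul, EReal.coe_eq_coe_iff,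
    renyiEntropy, if_neg fun h => hβ1 (by simpa using h), one_sub_div hβ.ne', one_div_div,
    div_eq_mul_inv]

theorem isLeast_renyiEntropy_one_div {β : ℝ} (hβ : 0 < β) (hβ1 : β ≠ 1)
    (hP : P ∈ stdSimplex ℝ 𝒳) :
    IsLeast ((fun Q : 𝒳 → ℝ => ENNReal.log
        ((∑ x, ENNReal.ofReal (P x) * ENNReal.ofReal (Q x) ^ (1 - β)) ^ (β - 1)⁻¹)) ''
          stdSimplex ℝ 𝒳) (renyiEntropy (1 / β) P) := by
  have hsum := sum_ofReal_rpow hP.1 (r := 1 / β) (by positivity)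
  have h0 : ∑ x, ENNReal.ofReal (P x) ^ (1 / β) ≠ 0 :=
    hsum ▸ (ENNReal.ofReal_pos.2 (sum_rpow_pos hP _)).ne'
  have htop : ∑ x, ENNReal.ofReal (P x) ^ (1 / β) ≠ ⊤ := hsum ▸ ENNReal.ofReal_ne_top
  have hE := escort_mem_stdSimplex h0 htop
  simp only [log_sum_mul_rpow_eq_add_renyiDiv_escort hβ hβ1 h0 htop,
    ← coe_renyiEntropy_one_div hβ hβ1 hP]
  refine ⟨⟨_, hE, by simp only [renyiDiv_self hβ hE, add_zero]⟩, ?_⟩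
  rintro _ ⟨Q, hQ, rfl⟩
  exact le_add_of_nonneg_right (renyiDiv_nonneg hβ hE hQ)

theorem renyiJ_diagJoint_of_half_lt (hα : 1 / 2 < α) (hP : P ∈ stdSimplex ℝ 𝒳) :
    renyiJ α (diagJoint P) = (renyiEntropy (α / (2 * α - 1)) P : EReal) := by
  have hα0 : 0 < α := by linarith
  have hmem := diagJoint_mem_stdSimplex hP
  rcases eq_or_ne α 1 with rfl | hα1
  · rw [renyiJ_one hmem, mutualInfo_eq_coe hmem, mutualInfoReal_diagJoint]
    norm_num
  have hβ1 : (2 * α - 1) / α ≠ 1 := fun h => hα1 (by linarith [(div_eq_one_iff_eq hα0.ne').1 h])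
  have hexp : 1 - (2 * α - 1) / α = (1 - α) / α := by field_simp; ring
  have hinv : ((2 * α - 1) / α - 1)⁻¹ = α / (α - 1) := by
    rw [← neg_sub 1, hexp, ← neg_div, neg_sub, inv_div]
  have hleast := isLeast_renyiEntropy_one_div (div_pos (by linarith) hα0) hβ1 hP
  simp only [hexp, hinv, ← reducedObjective_diagJoint hα0, one_div_div] at hleast
  exact (isLeast_renyiJ_reducedObjective hα0 hα1 hmem).unique hleast

theorem sum_ofReal_mul_rpow_le {Q : 𝒳 → ℝ} (hQ : Q ∈ stdSimplex ℝ 𝒳) {r c : ℝ} (hr : 1 ≤ r)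
    (hc : ∀ x, P x ≤ c) :
    ∑ x, ENNReal.ofReal (P x) * ENNReal.ofReal (Q x) ^ r ≤ ENNReal.ofReal c := by
  calc ∑ x, ENNReal.ofReal (P x) * ENNReal.ofReal (Q x) ^ r
      ≤ ∑ x, ENNReal.ofReal c * ENNReal.ofReal (Q x) :=
        Finset.sum_le_sum fun x _ => mul_le_mul' (ENNReal.ofReal_le_ofReal (hc x)) <|
          ENNReal.rpow_le_self_of_le_one
            (ENNReal.ofReal_le_one.2 ((mem_Icc_of_mem_stdSimplex hQ x).2)) hr
    _ = ENNReal.ofReal c := by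
        rw [← Finset.mul_sum, ← ENNReal.ofReal_sum_of_nonneg fun x _ => hQ.1 x, hQ.2,
          ENNReal.ofReal_one, mul_one]

theorem renyiJ_diagJoint_of_le_half (hα0 : 0 < α) (hα : α ≤ 1 / 2) (hP : P ∈ stdSimplex ℝ 𝒳) :
    renyiJ α (diagJoint P) = ((α / (1 - α) * minEntropy P : ℝ) : EReal) := by
  classical
  obtain ⟨x₁, hx₁⟩ := exists_pos_of_mem_stdSimplex hP
  have : Nonempty 𝒳 := ⟨x₁⟩
  obtain ⟨x₀, hmax⟩ := Finite.exists_max P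
  have hα1 : α < 1 := by linarith
  have hc : α / (α - 1) < 0 := div_neg_of_pos_of_neg hα0 (by linarith)
  have hr : 1 ≤ (1 - α) / α := (one_le_div hα0).2 (by linarith)
  have hleast := isLeast_renyiJ_reducedObjective hα0 hα1.ne (diagJoint_mem_stdSimplex hP)
  have hval := coe_mul_minEntropy (hx₁.trans_le (hmax x₁)) hmax α
  refine le_antisymm ((hleast.2 ⟨_, single_mem_stdSimplex ℝ x₀, rfl⟩).trans_eq ?_) ?_
  · rw [reducedObjective_diagJoint hα0, hval, Finset.sum_eq_single x₀
      (fun x _ hx => by simp [hx, one_pos.trans_le hr]) (by simp)]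
    simp
  · obtain ⟨Q, hQ, hmin⟩ := hleast.1
    rw [← hmin, reducedObjective_diagJoint hα0, hval, ENNReal.log_le_log_iff,
      rpow_le_rpow_iff_of_neg hc]
    exact sum_ofReal_mul_rpow_le hQ hr hmax

end Diagonal

section RandomVariables

variable {Ω 𝒳 𝒴 𝒵 : Type*} [MeasurableSpace Ω] {μ : Measure Ω} {X : Ω → 𝒳} {Y : Ω → 𝒴} {Z : Ω → 𝒵}

theorem pmf_comp_of_injective {f : 𝒳 → 𝒴} (hf : Function.Injective f) (X : Ω → 𝒳) (x : 𝒳) :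
    pmf μ (fun ω => f (X ω)) (f x) = pmf μ X x := by
  simp only [pmf, Set.preimage, Set.mem_singleton_iff, hf.eq_iff]

theorem jointPmf_comp_swap (μ : Measure Ω) (X : Ω → 𝒳) (Y : Ω → 𝒴) :
    jointPmf μ X Y ∘ Prod.swap = jointPmf μ Y X :=
  funext fun p => (pmf_comp_of_injective Prod.swap_injective _ p.swap).symm

theorem jointPmf_self (μ : Measure Ω) (X : Ω → 𝒳) : jointPmf μ X X = diagJoint (pmf μ X) := by
  classical
  funext ⟨x, y⟩
  rw [jointPmf, diagJoint]
  split_ifs with h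
  · obtain rfl : x = y := h
    exact pmf_comp_of_injective (f := fun x => (x, x)) (fun _ _ h => congrArg Prod.fst h) X x
  · have hempty : (fun ω => (X ω, X ω)) ⁻¹' {(x, y)} = ∅ :=
      Set.eq_empty_of_forall_notMem fun ω hω =>
        h ((congrArg Prod.fst hω).symm.trans (congrArg Prod.snd hω))
    rw [pmf, hempty, measureReal_empty]

theorem renyiJRV_comm [Fintype 𝒳] [Fintype 𝒴] (μ : Measure Ω) (α : ℝ) (X : Ω → 𝒳) (Y : Ω → 𝒴) :
    renyiJRV μ α X Y = renyiJRV μ α Y X := by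
  rw [renyiJRV, renyiJRV, ← jointPmf_comp_swap μ X Y, renyiJ_comp_swap]

theorem margFst_jointPmf [Fintype 𝒴] [MeasurableSpace 𝒴] [MeasurableSingletonClass 𝒴]
    [IsFiniteMeasure μ] (X : Ω → 𝒳) (hY : Measurable Y) :
    margFst (jointPmf μ X Y) = pmf μ X := by
  funext x
  have hjoint (y : 𝒴) : jointPmf μ X Y (x, y) = (μ.restrict (X ⁻¹' {x})).real (Y ⁻¹' {y}) := by
    rw [measureReal_restrict_apply (hY (measurableSet_singleton y)), jointPmf, pmf]
    congr 1
    ext ω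
    simp [and_comm]
  simp only [margFst, hjoint]
  rw [sum_measureReal_preimage_singleton _ fun y _ => hY (measurableSet_singleton y),
    Finset.coe_univ, Set.preimage_univ, measureReal_restrict_apply_univ, pmf]

theorem margSnd_jointPmf [Fintype 𝒳] [MeasurableSpace 𝒳] [MeasurableSingletonClass 𝒳]
    [IsFiniteMeasure μ] (hX : Measurable X) (Y : Ω → 𝒴) :
    margSnd (jointPmf μ X Y) = pmf μ Y := by
  rw [← margFst_jointPmf Y hX, ← jointPmf_comp_swap]
  rfl

section Measurable

variable [MeasurableSpace 𝒳] [MeasurableSingletonClass 𝒳]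
variable [MeasurableSpace 𝒴] [MeasurableSingletonClass 𝒴]

theorem pmf_eq_map (hX : Measurable X) (x : 𝒳) : pmf μ X x = (μ.map X).real {x} :=
  (map_measureReal_apply hX (measurableSet_singleton x)).symm

theorem indepFun_iff_jointPmf_eq_prodPmf [Countable 𝒳] [Countable 𝒴] [IsFiniteMeasure μ]
    (hX : Measurable X) (hY : Measurable Y) :
    IndepFun X Y μ ↔ jointPmf μ X Y = prodPmf (pmf μ X) (pmf μ Y) := by
  rw [indepFun_iff_map_prod_eq_prod_map_map hX.aemeasurable hY.aemeasurable,
    ext_iff_measureReal_singleton, funext_iff]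
  refine forall_congr' fun p => ?_
  rw [jointPmf, pmf_eq_map (hX.prodMk hY), prodPmf, pmf_eq_map hX, pmf_eq_map hY,
    ← measureReal_prod_prod, Set.singleton_prod_singleton]

variable [Fintype 𝒳] [Fintype 𝒴] [IsProbabilityMeasure μ]

theorem pmf_mem_stdSimplex (hX : Measurable X) : pmf μ X ∈ stdSimplex ℝ 𝒳 := by
  refine ⟨fun x => measureReal_nonneg, ?_⟩
  simp only [pmf]
  rw [sum_measureReal_preimage_singleton _ fun x _ => hX (measurableSet_singleton x),
    Finset.coe_univ, Set.preimage_univ, probReal_univ]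

theorem jointPmf_mem_stdSimplex (hX : Measurable X) (hY : Measurable Y) :
    jointPmf μ X Y ∈ stdSimplex ℝ (𝒳 × 𝒴) :=
  pmf_mem_stdSimplex (hX.prodMk hY)

theorem renyiJRV_eq_zero_iff_indepFun {α : ℝ} (hα : 0 < α) (hX : Measurable X)
    (hY : Measurable Y) : renyiJRV μ α X Y = 0 ↔ IndepFun X Y μ := by
  rw [renyiJRV, renyiJ_eq_zero_iff hα (jointPmf_mem_stdSimplex hX hY), margFst_jointPmf X hY,
    margSnd_jointPmf hX Y, indepFun_iff_jointPmf_eq_prodPmf hX hY]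

theorem renyiJRV_self_of_half_lt {α : ℝ} (hα : 1 / 2 < α) (hX : Measurable X) :
    renyiJRV μ α X X = (renyiEntropy (α / (2 * α - 1)) (pmf μ X) : EReal) := by
  rw [renyiJRV, jointPmf_self, renyiJ_diagJoint_of_half_lt hα (pmf_mem_stdSimplex hX)]

theorem renyiJRV_self_of_le_half {α : ℝ} (hα0 : 0 < α) (hα : α ≤ 1 / 2) (hX : Measurable X) :
    renyiJRV μ α X X = ((α / (1 - α) * minEntropy (pmf μ X) : ℝ) : EReal) := by
  rw [renyiJRV, jointPmf_self, renyiJ_diagJoint_of_le_half hα0 hα (pmf_mem_stdSimplex hX)]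

end Measurable

section MarkovChain

theorem pmf_eq_zero_of_pmf_comp_eq_zero [IsFiniteMeasure μ] {x : 𝒳} (f : 𝒳 → 𝒴)
    (h : pmf μ (fun ω => f (X ω)) (f x) = 0) : pmf μ X x = 0 :=
  measureReal_mono_null (fun _ hω => congrArg f hω) h

open Classical in
/-- The conditional probability mass function of `Z` given `Y = y`. When `P(Y = y) = 0` it is set
to the distribution of `Z`, so that it is a probability mass function for every `y`. -/
noncomputable def condPmf (μ : Measure Ω) (Y : Ω → 𝒴) (Z : Ω → 𝒵) (y : 𝒴) : 𝒵 → ℝ :=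
  if pmf μ Y y = 0 then pmf μ Z else fun z => jointPmf μ Y Z (y, z) / pmf μ Y y

theorem pmf_eq_jointPmf_mul_condPmf [IsFiniteMeasure μ] (h : IsMarkovChain μ X Y Z) (x : 𝒳)
    (y : 𝒴) (z : 𝒵) :
    pmf μ (fun ω => (X ω, Y ω, Z ω)) (x, y, z) = jointPmf μ X Y (x, y) * condPmf μ Y Z y z := by
  by_cases hy : pmf μ Y y = 0
  · rw [pmf_eq_zero_of_pmf_comp_eq_zero (fun p : 𝒳 × 𝒴 × 𝒵 => p.2.1) hy, jointPmf,
      pmf_eq_zero_of_pmf_comp_eq_zero (fun p : 𝒳 × 𝒴 => p.2) hy, zero_mul]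
  · rw [condPmf, if_neg hy, ← mul_div_assoc, ← h x y z, mul_div_cancel_right₀ _ hy]

theorem condPmf_mem_stdSimplex [Fintype 𝒵] [MeasurableSpace 𝒵] [MeasurableSingletonClass 𝒵]
    [IsProbabilityMeasure μ] (Y : Ω → 𝒴) (hZ : Measurable Z) (y : 𝒴) :
    condPmf μ Y Z y ∈ stdSimplex ℝ 𝒵 := by
  rw [condPmf]
  split_ifs with hy
  · exact pmf_mem_stdSimplex hZ
  · refine ⟨fun z => div_nonneg measureReal_nonneg measureReal_nonneg, ?_⟩
    rw [← Finset.sum_div, div_eq_one_iff_eq hy]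
    exact congrFun (margFst_jointPmf Y hZ) y

variable [Fintype 𝒴] [MeasurableSpace 𝒴] [MeasurableSingletonClass 𝒴]

theorem jointPmf_eq_sum_condPmf [IsFiniteMeasure μ] (hY : Measurable Y)
    (h : IsMarkovChain μ X Y Z) :
    jointPmf μ X Z = fun p => ∑ y, jointPmf μ X Y (p.1, y) * condPmf μ Y Z y p.2 := by
  funext p
  have hmarg := congrFun (margFst_jointPmf (μ := μ) (fun ω => (X ω, Z ω)) hY) p
  rw [jointPmf, ← hmarg, margFst]
  refine Finset.sum_congr rfl fun y _ => ?_
  rw [← pmf_eq_jointPmf_mul_condPmf h]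
  have hinj : Function.Injective fun q : 𝒳 × 𝒴 × 𝒵 => ((q.1, q.2.2), q.2.1) :=
    fun q q' hq => by simp_all [Prod.ext_iff]
  exact pmf_comp_of_injective hinj (fun ω => (X ω, Y ω, Z ω)) (p.1, y, p.2)

theorem renyiJRV_le_of_isMarkovChain [Fintype 𝒳] [MeasurableSpace 𝒳] [MeasurableSingletonClass 𝒳]
    [Fintype 𝒵] [MeasurableSpace 𝒵] [MeasurableSingletonClass 𝒵] [IsProbabilityMeasure μ]
    {α : ℝ} (hα : 0 < α) (hX : Measurable X) (hY : Measurable Y) (hZ : Measurable Z)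
    (h : IsMarkovChain μ X Y Z) : renyiJRV μ α X Z ≤ renyiJRV μ α X Y := by
  rw [renyiJRV, jointPmf_eq_sum_condPmf hY h]
  exact renyiJ_kernel_le hα (jointPmf_mem_stdSimplex hX hY) (condPmf_mem_stdSimplex Y hZ)

end MarkovChain

section Additivity

variable {𝒳₁ 𝒳₂ 𝒴₁ 𝒴₂ : Type*}
  [MeasurableSpace 𝒳₁] [MeasurableSingletonClass 𝒳₁]
  [MeasurableSpace 𝒳₂] [MeasurableSingletonClass 𝒳₂]
  [MeasurableSpace 𝒴₁] [MeasurableSingletonClass 𝒴₁]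
  [MeasurableSpace 𝒴₂] [MeasurableSingletonClass 𝒴₂]
  {X₁ : Ω → 𝒳₁} {X₂ : Ω → 𝒳₂} {Y₁ : Ω → 𝒴₁} {Y₂ : Ω → 𝒴₂}

theorem jointPmf_prodMk_of_indepFun [Countable 𝒳₁] [Countable 𝒳₂] [Countable 𝒴₁] [Countable 𝒴₂]
    [IsFiniteMeasure μ] (hX₁ : Measurable X₁) (hX₂ : Measurable X₂) (hY₁ : Measurable Y₁)
    (hY₂ : Measurable Y₂)
    (h : IndepFun (fun ω => (X₁ ω, Y₁ ω)) (fun ω => (X₂ ω, Y₂ ω)) μ) :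
    jointPmf μ (fun ω => (X₁ ω, X₂ ω)) (fun ω => (Y₁ ω, Y₂ ω))
      = prodJoint (jointPmf μ X₁ Y₁) (jointPmf μ X₂ Y₂) := by
  rw [indepFun_iff_jointPmf_eq_prodPmf (hX₁.prodMk hY₁) (hX₂.prodMk hY₂)] at h
  funext p
  exact (pmf_comp_of_injective (Equiv.prodProdProdComm 𝒳₁ 𝒳₂ 𝒴₁ 𝒴₂).injective _ p).symm.trans
    (congrFun h _)

theorem renyiJRV_prodMk_of_indepFun [Fintype 𝒳₁] [Fintype 𝒳₂] [Fintype 𝒴₁] [Fintype 𝒴₂]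
    [IsProbabilityMeasure μ] {α : ℝ} (hα : 0 < α) (hX₁ : Measurable X₁) (hX₂ : Measurable X₂)
    (hY₁ : Measurable Y₁) (hY₂ : Measurable Y₂)
    (h : IndepFun (fun ω => (X₁ ω, Y₁ ω)) (fun ω => (X₂ ω, Y₂ ω)) μ) :
    renyiJRV μ α (fun ω => (X₁ ω, X₂ ω)) (fun ω => (Y₁ ω, Y₂ ω))
      = renyiJRV μ α X₁ Y₁ + renyiJRV μ α X₂ Y₂ := by
  rw [renyiJRV, jointPmf_prodMk_of_indepFun hX₁ hX₂ hY₁ hY₂ h]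
  exact renyiJ_prodJoint hα (jointPmf_mem_stdSimplex hX₁ hY₁) (jointPmf_mem_stdSimplex hX₂ hY₂)

end Additivity

end RandomVariables

end RenyiDep

theorem theorem1
    {Ω 𝒳 𝒳₁ 𝒳₂ 𝒴 𝒴₁ 𝒴₂ 𝒵 : Type*} [MeasurableSpace Ω]
    [Fintype 𝒳] [MeasurableSpace 𝒳] [MeasurableSingletonClass 𝒳]
    [Fintype 𝒳₁] [MeasurableSpace 𝒳₁] [MeasurableSingletonClass 𝒳₁]
    [Fintype 𝒳₂] [MeasurableSpace 𝒳₂] [MeasurableSingletonClass 𝒳₂]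
    [Fintype 𝒴] [MeasurableSpace 𝒴] [MeasurableSingletonClass 𝒴]
    [Fintype 𝒴₁] [MeasurableSpace 𝒴₁] [MeasurableSingletonClass 𝒴₁]
    [Fintype 𝒴₂] [MeasurableSpace 𝒴₂] [MeasurableSingletonClass 𝒴₂]
    [Fintype 𝒵] [MeasurableSpace 𝒵] [MeasurableSingletonClass 𝒵]
    (μ : Measure Ω) [IsProbabilityMeasure μ]
    (X : Ω → 𝒳) (hX : Measurable X) (X₁ : Ω → 𝒳₁) (hX₁ : Measurable X₁)
    (X₂ : Ω → 𝒳₂) (hX₂ : Measurable X₂) (Y : Ω → 𝒴) (hY : Measurable Y)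
    (Y₁ : Ω → 𝒴₁) (hY₁ : Measurable Y₁) (Y₂ : Ω → 𝒴₂) (hY₂ : Measurable Y₂)
    (Z : Ω → 𝒵) (hZ : Measurable Z) :
    -- the minimum in the definition of `J_α(X;Y)` is attained
    (∀ α : ℝ, 0 < α → ∃ QX ∈ stdSimplex ℝ 𝒳, ∃ QY ∈ stdSimplex ℝ 𝒴,
      renyiJRV μ α X Y = renyiDiv α (jointPmf μ X Y) (prodPmf QX QY)) ∧
    -- nonnegativity
    (∀ α : ℝ, 0 < α → 0 ≤ renyiJRV μ α X Y ∧ (renyiJRV μ α X Y = 0 ↔ IndepFun X Y μ)) ∧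
    -- symmetry
    (∀ α : ℝ, 0 < α → renyiJRV μ α X Y = renyiJRV μ α Y X) ∧
    -- data-processing inequality
    (∀ α : ℝ, 0 < α → IsMarkovChain μ X Y Z → renyiJRV μ α X Z ≤ renyiJRV μ α X Y) ∧
    -- additivity
    (∀ α : ℝ, 0 < α → IndepFun (fun ω => (X₁ ω, Y₁ ω)) (fun ω => (X₂ ω, Y₂ ω)) μ →
      renyiJRV μ α (fun ω => (X₁ ω, X₂ ω)) (fun ω => (Y₁ ω, Y₂ ω))
        = renyiJRV μ α X₁ Y₁ + renyiJRV μ α X₂ Y₂) ∧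
    -- upper bounds
    (∀ α : ℝ, 0 < α →
      renyiJRV μ α X Y ≤ ((Real.log (Fintype.card 𝒳) : ℝ) : EReal) ∧
      renyiJRV μ α X Y ≤ ((Real.log (Fintype.card 𝒴) : ℝ) : EReal)) ∧
    -- order one
    (renyiJRV μ 1 X Y = mutualInfo (jointPmf μ X Y)) ∧
    -- continuity and monotonicity in the order
    (ContinuousOn (fun α : ℝ => renyiJRV μ α X Y) (Set.Ioi 0) ∧
      MonotoneOn (fun α : ℝ => renyiJRV μ α X Y) (Set.Ioi 0)) ∧
    -- minimization over `Q_X` alone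
    (∀ α : ℝ, 0 < α → α ≠ 1 →
      IsLeast (reducedObjective α (jointPmf μ X Y) '' stdSimplex ℝ 𝒳) (renyiJRV μ α X Y) ∧
      (1 / 2 ≤ α → EConvexOn (stdSimplex ℝ 𝒳) (reducedObjective α (jointPmf μ X Y)))) ∧
    -- variational formula for orders below one
    (∀ α : ℝ, 0 < α → α < 1 →
      IsLeast (dualObjective α (jointPmf μ X Y) '' stdSimplex ℝ (𝒳 × 𝒴)) (renyiJRV μ α X Y)) ∧
    -- variational formula for orders above one
    (∀ α : ℝ, 1 < α →
      IsGreatest (dualObjective α (jointPmf μ X Y) '' stdSimplex ℝ (𝒳 × 𝒴)) (renyiJRV μ α X Y) ∧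
      EStrictConcaveOn (stdSimplex ℝ (𝒳 × 𝒴)) (dualObjective α (jointPmf μ X Y)) ∧
      ∀ R ∈ stdSimplex ℝ (𝒳 × 𝒴),
        IsMaxOn (dualObjective α (jointPmf μ X Y)) (stdSimplex ℝ (𝒳 × 𝒴)) R ↔
          dualObjective α (jointPmf μ X Y) R
            = renyiDiv α (jointPmf μ X Y) (prodPmf (margFst R) (margSnd R))) ∧
    -- concavity in `P_X` for a fixed conditional probability mass function `W = P_{Y|X}`
    (∀ α : ℝ, 1 ≤ α → ∀ W : 𝒳 → 𝒴 → ℝ, (∀ x, W x ∈ stdSimplex ℝ 𝒴) →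
      EConcaveOn (stdSimplex ℝ 𝒳) (fun PX => renyiJ α (fun p => PX p.1 * W p.1 p.2))) ∧
    -- self-information
    (∀ α : ℝ, (1 / 2 < α →
        renyiJRV μ α X X = ((renyiEntropy (α / (2 * α - 1)) (pmf μ X) : ℝ) : EReal)) ∧
      (0 < α → α ≤ 1 / 2 →
        renyiJRV μ α X X = ((α / (1 - α) * minEntropy (pmf μ X) : ℝ) : EReal))) := by
  have hP := jointPmf_mem_stdSimplex (μ := μ) hX hY
  exact
    ⟨fun α hα => exists_renyiJ_eq hα hP,
      fun α hα => ⟨renyiJ_nonneg hα hP, renyiJRV_eq_zero_iff_indepFun hα hX hY⟩,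
      fun α _ => renyiJRV_comm μ α X Y,
      fun α hα => renyiJRV_le_of_isMarkovChain hα hX hY hZ,
      fun α hα => renyiJRV_prodMk_of_indepFun hα hX₁ hX₂ hY₁ hY₂,
      fun α hα => ⟨renyiJ_le_log_card hα hP, renyiJ_le_log_card_right hα hP⟩,
      renyiJ_one hP,
      ⟨continuousOn_renyiJ hP, monotoneOn_renyiJ hP⟩,
      fun α hα hα1 =>
        ⟨isLeast_renyiJ_reducedObjective hα hα1 hP, fun h => eConvexOn_reducedObjective h hα1 hP⟩,
      fun α hα hα1 => isLeast_dualObjective hα hα1 hP,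
      fun α hα =>
        ⟨isGreatest_dualObjective hα hP, eStrictConcaveOn_dualObjective hα hP.1,
          fun R hR => isMaxOn_dualObjective_iff hα hP hR⟩,
      fun α hα W hW => eConcaveOn_renyiJ_channelJoint hα hW,
      fun α => ⟨fun hα => renyiJRV_self_of_half_lt hα hX,
        fun hα0 hα => renyiJRV_self_of_le_half hα0 hα hX⟩⟩
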